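/- Let $\mathbb H$ be the upper half-plane, $q=e^{2\pi i\tau}$, $y=e^{2\pi i z}$ for $(\tau,z)\in\mathbb H\times\mathbb C$. For an integer $m\ge 0$, a weak Jacobi form of weight $0$ and index $m$ is a holomorphic function $\phi$ on $\mathbb H\times\mathbb C$ such that $$\phi\Bigl(\frac{a\tau+b}{c\tau+d},\frac{z}{c\tau+d}\Bigr)=e^{2\pi i m c z^2/(c\tau+d)}\phi(\tau,z)\quad\text{for all }\begin{pmatrix}a&b\\c&d\end{pmatrix}\in SL_2(\mathbb Z),$$ $$\phi(\tau,z+\lambda\tau+\mu)=e^{-2\pi i m(\lambda^2\tau+2\lambda z)}\phi(\tau,z)\quad\text{for all }\lambda,\mu\in\mathbb Z,$$ and which has a Fourier expansion $\phi(\tau,z)=\sum_{n\ge 0,\ l\in\mathbb Z}f(n,l)q^ny^l$. Its $q^0$-term is $[\phi]_{q^0}=\sum_l f(0,l)y^l$. Let $J^{\mathbb Z}_{0,m}$ be the $\mathbb Z$-module of all such forms with all $f(n,l)\in\mathbb Z$, let $J^{\mathbb Z}_{0,m}(q)$ be the submodule of those with $[\phi]_{q^0}=0$, and let $J^{\mathbb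 Z}_{0,*}=\bigoplus_{m\ge 0}J^{\mathbb Z}_{0,m}$, a graded ring. Let $\vartheta(\tau,z)=\sum_{n\in\mathbb Z}\left(\frac{-4}{n}\right)q^{n^2/8}y^{n/2}$, let $\eta$ be the Dedekind eta function, let $\left(\frac{\cdot}{\cdot}\right)$ denote the Kronecker symbol, and put $$\phi_{0,2}(\tau,z)=\tfrac12\,\eta(\tau)^{-4}\sum_{m,n\in\mathbb Z}(3m-n)\left(\frac{-4}{m}\right)\left(\frac{12}{n}\right)q^{(3m^2+n^2)/24}y^{(m+n)/2},$$ $$\phi_{0,3}(\tau,z)=\left(\frac{\vartheta(\tau,2z)}{\vartheta(\tau,z)}\right)^2,\qquad \phi_{0,4}(\tau,z)=\frac{\vartheta(\tau,3z)}{\vartheta(\tau,z)},$$ where the quotients are extended by continuity to the zeros of $\vartheta(\tau,z)$. **Theorem.** 1. Let $m\ge 1$. The quotient $J^{\mathbb Z}_{0,m}/J^{\mathbb Z}_{0,m}(q)$ is a free $\mathbb Z$-module of rank $m$. It has a basis consisting of the classes of forms $\psi^{(n)}_{0,m}\in J^{\mathbb Z}_{0,m}$ $(1\le n\le m)$ with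 the following $q^0$-terms: $$[\psi^{(n)}_{0,m}]_{q^0}=y^n+\dots+y^{-n}\qquad(3\le n\le m),$$ that is, a Laurent polynomial in $y$ with coefficient $1$ at $y^{n}$ and at $y^{-n}$ and with no terms $y^l$, $|l|>n$; $$[\psi^{(2)}_{0,m}]_{q^0}=y^2-4y+6-4y^{-1}+y^{-2}\qquad(\text{if }m\ge 2);$$ $$[\psi^{(1)}_{0,m}]_{q^0}=\frac{1}{(12,m)}\bigl(my+(12-2m)+my^{-1}\bigr),$$ where $(12,m)$ is the greatest common divisor of $12$ and $m$. 2. There is a unique weak Jacobi form $\phi_{0,1}$ of weight $0$ and index $1$ with $[\phi_{0,1}]_{q^0}=y+10+y^{-1}$, it has integral Fourier coefficients, and $\phi_{0,n}\in J^{\mathbb Z}_{0,n}$ for $n=1,2,3,4$. The graded ring $J^{\mathbb Z}_{0,*}$ is generated by these four forms, $$J^{\mathbb Z}_{0,*}=\mathbb Z[\phi_{0,1},\phi_{0,2},\phi_{0,3},\phi_{0,4}],$$ the forms $\phi_{0,1},\phi_{0,2},\phi_{0,3}$ are algebraically independent over $\mathbb Z$, and $4\phi_{0,4}=\phi_{0,1}\phi_{0,3}-\phi_{0,2}^2$.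 -/

import Mathlib

open Complex
open UpperHalfPlane hiding I
open scoped Real MatrixGroups Topology DirectSum

namespace WeakJacobi

/-- The monomial `q ^ n * y ^ l`, where `q = exp (2 π i τ)` and `y = exp (2 π i z)`. -/
noncomputable def qy (n : ℕ) (l : ℤ) (τ : ℍ) (z : ℂ) : ℂ :=
  cexp (2 * π * I * (n * (τ : ℂ) + l * z))

/-- `φ (τ, z) = ∑ f (n, l) q ^ n y ^ l`, the sum running over all `n ≥ 0` and all integers `l`,
absolutely convergent at every point of `ℍ × ℂ`. -/
def HasFourierExpansion (φ : ℍ → ℂ → ℂ) (f : ℕ → ℤ → ℂ) : Prop :=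
  ∀ (τ : ℍ) (z : ℂ), HasSum (fun p : ℕ × ℤ => f p.1 p.2 * qy p.1 p.2 τ z) (φ τ z)

/-- Weak Jacobi forms of weight `k` and (integral) index `m`. -/
structure IsWeakJacobiForm (k : ℤ) (m : ℕ) (φ : ℍ → ℂ → ℂ) : Prop where
  /-- `φ` is holomorphic on `ℍ × ℂ`. -/
  holomorphic : DifferentiableOn ℂ (fun p : ℂ × ℂ => φ (ofComplex p.1) p.2)
    {p : ℂ × ℂ | 0 < p.1.im}
  modular : ∀ (γ : SL(2, ℤ)) (τ : ℍ) (z : ℂ),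
    φ (γ • τ) (z / ((γ 1 0 : ℂ) * τ + (γ 1 1 : ℂ))) =
      ((γ 1 0 : ℂ) * τ + (γ 1 1 : ℂ)) ^ k *
        cexp (2 * π * I * m * (γ 1 0 : ℂ) * z ^ 2 / ((γ 1 0 : ℂ) * τ + (γ 1 1 : ℂ))) * φ τ z
  elliptic : ∀ (a b : ℤ) (τ : ℍ) (z : ℂ),
    φ τ (z + a * (τ : ℂ) + b) =
      cexp (-(2 * π * I * m * ((a : ℂ) ^ 2 * (τ : ℂ) + 2 * a * z))) * φ τ z
  fourier : ∃ f : ℕ → ℤ → ℂ, HasFourierExpansion φ f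

/-- The Fourier coefficients of `φ` are integers. -/
def HasIntegralCoeffs (φ : ℍ → ℂ → ℂ) : Prop :=
  ∃ f : ℕ → ℤ → ℤ, HasFourierExpansion φ (fun n l => (f n l : ℂ))

/-- The `q ^ 0`-term of `φ` is the Laurent polynomial `P` (in the variable `y`). -/
def HasQZeroTerm (φ : ℍ → ℂ → ℂ) (P : LaurentPolynomial ℂ) : Prop :=
  ∃ f : ℕ → ℤ → ℂ, HasFourierExpansion φ f ∧ ∀ l : ℤ, f 0 l = P.coeff l

lemma HasFourierExpansion.add {φ ψ : ℍ → ℂ → ℂ} {f g : ℕ → ℤ → ℂ}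
    (hφ : HasFourierExpansion φ f) (hψ : HasFourierExpansion ψ g) :
    HasFourierExpansion (φ + ψ) (fun n l => f n l + g n l) := by
  intro τ z
  simpa [add_mul] using (hφ τ z).add (hψ τ z)

lemma HasFourierExpansion.neg {φ : ℍ → ℂ → ℂ} {f : ℕ → ℤ → ℂ}
    (hφ : HasFourierExpansion φ f) : HasFourierExpansion (-φ) (fun n l => -f n l) := by
  intro τ z
  simpa using (hφ τ z).neg

lemma HasFourierExpansion.zero : HasFourierExpansion 0 (fun _ _ => 0) := by
  intro τ z
  simp

lemma HasIntegralCoeffs.add {φ ψ : ℍ → ℂ → ℂ} (hφ : HasIntegralCoeffs φ)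
    (hψ : HasIntegralCoeffs ψ) : HasIntegralCoeffs (φ + ψ) := by
  obtain ⟨f, hf⟩ := hφ
  obtain ⟨g, hg⟩ := hψ
  exact ⟨fun n l => f n l + g n l, by simpa using hf.add hg⟩

lemma HasIntegralCoeffs.neg {φ : ℍ → ℂ → ℂ} (hφ : HasIntegralCoeffs φ) :
    HasIntegralCoeffs (-φ) := by
  obtain ⟨f, hf⟩ := hφ
  exact ⟨fun n l => -f n l, by simpa using hf.neg⟩

lemma HasIntegralCoeffs.zero : HasIntegralCoeffs 0 :=
  ⟨fun _ _ => 0, by simpa using HasFourierExpansion.zero⟩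

lemma HasIntegralCoeffs.one : HasIntegralCoeffs 1 := by
  refine ⟨fun n l => if n = 0 ∧ l = 0 then 1 else 0, fun τ z => ?_⟩
  convert hasSum_single ((0 : ℕ), (0 : ℤ)) ?_ using 1
  · simp [qy]
  · rintro ⟨n, l⟩ h
    have : ¬ (n = 0 ∧ l = 0) := by simpa using h
    simp [this]

lemma qy_mul (n n' : ℕ) (l l' : ℤ) (τ : ℍ) (z : ℂ) :
    qy n l τ z * qy n' l' τ z = qy (n + n') (l + l') τ z := by
  rw [qy, qy, qy, ← Complex.exp_add]
  congr 1
  push_cast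
  ring

lemma qy_ne_zero (n : ℕ) (l : ℤ) (τ : ℍ) (z : ℂ) : qy n l τ z ≠ 0 := Complex.exp_ne_zero _

lemma norm_qy_zero (n : ℕ) (l : ℤ) (τ : ℍ) : ‖qy n l τ 0‖ = ‖qy n 0 τ 0‖ := by
  simp [qy]

/-- An integral expansion has finitely many non-zero coefficients for every power of `q`. -/
lemma HasFourierExpansion.finite_support {φ : ℍ → ℂ → ℂ} {f : ℕ → ℤ → ℤ}
    (hφ : HasFourierExpansion φ (fun n l => (f n l : ℂ))) (n : ℕ) :
    {l : ℤ | f n l ≠ 0}.Finite := by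
  have h1 := (hφ UpperHalfPlane.I 0).summable.comp_injective
    (Prod.mk_right_injective n : Function.Injective (fun l : ℤ => (n, l)))
  have h2 := h1.norm.tendsto_cofinite_zero
  have hpos : 0 < ‖qy n 0 UpperHalfPlane.I 0‖ := norm_pos_iff.mpr (qy_ne_zero _ _ _ _)
  have h3 := h2.eventually (gt_mem_nhds hpos)
  refine Set.Finite.subset h3 ?_
  intro l hl
  simp only [Set.mem_compl_iff, Set.mem_ofPred_eq, Function.comp, norm_mul, norm_qy_zero n l,
    not_lt]
  have : (1 : ℝ) ≤ ‖((f n l : ℤ) : ℂ)‖ := by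
    rw [Complex.norm_intCast]
    exact_mod_cast Int.one_le_abs hl
  nlinarith

lemma finite_fiber {f g : ℕ → ℤ → ℤ} (hf : ∀ n, {l : ℤ | f n l ≠ 0}.Finite) (N : ℕ × ℤ) :
    {p : {p : (ℕ × ℤ) × (ℕ × ℤ) // p.1 + p.2 = N} |
      f p.1.1.1 p.1.1.2 * g p.1.2.1 p.1.2.2 ≠ 0}.Finite := by
  have hA : (⋃ n ∈ Finset.range (N.1 + 1), (fun l : ℤ => (n, l)) '' {l | f n l ≠ 0}).Finite :=
    Set.Finite.biUnion (Finset.finite_toSet _) (fun n _ => (hf n).image _)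
  refine Set.Finite.of_finite_image (f := fun p => p.1.1) (hA.subset ?_) ?_
  · rintro _ ⟨⟨⟨⟨a, x⟩, b, y⟩, hp⟩, hc, rfl⟩
    have h1 : a + b = N.1 := congrArg Prod.fst hp
    have h2 : f a x ≠ 0 := left_ne_zero_of_mul hc
    simp only [Set.mem_iUnion]
    exact ⟨a, Finset.mem_range.mpr (by omega), x, h2, rfl⟩
  · rintro ⟨⟨p, p'⟩, hp⟩ - ⟨⟨r, r'⟩, hr⟩ - h
    have h1 : p = r := h
    have h2 : p + p' = N := hp
    have h3 : r + r' = N := hr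
    subst h1
    have h4 : p' = r' := add_left_cancel (h2.trans h3.symm)
    subst h4
    rfl

/-- The coefficients of the product of two integral expansions. -/
noncomputable def conv (f g : ℕ → ℤ → ℤ) (N : ℕ × ℤ) : ℤ :=
  ∑ᶠ p : {p : (ℕ × ℤ) × (ℕ × ℤ) // p.1 + p.2 = N}, f p.1.1.1 p.1.1.2 * g p.1.2.1 p.1.2.2

lemma hasSum_fiber {f g : ℕ → ℤ → ℤ} (hf : ∀ n, {l : ℤ | f n l ≠ 0}.Finite) (τ : ℍ) (z : ℂ)
    (N : ℕ × ℤ) :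
    HasSum (fun p : {p : (ℕ × ℤ) × (ℕ × ℤ) // p.1 + p.2 = N} =>
      ((f p.1.1.1 p.1.1.2 : ℂ) * qy p.1.1.1 p.1.1.2 τ z) *
        ((g p.1.2.1 p.1.2.2 : ℂ) * qy p.1.2.1 p.1.2.2 τ z))
      ((conv f g N : ℂ) * qy N.1 N.2 τ z) := by
  have hsum : HasSum (fun p : {p : (ℕ × ℤ) × (ℕ × ℤ) // p.1 + p.2 = N} =>
      f p.1.1.1 p.1.1.2 * g p.1.2.1 p.1.2.2) (conv f g N) := by
    rw [conv, finsum_eq_sum _ (finite_fiber hf N)]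
    refine hasSum_sum_of_ne_finset_zero ?_
    intro p hp
    by_contra h
    exact hp ((Set.Finite.mem_toFinset _).mpr h)
  have hsum' := (hsum.map (Int.castRingHom ℂ) continuous_of_discreteTopology).mul_right
    (qy N.1 N.2 τ z)
  refine hsum'.congr_fun ?_
  rintro ⟨⟨⟨a, x⟩, b, y⟩, hp⟩
  have h1 : a + b = N.1 := congrArg Prod.fst hp
  have h2 : x + y = N.2 := congrArg Prod.snd hp
  have h3 := qy_mul a b x y τ z
  rw [h1, h2] at h3
  rw [← h3]
  simp only [Function.comp, Int.coe_castRingHom]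
  push_cast
  ring

lemma hasSum_of_fibers {α β : Type*} (s : α → β) {F : α → ℂ} {G : β → ℂ} {a : ℂ}
    (h : HasSum F a) (hG : ∀ b, HasSum (fun p : {p : α // s p = b} => F p.1) (G b)) :
    HasSum G a :=
  HasSum.sigma ((Equiv.sigmaFiberEquiv s).hasSum_iff.mpr h) hG

lemma hasSum_mul_of_hasSum {α : Type*} {u v : α → ℂ} {a b : ℂ} (hu : HasSum u a)
    (hv : HasSum v b) : HasSum (fun p : α × α => u p.1 * v p.2) (a * b) :=
  hu.mul hv (summable_mul_of_summable_norm hu.summable.norm hv.summable.norm)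

lemma HasFourierExpansion.mul {φ ψ : ℍ → ℂ → ℂ} {f g : ℕ → ℤ → ℤ}
    (hf : HasFourierExpansion φ (fun n l => (f n l : ℂ)))
    (hg : HasFourierExpansion ψ (fun n l => (g n l : ℂ))) (τ : ℍ) (z : ℂ) :
    HasSum (fun N : ℕ × ℤ => (conv f g N : ℂ) * qy N.1 N.2 τ z) (φ τ z * ψ τ z) :=
  hasSum_of_fibers (fun p : (ℕ × ℤ) × (ℕ × ℤ) => p.1 + p.2)
    (hasSum_mul_of_hasSum (hf τ z) (hg τ z))
    (fun N => hasSum_fiber hf.finite_support τ z N)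

lemma HasIntegralCoeffs.mul {φ ψ : ℍ → ℂ → ℂ} (hφ : HasIntegralCoeffs φ)
    (hψ : HasIntegralCoeffs ψ) : HasIntegralCoeffs (φ * ψ) := by
  obtain ⟨f, hf⟩ := hφ
  obtain ⟨g, hg⟩ := hψ
  exact ⟨fun n l => conv f g (n, l), fun τ z => hf.mul hg τ z⟩

/-- `J^ℤ_{0,m}`: the group of weak Jacobi forms of weight `0` and index `m` with integral
Fourier coefficients. -/
def JZ (m : ℕ) : AddSubgroup (ℍ → ℂ → ℂ) where
  carrier := {φ | IsWeakJacobiForm 0 m φ ∧ HasIntegralCoeffs φ}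
  zero_mem' := by
    refine ⟨⟨?_, ?_, ?_, ⟨_, HasFourierExpansion.zero⟩⟩, HasIntegralCoeffs.zero⟩
    · simp
    · intro γ τ z; simp
    · intro a b τ z; simp
  add_mem' := by
    rintro φ ψ ⟨hφ, hφ'⟩ ⟨hψ, hψ'⟩
    obtain ⟨f, hf⟩ := hφ.fourier
    obtain ⟨g, hg⟩ := hψ.fourier
    refine ⟨⟨hφ.holomorphic.add hψ.holomorphic, ?_, ?_, ⟨_, hf.add hg⟩⟩, hφ'.add hψ'⟩
    · intro γ τ z
      simp only [Pi.add_apply, hφ.modular γ τ z, hψ.modular γ τ z]; ring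
    · intro a b τ z
      simp only [Pi.add_apply, hφ.elliptic a b τ z, hψ.elliptic a b τ z]; ring
  neg_mem' := by
    rintro φ ⟨hφ, hφ'⟩
    obtain ⟨f, hf⟩ := hφ.fourier
    refine ⟨⟨hφ.holomorphic.neg, ?_, ?_, ⟨_, hf.neg⟩⟩, hφ'.neg⟩
    · intro γ τ z
      simp only [Pi.neg_apply, hφ.modular γ τ z]; ring
    · intro a b τ z
      simp only [Pi.neg_apply, hφ.elliptic a b τ z]; ring

/-- `J^ℤ_{0,m}(q)`: the subgroup of the forms without `q ^ 0`-term. -/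
def JZq (m : ℕ) : AddSubgroup (JZ m) where
  carrier := {φ | HasQZeroTerm (φ : ℍ → ℂ → ℂ) 0}
  zero_mem' := ⟨_, HasFourierExpansion.zero, by simp⟩
  add_mem' := by
    rintro φ ψ ⟨f, hf, hf0⟩ ⟨g, hg, hg0⟩
    exact ⟨_, hf.add hg, fun l => by simp [hf0, hg0]⟩
  neg_mem' := by
    rintro φ ⟨f, hf, hf0⟩
    exact ⟨_, hf.neg, fun l => by simp [hf0]⟩

/-- Products of forms of indices `m` and `n` have index `m + n`; hence `⨁ m, JZ m` is a
commutative ring, the graded ring `J^ℤ_{0,*}`. -/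
instance gradedMonoidJZ : SetLike.GradedMonoid JZ where
  one_mem := by
    obtain ⟨f, hf⟩ := HasIntegralCoeffs.one
    refine ⟨⟨?_, ?_, ?_, ⟨_, hf⟩⟩, ⟨f, hf⟩⟩
    · simp
    · intro γ τ z; simp
    · intro a b τ z; simp
  mul_mem := by
    rintro m n φ ψ ⟨hφ, hφ'⟩ ⟨hψ, hψ'⟩
    have hmul := hφ'.mul hψ'
    obtain ⟨f, hf⟩ := hφ'.mul hψ'
    refine ⟨⟨hφ.holomorphic.mul hψ.holomorphic, ?_, ?_, ⟨_, hf⟩⟩, hmul⟩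
    · intro γ τ z
      have h : ∀ w d : ℂ, cexp (2 * π * I * ((m + n : ℕ) : ℂ) * w * z ^ 2 / d) =
          cexp (2 * π * I * m * w * z ^ 2 / d) * cexp (2 * π * I * n * w * z ^ 2 / d) := by
        intro w d
        rw [← Complex.exp_add]
        congr 1
        push_cast
        ring
      simp only [Pi.mul_apply, hφ.modular γ τ z, hψ.modular γ τ z, h, zpow_zero]
      ring
    · intro a b τ z
      have h : ∀ w : ℂ, cexp (-(2 * π * I * ((m + n : ℕ) : ℂ) * w)) =
          cexp (-(2 * π * I * m * w)) * cexp (-(2 * π * I * n * w)) := by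
        intro w
        rw [← Complex.exp_add]
        congr 1
        push_cast
        ring
      simp only [Pi.mul_apply, hφ.elliptic a b τ z, hψ.elliptic a b τ z, h]
      ring

/-- The Jacobi theta series `ϑ (τ, z) = ∑ (-4 / n) q ^ (n² / 8) y ^ (n / 2)`; the Kronecker symbol
`(-4 / n)` is the non-trivial character modulo `4`. -/
noncomputable def theta (τ : ℍ) (z : ℂ) : ℂ :=
  ∑' n : ℤ, (ZMod.χ₄ (n : ZMod 4) : ℂ) * cexp (π * I * n ^ 2 / 4 * (τ : ℂ) + π * I * n * z)

/-- The Kronecker symbol `(12 / n)`. -/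
def chi12 (n : ℤ) : ℤ :=
  if n % 12 = 1 ∨ n % 12 = 11 then 1 else if n % 12 = 5 ∨ n % 12 = 7 then -1 else 0

/-- The quotient `ϑ (τ, N z) / ϑ (τ, z)`, extended by continuity to the zeros of `ϑ (τ, z)`. -/
noncomputable def thetaQuotient (N : ℕ) (τ : ℍ) (z : ℂ) : ℂ :=
  Filter.limUnder (𝓝[≠] z) (fun w : ℂ => theta τ (N * w) / theta τ w)

/-- `φ_{0,2} = (1/2) η ^ (-4) ∑ (3m - n) (-4 / m) (12 / n) q ^ ((3m² + n²) / 24) y ^ ((m + n) / 2)`,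
the sum running over all integers `m`, `n`. -/
noncomputable def phi02 (τ : ℍ) (z : ℂ) : ℂ :=
  1 / 2 * ModularForm.eta (τ : ℂ) ^ (-4 : ℤ) *
    ∑' p : ℤ × ℤ, (3 * p.1 - p.2 : ℂ) * (ZMod.χ₄ (p.1 : ZMod 4) : ℂ) * (chi12 p.2 : ℂ) *
      cexp (2 * π * I * ((3 * (p.1 : ℂ) ^ 2 + (p.2 : ℂ) ^ 2) / 24 * (τ : ℂ) +
        ((p.1 : ℂ) + p.2) / 2 * z))

/-- `φ_{0,3} = φ_{0,3/2} ^ 2`, where `φ_{0,3/2} (τ, z) = ϑ (τ, 2z) / ϑ (τ, z)`. -/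
noncomputable def phi03 (τ : ℍ) (z : ℂ) : ℂ := thetaQuotient 2 τ z ^ 2

/-- `φ_{0,4} (τ, z) = ϑ (τ, 3z) / ϑ (τ, z)`. -/
noncomputable def phi04 (τ : ℍ) (z : ℂ) : ℂ := thetaQuotient 3 τ z

end WeakJacobi

open WeakJacobi LaurentPolynomial

namespace WeakJacobi

open scoped ModularForm

/-! ### Uniqueness of Fourier expansions -/

/-! Structure over modular forms. A weak Jacobi form of even weight and index m is a sum of `f_j
φ_{-2,1}^j φ_{0,1}^(m-j)`, 0 ≤ j ≤ m, with modular forms `f_j` of level one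
(`IsWeakJacobiForm.exists_modularForms`). For fixed τ this is a dimension count: an even theta
function of index m is determined by m + 1 Laurent coefficients, and the m + 1 monomials are
linearly independent. Taylor expansion at z = 0 shows that the `f_j` have q-series, and independence
transfers the transformation law to them.

The q^0-terms. In weight 0, `f_j` has weight 2j. With u = y - 2 + y⁻¹, the q^0-terms of φ_{-2,1} and
φ_{0,1} are u and 12 + u, so that of a form is p(u) with p = ∑ a_j X^j (12 + X)^(m-j), where a_j is
the constant term of `f_j`. No modular form of weight 2 exists, so a_1 = 0, which says m p(0) = 12
p'(0). For integral forms p lies in ℤ[X] (`JZ.exists_polynomial`). Conversely, 12 + X, 6 + X, 4 + X,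
3 + X in degrees 1, 2, 3, 4 generate all integral p of degree at most m with this relation
(`mem_of_generators`); they are the q^0-terms of φ_{0,1}, …, φ_{0,4}. The X^n with 2 ≤ n ≤ m and (12
+ mX)/(12, m) form a basis of these p, which is the first part of the theorem.

Forms without q^0-term. Here each `f_j` is divisible by Δ, and the quotient has negative weight for
j < 6, so the form is Δ φ_{-2,1}^6 times a form of index m - 6. Division keeps coefficients integral
because the leading coefficient q u^6 is a monomial times a power of 1 - y⁻¹
(`JZ.eq_discriminant_mul`). Since Δ φ_{-2,1}^6 is an integral polynomial in the generators
(`discriminant_mul_phiNeg_pow`), induction on m shows that they generate (`formsIn_eq_top`).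

The generators. All are built from ϑ, from the series for (12 / n), from η and from `E2`, whose
expansions are integral. In index below 6 a form of weight 0 is determined by its q^0-term, so the
relations among generators are checked on q^0-terms. Two of them write φ_{0,2}, φ_{0,3} through
φ_{0,1}, E₄ φ_{-2,1}² and E₆ φ_{-2,1}³; these three vary freely enough to give algebraic
independence. -/

lemma eq_zero_of_hasSum_cexp_zero {c : ℤ → ℂ}
    (h : ∀ x : ℝ, HasSum (fun l : ℤ => c l * cexp (2 * π * I * (l * x))) 0) : c = 0 := by
  funext k
  have hs : Summable (fun l : ℤ => ‖c l‖) := by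
    have := (h 0).summable.norm
    simpa using this
  -- Convergence at x = 0 bounds ∑ ‖c l‖, which permits termwise integration against the k-th
  -- character; orthogonality isolates `c k`.
  have h1 := intervalIntegral.hasSum_intervalIntegral_of_summable_norm (a := (0 : ℝ)) (b := 1)
    (f := fun l : ℤ => (⟨fun x : ℝ => c l * cexp (2 * π * I * (l * x)) *
      cexp (-(2 * π * I * (k * x))), by fun_prop⟩ : C(ℝ, ℂ))) (by
      refine Summable.of_nonneg_of_le (fun _ => norm_nonneg _) (fun l => ?_) hs
      refine (ContinuousMap.norm_le _ (norm_nonneg _)).mpr fun ⟨x, _⟩ => ?_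
      have e1 : ‖cexp (2 * π * I * (l * (x : ℝ)))‖ = 1 := by
        rw [show 2 * π * I * ((l : ℂ) * ((x : ℝ) : ℂ)) = ((2 * π * l * (x : ℝ) : ℝ) : ℂ) * I by
          push_cast; ring, norm_exp_ofReal_mul_I]
      have e2 : ‖cexp (-(2 * π * I * (k * (x : ℝ))))‖ = 1 := by
        rw [show -(2 * π * I * ((k : ℂ) * ((x : ℝ) : ℂ))) = ((-(2 * π * k * (x : ℝ)) : ℝ) : ℂ) * I by
          push_cast; ring, norm_exp_ofReal_mul_I]
      simp [e1, e2])
  have h2 : ∀ x : ℝ, ∑' l : ℤ, (c l * cexp (2 * π * I * (l * x)) *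
      cexp (-(2 * π * I * (k * x)))) = 0 := fun x => by
    rw [tsum_mul_right, (h x).tsum_eq, zero_mul]
  simp only [ContinuousMap.coe_mk, h2, intervalIntegral.integral_zero] at h1
  have h3 : ∀ l : ℤ, ∫ x in (0 : ℝ)..1, c l * cexp (2 * π * I * (l * x)) *
      cexp (-(2 * π * I * (k * x))) = if l = k then c k else 0 := by
    intro l
    have e : ∀ x : ℝ, c l * cexp (2 * π * I * (l * x)) * cexp (-(2 * π * I * (k * x))) =
        c l * cexp ((2 * π * I * ((l - k : ℤ) : ℂ)) * x) := by
      intro x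
      rw [mul_assoc, ← Complex.exp_add]
      congr 2
      push_cast
      ring
    simp_rw [e]
    split_ifs with hlk
    · subst hlk; simp
    · have hne : 2 * π * I * ((l - k : ℤ) : ℂ) ≠ 0 := by
        have : ((l - k : ℤ) : ℂ) ≠ 0 := by exact_mod_cast sub_ne_zero.mpr hlk
        exact mul_ne_zero Complex.two_pi_I_ne_zero this
      rw [intervalIntegral.integral_const_mul, integral_exp_mul_complex hne]
      have : cexp (2 * π * I * ((l - k : ℤ) : ℂ) * ((1 : ℝ) : ℂ)) = 1 := by
        rw [Complex.exp_eq_one_iff]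
        exact ⟨l - k, by push_cast; ring⟩
      rw [this]; simp
  simp_rw [h3] at h1
  have h4 := h1.unique (hasSum_ite_eq k (c k))
  simpa using h4.symm

/-- `c l = ∑ f (n, l) q ^ n`. -/
lemma HasFourierExpansion.summable_fiber {φ : ℍ → ℂ → ℂ} {f : ℕ → ℤ → ℂ}
    (h : HasFourierExpansion φ f) (τ : ℍ) (l : ℤ) :
    Summable (fun n : ℕ => f n l * qy n 0 τ 0) := by
  have h1 := (h τ 0).summable.comp_injective
    (Prod.mk_left_injective l : Function.Injective (fun n : ℕ => (n, l)))
  refine h1.congr fun n => ?_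
  simp [qy]

/-- The coefficient of `y ^ l` of a Fourier expansion, as a function of `τ`. -/
noncomputable def yCoeff (f : ℕ → ℤ → ℂ) (l : ℤ) (τ : ℍ) : ℂ := ∑' n : ℕ, f n l * qy n 0 τ 0

lemma HasFourierExpansion.hasSum_yCoeff {φ : ℍ → ℂ → ℂ} {f : ℕ → ℤ → ℂ}
    (h : HasFourierExpansion φ f) (τ : ℍ) (z : ℂ) :
    HasSum (fun l : ℤ => yCoeff f l τ * cexp (2 * π * I * (l * z))) (φ τ z) := by
  have h1 : HasSum (fun p : ℤ × ℕ => f p.2 p.1 * qy p.2 p.1 τ z) (φ τ z) :=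
    (Equiv.prodComm ℤ ℕ).hasSum_iff.mpr (h τ z)
  refine HasSum.prod_fiberwise h1 fun l => ?_
  have := (h.summable_fiber τ l).hasSum.mul_right (cexp (2 * π * I * (l * z)))
  refine this.congr_fun ?_
  intro n
  simp only [mul_assoc, qy]
  rw [← Complex.exp_add]
  congr 2
  ring

/-- On the line Im τ = 1 the q-series is a Fourier series in Re τ with coefficients a_n e^(-2πn). -/
lemma coeff_eq_zero_of_hasSum_zero {a : ℕ → ℂ}
    (h : ∀ τ : ℍ, HasSum (fun n : ℕ => a n * qy n 0 τ 0) 0) : a = 0 := by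
  let c : ℤ → ℂ := fun l => if 0 ≤ l then a l.toNat * (Real.exp (-(2 * π * l)) : ℂ) else 0
  have hc : c = 0 := by
    refine eq_zero_of_hasSum_cexp_zero fun x => ?_
    have h1 := h ⟨x + I, by simp⟩
    have hinj : Function.Injective (fun n : ℕ => (n : ℤ)) := Nat.cast_injective
    rw [← hinj.hasSum_iff]
    · refine h1.congr_fun ?_
      intro n
      simp only [Function.comp, c, qy]
      simp only [Int.natCast_nonneg, if_true, Int.toNat_natCast]
      rw [mul_assoc, Complex.ofReal_exp, ← Complex.exp_add]
      congr 2
      push_cast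
      ring_nf
      simp [I_sq]
      ring
    · intro l hl
      have : ¬ 0 ≤ l := fun h0 => hl ⟨l.toNat, by simp [h0]⟩
      simp [c, this]
  funext n
  have := congrFun hc n
  simp only [c, Int.natCast_nonneg, if_true, Int.toNat_natCast, Pi.zero_apply, mul_eq_zero,
    Complex.ofReal_eq_zero, Real.exp_ne_zero, or_false] at this
  exact this

lemma qSeries_unique {a b : ℕ → ℂ} {g : ℍ → ℂ}
    (ha : ∀ τ : ℍ, HasSum (fun n : ℕ => a n * qy n 0 τ 0) (g τ))
    (hb : ∀ τ : ℍ, HasSum (fun n : ℕ => b n * qy n 0 τ 0) (g τ)) : a = b := by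
  have : (fun n => a n - b n) = 0 := coeff_eq_zero_of_hasSum_zero fun τ => by
    simpa [sub_mul] using (ha τ).sub (hb τ)
  funext n
  exact sub_eq_zero.mp (congrFun this n)

/-- The coefficients of an absolutely convergent Laurent expansion in `y` are unique. -/
lemma cexp_coeff_unique {c d : ℤ → ℂ} {g : ℂ → ℂ}
    (hc : ∀ z, HasSum (fun l : ℤ => c l * cexp (2 * π * I * (l * z))) (g z))
    (hd : ∀ z, HasSum (fun l : ℤ => d l * cexp (2 * π * I * (l * z))) (g z)) : c = d := by
  have : (fun l => c l - d l) = 0 := eq_zero_of_hasSum_cexp_zero fun x => by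
    simpa [sub_mul] using (hc x).sub (hd x)
  funext n
  exact sub_eq_zero.mp (congrFun this n)

/-- Uniqueness is applied twice: in y for fixed τ, then in q for each coefficient of y^l. -/
lemma HasFourierExpansion.unique {φ : ℍ → ℂ → ℂ} {f g : ℕ → ℤ → ℂ}
    (hf : HasFourierExpansion φ f) (hg : HasFourierExpansion φ g) : f = g := by
  have h0 : ∀ l, (fun n => f n l) = fun n => g n l := fun l => by
    refine qSeries_unique (g := yCoeff f l) (fun τ => (hf.summable_fiber τ l).hasSum) fun τ => ?_
    have := cexp_coeff_unique (hf.hasSum_yCoeff τ) (hg.hasSum_yCoeff τ)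
    rw [congrFun this l]
    exact (hg.summable_fiber τ l).hasSum
  funext n l
  exact congrFun (h0 l) n

/-! ### Differentiating Fourier expansions -/

/-- The total derivative of `q ^ n y ^ l` at `x = (τ, z)`. -/
noncomputable def termFDeriv (f : ℕ → ℤ → ℂ) (p : ℕ × ℤ) (x : ℂ × ℂ) : ℂ × ℂ →L[ℂ] ℂ :=
  (f p.1 p.2 * cexp (2 * π * I * (p.1 * x.1 + p.2 * x.2))) •
    ((2 * π * I * p.1) • ContinuousLinearMap.fst ℂ ℂ ℂ +
      (2 * π * I * p.2) • ContinuousLinearMap.snd ℂ ℂ ℂ)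

lemma hasFDerivAt_term (f : ℕ → ℤ → ℂ) (p : ℕ × ℤ) (x : ℂ × ℂ) :
    HasFDerivAt (fun x : ℂ × ℂ => f p.1 p.2 * cexp (2 * π * I * (p.1 * x.1 + p.2 * x.2)))
      (termFDeriv f p x) x := by
  have h1 : HasFDerivAt (fun x : ℂ × ℂ => 2 * π * I * (p.1 * x.1 + p.2 * x.2))
      ((2 * π * I * p.1) • ContinuousLinearMap.fst ℂ ℂ ℂ +
      (2 * π * I * p.2) • ContinuousLinearMap.snd ℂ ℂ ℂ) x := by
    have := ((hasFDerivAt_fst (𝕜 := ℂ) (p := x)).const_mul (p.1 : ℂ)).add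
      ((hasFDerivAt_snd (𝕜 := ℂ) (p := x)).const_mul (p.2 : ℂ))
    refine (this.const_mul (2 * π * I)).congr_fderiv ?_
    rw [smul_add, smul_smul, smul_smul]
  refine (h1.cexp.const_mul (f p.1 p.2)).congr_fderiv ?_
  rw [smul_smul, termFDeriv]

lemma norm_termFDeriv_le (f : ℕ → ℤ → ℂ) (p : ℕ × ℤ) (x : ℂ × ℂ) :
    ‖termFDeriv f p x‖ ≤ ‖f p.1 p.2‖ * (2 * π * (p.1 + |(p.2 : ℝ)|)) *
      rexp (-(2 * π * (p.1 * x.1.im + p.2 * x.2.im))) := by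
  have h1 : ‖cexp (2 * π * I * (p.1 * x.1 + p.2 * x.2))‖ =
      rexp (-(2 * π * (p.1 * x.1.im + p.2 * x.2.im))) := by
    rw [Complex.norm_exp]
    congr 1
    simp
  have hπ := Real.pi_pos
  have n1 : ‖(2 * π * I * p.1 : ℂ)‖ = 2 * π * p.1 := by
    simp [abs_of_pos hπ]
  have n2 : ‖(2 * π * I * p.2 : ℂ)‖ = 2 * π * |(p.2 : ℝ)| := by
    simp [abs_of_pos hπ]
  have h2 : ‖(2 * π * I * p.1 : ℂ) • ContinuousLinearMap.fst ℂ ℂ ℂ +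
      (2 * π * I * p.2 : ℂ) • ContinuousLinearMap.snd ℂ ℂ ℂ‖ ≤ 2 * π * (p.1 + |(p.2 : ℝ)|) := by
    refine (norm_add_le _ _).trans ?_
    have hs (a : ℂ) (f : ℂ × ℂ →L[ℂ] ℂ) : ‖a • f‖ = ‖a‖ * ‖f‖ := norm_smul a f
    rw [hs, hs, n1, n2]
    have f1 := ContinuousLinearMap.norm_fst_le ℂ ℂ ℂ
    have f2 := ContinuousLinearMap.norm_snd_le ℂ ℂ ℂ
    have := mul_le_mul_of_nonneg_left f1 (show 0 ≤ 2 * π * (p.1 : ℝ) by positivity)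
    have := mul_le_mul_of_nonneg_left f2 (show 0 ≤ 2 * π * |(p.2 : ℝ)| by positivity)
    linarith
  have hs (a : ℂ) (f : ℂ × ℂ →L[ℂ] ℂ) : ‖a • f‖ = ‖a‖ * ‖f‖ := norm_smul a f
  rw [termFDeriv, hs, norm_mul, h1]
  calc _ ≤ ‖f p.1 p.2‖ * rexp (-(2 * π * (p.1 * x.1.im + p.2 * x.2.im))) *
        (2 * π * (p.1 + |(p.2 : ℝ)|)) := by gcongr
    _ = _ := by ring

/-- A summable bound for the derivatives of the terms on `{Im τ > ε, |Im z| < R}`. -/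
noncomputable def termBound (f : ℕ → ℤ → ℂ) (ε R : ℝ) (p : ℕ × ℤ) : ℝ :=
  (2 / ε + 1) * (‖f p.1 p.2‖ * (rexp (-(π * (p.1 * ε))) *
    (rexp (2 * π * (p.2 * (R + 1))) + rexp (-(2 * π * (p.2 * (R + 1)))))))

/-- The bound is a constant times the absolute values of the terms at the points (εi/2, ±(R+1)i).
The slack between ε/2 and ε, and between R and R + 1, absorbs the factors n and l produced by
differentiation. -/
lemma HasFourierExpansion.summable_termBound {φ : ℍ → ℂ → ℂ} {f : ℕ → ℤ → ℂ}
    (h : HasFourierExpansion φ f) {ε : ℝ} (hε : 0 < ε) (R : ℝ) : Summable (termBound f ε R) := by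
  refine Summable.mul_left _ ?_
  have h1 := (h ⟨(ε / 2 : ℝ) * I, by simp [hε]⟩ ((R + 1 : ℝ) * I)).summable.norm
  have h2 := (h ⟨(ε / 2 : ℝ) * I, by simp [hε]⟩ (-(R + 1 : ℝ) * I)).summable.norm
  refine (h1.add h2).congr fun p => ?_
  simp only [norm_mul, qy, Complex.norm_exp]
  rw [← mul_add, mul_add (rexp _), ← Real.exp_add, ← Real.exp_add, add_comm]
  simp
  ring_nf
  simp

lemma two_pi_mul_le {ε : ℝ} (hε : 0 < ε) (n : ℕ) (x : ℝ) (hx : 0 ≤ x) :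
    2 * π * (n + x) ≤ (2 / ε + 1) * (rexp (π * (n * ε)) * rexp (2 * π * x)) := by
  have hπ := Real.pi_pos
  have e1 : (π * (n * ε)) + 1 ≤ rexp (π * (n * ε)) := Real.add_one_le_exp _
  have e2 : 2 * π * x + 1 ≤ rexp (2 * π * x) := Real.add_one_le_exp _
  have a1 : 1 ≤ rexp (π * (n * ε)) := Real.one_le_exp (by positivity)
  have a2 : 1 ≤ rexp (2 * π * x) := Real.one_le_exp (by positivity)
  have b1 : 2 * π * n = 2 / ε * (π * (n * ε)) := by field_simp
  have b2 : 2 / ε * (π * (n * ε)) ≤ 2 / ε * (rexp (π * (n * ε)) * rexp (2 * π * x)) := by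
    refine mul_le_mul_of_nonneg_left ?_ (by positivity)
    exact le_trans (by linarith) (le_mul_of_one_le_right (Real.exp_pos _).le a2)
  have b3 : 2 * π * x ≤ rexp (π * (n * ε)) * rexp (2 * π * x) := by nlinarith
  linarith [b1, b2, b3]

lemma norm_termFDeriv_le_termBound (f : ℕ → ℤ → ℂ) {ε R : ℝ} (hε : 0 < ε) (p : ℕ × ℤ)
    {x : ℂ × ℂ} (hx : ε < x.1.im) (hz : |x.2.im| < R) :
    ‖termFDeriv f p x‖ ≤ termBound f ε R p := by
  have hπ := Real.pi_pos
  have hR : 0 < R := (abs_nonneg _).trans_lt hz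
  refine (norm_termFDeriv_le f p x).trans ?_
  rw [termBound, mul_left_comm (2 / ε + 1), mul_assoc ‖f p.1 p.2‖]
  refine mul_le_mul_of_nonneg_left (a := ‖f p.1 p.2‖) ?_ (norm_nonneg _)
  have h1 := two_pi_mul_le hε p.1 |(p.2 : ℝ)| (abs_nonneg _)
  have h2 : rexp (-(2 * π * (p.1 * x.1.im + p.2 * x.2.im))) ≤
      rexp (-(2 * π * (p.1 * ε))) * rexp (2 * π * (|(p.2 : ℝ)| * R)) := by
    rw [← Real.exp_add]
    apply Real.exp_le_exp.mpr
    have i1 : (p.1 : ℝ) * ε ≤ p.1 * x.1.im := by gcongr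
    have i2 : -((p.2 : ℝ) * x.2.im) ≤ |(p.2 : ℝ)| * R := by
      refine (neg_le_abs _).trans ?_
      rw [abs_mul]
      gcongr
    nlinarith
  have h3 : rexp (2 * π * (|(p.2 : ℝ)| * (R + 1))) ≤
      rexp (2 * π * (p.2 * (R + 1))) + rexp (-(2 * π * (p.2 * (R + 1)))) := by
    rcases abs_cases (p.2 : ℝ) with ⟨h, -⟩ | ⟨h, -⟩
    · rw [h]; linarith [Real.exp_pos (-(2 * π * (p.2 * (R + 1))))]
    · rw [h, neg_mul, mul_neg]; linarith [Real.exp_pos (2 * π * (p.2 * (R + 1)))]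
  calc 2 * π * (p.1 + |(p.2 : ℝ)|) * rexp (-(2 * π * (p.1 * x.1.im + p.2 * x.2.im)))
      ≤ ((2 / ε + 1) * (rexp (π * (p.1 * ε)) * rexp (2 * π * |(p.2 : ℝ)|))) *
        (rexp (-(2 * π * (p.1 * ε))) * rexp (2 * π * (|(p.2 : ℝ)| * R))) := by gcongr
    _ = (2 / ε + 1) * (rexp (-(π * (p.1 * ε))) * rexp (2 * π * (|(p.2 : ℝ)| * (R + 1)))) := by
        rw [mul_assoc, ← Real.exp_add, ← Real.exp_add, ← Real.exp_add, ← Real.exp_add]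
        congr 2
        ring
    _ ≤ _ := by gcongr

/-- Pointwise absolute convergence alone yields holomorphy in (τ, z), so the forms constructed below
need only an expansion and transformation laws. -/
lemma HasFourierExpansion.hasFDerivAt {φ : ℍ → ℂ → ℂ} {f : ℕ → ℤ → ℂ}
    (h : HasFourierExpansion φ f) (x : ℂ × ℂ) (hx : 0 < x.1.im) :
    Summable (fun p => termFDeriv f p x) ∧
    HasFDerivAt (fun p : ℂ × ℂ => φ (ofComplex p.1) p.2) (∑' p, termFDeriv f p x) x := by
  obtain ⟨ε, hε, hεx⟩ := exists_between hx
  obtain ⟨R, hR⟩ := exists_gt |x.2.im|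
  set s : Set (ℂ × ℂ) := {x | ε < x.1.im} ∩ {x | |x.2.im| < R} with hs
  have hso : IsOpen s := by
    refine (isOpen_lt continuous_const ?_).inter (isOpen_lt ?_ continuous_const) <;> fun_prop
  have hsc : Convex ℝ s := by
    have h1 : Convex ℝ {x : ℂ × ℂ | ε < x.1.im} :=
      (convex_Ioi ε).linear_preimage (imLm.comp (LinearMap.fst ℝ ℂ ℂ))
    have h2 : Convex ℝ {x : ℂ × ℂ | |x.2.im| < R} := by
      have := (convex_Ioo (-R) R).linear_preimage (imLm.comp (LinearMap.snd ℝ ℂ ℂ))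
      refine Eq.mp (congrArg (Convex ℝ) ?_) this
      ext x
      simp only [Set.mem_preimage, Set.mem_Ioo, Set.mem_ofPred_eq, abs_lt]
      rfl
    exact h1.inter h2
  have hxs : x ∈ s := ⟨hεx, hR⟩
  have hsum := h.summable_termBound hε R
  refine ⟨Summable.of_norm_bounded hsum fun p => norm_termFDeriv_le_termBound f hε p hεx hR, ?_⟩
  have hterm : ∀ y : ℂ × ℂ, (hy : 0 < y.1.im) → HasSum
      (fun p : ℕ × ℤ => f p.1 p.2 * cexp (2 * π * I * (p.1 * y.1 + p.2 * y.2)))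
      (φ (ofComplex y.1) y.2) := by
    intro y hy
    have := h (ofComplex y.1) y.2
    simpa [qy, ofComplex_apply_of_im_pos hy] using this
  have key := hasFDerivAt_tsum_of_isPreconnected hsum hso hsc.isPreconnected
    (fun p y _ => hasFDerivAt_term f p y)
    (fun p y hy => norm_termFDeriv_le_termBound f hε p hy.1 hy.2) hxs (hterm x hx).summable hxs
  refine key.congr_of_eventuallyEq ?_
  filter_upwards [hso.mem_nhds hxs] with y hy
  exact (hterm y (hε.trans hy.1)).tsum_eq.symm

lemma HasFourierExpansion.differentiableOn {φ : ℍ → ℂ → ℂ} {f : ℕ → ℤ → ℂ}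
    (h : HasFourierExpansion φ f) : DifferentiableOn ℂ (fun p : ℂ × ℂ => φ (ofComplex p.1) p.2)
    {p : ℂ × ℂ | 0 < p.1.im} :=
  fun x hx => (h.hasFDerivAt x hx).2.differentiableAt.differentiableWithinAt

lemma HasFourierExpansion.hasDerivAt {φ : ℍ → ℂ → ℂ} {f : ℕ → ℤ → ℂ}
    (h : HasFourierExpansion φ f) (τ : ℍ) (z : ℂ) :
    Summable (fun p : ℕ × ℤ => (p.2 * f p.1 p.2) * qy p.1 p.2 τ z) ∧
    HasDerivAt (φ τ) (2 * π * I * ∑' p : ℕ × ℤ, (p.2 * f p.1 p.2) * qy p.1 p.2 τ z) z := by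
  obtain ⟨h1, h2⟩ := h.hasFDerivAt (τ, z) τ.im_pos
  have h3 := h1.hasSum.mapL ((ContinuousLinearMap.apply ℂ ℂ) ((0 : ℂ), (1 : ℂ)))
  have e : ∀ p : ℕ × ℤ, (ContinuousLinearMap.apply ℂ ℂ) ((0 : ℂ), (1 : ℂ))
      (termFDeriv f p ((τ : ℂ), z)) = 2 * π * I * ((p.2 * f p.1 p.2) * qy p.1 p.2 τ z) := by
    intro p
    simp [termFDeriv, qy]
    ring
  simp only [e] at h3
  have hpi : (2 * π * I : ℂ) ≠ 0 := by simp [Real.pi_ne_zero]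
  refine ⟨(summable_mul_left_iff hpi).mp h3.summable, ?_⟩
  have h4 : HasDerivAt (fun z : ℂ => ((τ : ℂ), z)) ((0 : ℂ), (1 : ℂ)) z :=
    (hasDerivAt_const z (τ : ℂ)).prodMk (hasDerivAt_id z)
  have h5 := h2.comp_hasDerivAt z h4
  rw [← tsum_mul_left, h3.tsum_eq]
  simpa [Function.comp_def] using h5

/-- `y ∂/∂y`, i.e. `(2 π i)⁻¹ ∂/∂z`. -/
noncomputable def dz (φ : ℍ → ℂ → ℂ) (τ : ℍ) (z : ℂ) : ℂ := (2 * π * I)⁻¹ * deriv (φ τ) z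

lemma HasFourierExpansion.dz {φ : ℍ → ℂ → ℂ} {f : ℕ → ℤ → ℂ} (h : HasFourierExpansion φ f) :
    HasFourierExpansion (dz φ) (fun n l => l * f n l) := by
  intro τ z
  obtain ⟨h1, h2⟩ := h.hasDerivAt τ z
  rw [WeakJacobi.dz, h2.deriv, inv_mul_cancel_left₀ (by simp [Real.pi_ne_zero])]
  exact h1.hasSum

lemma HasFourierExpansion.differentiable {φ : ℍ → ℂ → ℂ} {f : ℕ → ℤ → ℂ}
    (h : HasFourierExpansion φ f) (τ : ℍ) : Differentiable ℂ (φ τ) :=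
  fun z => (h.hasDerivAt τ z).2.differentiableAt

/-! ### Formal expansions -/

/-- The ring of formal expansions: power series in `q` over the Laurent polynomials in `y`. -/
abbrev FormalExp (R : Type*) [Semiring R] := PowerSeries R[T;T⁻¹]

/-- The coefficient of `q ^ n y ^ l`. -/
noncomputable def FormalExp.co {R : Type*} [Semiring R] (F : FormalExp R) (n : ℕ) (l : ℤ) : R :=
  (PowerSeries.coeff n F).coeff l

lemma FormalExp.ext {R : Type*} [Semiring R] {F G : FormalExp R} (h : ∀ n l, F.co n l = G.co n l) :
    F = G := by
  refine PowerSeries.ext fun n => LaurentPolynomial.ext fun l => h n l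

/-- The formal series with given coefficients, finitely many for every power of `q`. -/
noncomputable def FormalExp.ofCoeff {R : Type*} [Semiring R] (f : ℕ → ℤ → R)
    (hf : ∀ n, (Function.support (f n)).Finite) : FormalExp R :=
  PowerSeries.mk fun n => AddMonoidAlgebra.ofCoeff (Finsupp.ofSupportFinite (f n) (hf n))

@[simp] lemma FormalExp.co_ofCoeff {R : Type*} [Semiring R] (f : ℕ → ℤ → R)
    (hf : ∀ n, (Function.support (f n)).Finite) (n : ℕ) (l : ℤ) :
    (FormalExp.ofCoeff f hf).co n l = f n l := by
  simp only [FormalExp.co, FormalExp.ofCoeff, PowerSeries.coeff_mk]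
  rfl

/-- `φ` has the formal expansion `F`. -/
def HasExp (φ : ℍ → ℂ → ℂ) (F : FormalExp ℂ) : Prop :=
  HasFourierExpansion φ F.co

lemma HasExp.unique {φ : ℍ → ℂ → ℂ} {F G : FormalExp ℂ} (hF : HasExp φ F) (hG : HasExp φ G) :
    F = G :=
  FormalExp.ext fun n l => congrFun (congrFun (HasFourierExpansion.unique hF hG) n) l

lemma HasExp.add {φ ψ : ℍ → ℂ → ℂ} {F G : FormalExp ℂ} (hF : HasExp φ F) (hG : HasExp ψ G) :
    HasExp (φ + ψ) (F + G) := by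
  have e : (F + G).co = fun n l => F.co n l + G.co n l := by
    funext n l
    simp [FormalExp.co]
  rw [HasExp, e]
  exact HasFourierExpansion.add hF hG

lemma HasExp.neg {φ : ℍ → ℂ → ℂ} {F : FormalExp ℂ} (hF : HasExp φ F) : HasExp (-φ) (-F) := by
  have e : (-F).co = fun n l => -F.co n l := by
    funext n l
    simp [FormalExp.co]
  rw [HasExp, e]
  exact HasFourierExpansion.neg hF

lemma HasExp.sub {φ ψ : ℍ → ℂ → ℂ} {F G : FormalExp ℂ} (hF : HasExp φ F) (hG : HasExp ψ G) :
    HasExp (φ - ψ) (F - G) := by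
  rw [sub_eq_add_neg, sub_eq_add_neg]
  exact hF.add hG.neg

lemma HasExp.zero : HasExp 0 0 := by
  have e : (0 : FormalExp ℂ).co = fun n l => 0 := by
    funext n l
    simp [FormalExp.co]
  rw [HasExp, e]
  exact HasFourierExpansion.zero

lemma coeff_T_mul {R : Type*} [Semiring R] (a : R) (k : ℤ) (P : R[T;T⁻¹]) (l : ℤ) :
    (C a * T k * P).coeff l = a * P.coeff (l - k) := by
  rw [← single_eq_C_mul_T]
  refine AddMonoidAlgebra.coeff_single_mul_eq_mul_coeff (l - k) ?_
  intro m _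
  constructor <;> intro h <;> linarith

lemma hasSum_coeff_mul (P Q : ℂ[T;T⁻¹]) (l : ℤ) :
    HasSum (fun p : {p : ℤ × ℤ // p.1 + p.2 = l} => P.coeff p.1.1 * Q.coeff p.1.2)
      ((P * Q).coeff l) := by
  induction P using LaurentPolynomial.induction_on' with
  | add P P' h h' => simpa [add_mul] using h.add h'
  | C_mul_T k a =>
    rw [coeff_T_mul]
    convert hasSum_single (f := fun p : {p : ℤ × ℤ // p.1 + p.2 = l} =>
      (C a * T k).coeff p.1.1 * Q.coeff p.1.2) ⟨(k, l - k), by ring⟩ ?_ using 1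
    · have := coeff_T_mul a k 1 k
      simp only [mul_one, sub_self] at this
      rw [this]
      simp [← LaurentPolynomial.T_zero]
    · rintro ⟨⟨i, j⟩, hij⟩ hne
      have hi : i ≠ k := by
        rintro rfl
        exact hne (Subtype.ext (Prod.ext rfl (by simp at hij ⊢; linarith)))
      rw [← single_eq_C_mul_T]
      simp [hi.symm, -single_eq_C_mul_T]

lemma HasExp.mul {φ ψ : ℍ → ℂ → ℂ} {F G : FormalExp ℂ} (hF : HasExp φ F) (hG : HasExp ψ G) :
    HasExp (φ * ψ) (F * G) := by
  intro τ z
  have h0 := hasSum_mul_of_hasSum (hF τ z) (hG τ z)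
  have h1 : HasSum (fun p : (ℕ × ℕ) × ℤ =>
      (PowerSeries.coeff p.1.1 F * PowerSeries.coeff p.1.2 G).coeff p.2 *
        qy (p.1.1 + p.1.2) p.2 τ z) (φ τ z * ψ τ z) := by
    -- The product is regrouped in two stages: the exponents of y are added first, with the two
    -- exponents of q kept apart, which matches multiplication of Laurent polynomials; the exponents
    -- of q are added afterwards.
    refine hasSum_of_fibers (fun p : (ℕ × ℤ) × (ℕ × ℤ) => ((p.1.1, p.2.1), p.1.2 + p.2.2)) h0 ?_
    rintro ⟨⟨a, b⟩, l⟩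
    let e : {p : ℤ × ℤ // p.1 + p.2 = l} ≃ {p : (ℕ × ℤ) × (ℕ × ℤ) //
        ((p.1.1, p.2.1), p.1.2 + p.2.2) = ((a, b), l)} :=
      { toFun := fun p => ⟨((a, p.1.1), (b, p.1.2)), by simp [p.2]⟩
        invFun := fun p => ⟨(p.1.1.2, p.1.2.2), by have := p.2; simp at this; exact this.2⟩
        left_inv := fun p => rfl
        right_inv := by
          rintro ⟨⟨⟨a', x⟩, b', y⟩, hp⟩
          simp only [Prod.mk.injEq] at hp
          obtain ⟨⟨rfl, rfl⟩, -⟩ := hp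
          rfl }
    rw [← e.hasSum_iff]
    refine ((hasSum_coeff_mul (PowerSeries.coeff a F) (PowerSeries.coeff b G) l).mul_right
      (qy (a + b) l τ z)).congr_fun ?_
    rintro ⟨⟨x, y⟩, rfl⟩
    simp only [Function.comp, e, Equiv.coe_fn_mk, FormalExp.co, ← qy_mul]
    ring
  refine hasSum_of_fibers (fun p : (ℕ × ℕ) × ℤ => (p.1.1 + p.1.2, p.2)) h1 ?_
  rintro ⟨n, l⟩
  let e : Finset.HasAntidiagonal.antidiagonal n ≃ {p : (ℕ × ℕ) × ℤ // (p.1.1 + p.1.2, p.2) = (n, l)} :=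
    { toFun := fun p => ⟨(p.1, l), by
        have := Finset.HasAntidiagonal.mem_antidiagonal.mp p.2; simp [this]⟩
      invFun := fun p => ⟨p.1.1, by have := p.2; simp at this; simp [this.1]⟩
      left_inv := fun p => rfl
      right_inv := by
        rintro ⟨⟨p, l'⟩, hp⟩
        simp only [Prod.mk.injEq] at hp
        obtain ⟨-, rfl⟩ := hp
        rfl }
  rw [← e.hasSum_iff]
  have : (F * G).co n l = ∑ p : Finset.HasAntidiagonal.antidiagonal n,
      (PowerSeries.coeff p.1.1 F * PowerSeries.coeff p.1.2 G).coeff l := by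
    rw [FormalExp.co, PowerSeries.coeff_mul, ← Finset.sum_coe_sort, AddMonoidAlgebra.coeff_sum,
      Finsupp.finsetSum_apply]
  simp only [this, Finset.sum_mul]
  refine (hasSum_fintype _).congr_fun ?_
  rintro ⟨p, hp⟩
  simp [e, Finset.HasAntidiagonal.mem_antidiagonal.mp hp]

lemma HasExp.pow {φ : ℍ → ℂ → ℂ} {F : FormalExp ℂ} (hF : HasExp φ F)
    (hone : HasExp 1 1) (k : ℕ) : HasExp (φ ^ k) (F ^ k) := by
  induction k with
  | zero => simpa using hone
  | succ k ih => rw [pow_succ, pow_succ]; exact ih.mul hF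

/-! ### Power series in `q` -/

/-- `g = ∑ a n q ^ n`. -/
def HasQ (g : ℍ → ℂ) (a : PowerSeries ℂ) : Prop :=
  ∀ τ : ℍ, HasSum (fun n : ℕ => PowerSeries.coeff n a * qy n 0 τ 0) (g τ)

lemma co_map_C (a : PowerSeries ℂ) (n : ℕ) (l : ℤ) :
    FormalExp.co (PowerSeries.map (C : ℂ →+* ℂ[T;T⁻¹]) a) n l =
      if l = 0 then PowerSeries.coeff n a else 0 := by
  simp [FormalExp.co]

/-- Treating a q-series as an expansion constant in y lets the arithmetic of `HasExp` serve for
q-series as well. -/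
lemma hasQ_iff_hasExp {g : ℍ → ℂ} {a : PowerSeries ℂ} :
    HasQ g a ↔ HasExp (fun τ _ => g τ) (PowerSeries.map C a) := by
  have hinj : Function.Injective (fun n : ℕ => (n, (0 : ℤ))) := Prod.mk_left_injective 0
  have key : ∀ τ z, HasSum (fun p : ℕ × ℤ =>
      FormalExp.co (PowerSeries.map C a) p.1 p.2 * qy p.1 p.2 τ z) (g τ) ↔
      HasSum (fun n : ℕ => PowerSeries.coeff n a * qy n 0 τ 0) (g τ) := by
    intro τ z
    rw [← hinj.hasSum_iff]
    · simp [Function.comp_def, co_map_C, qy]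
    · rintro ⟨n, l⟩ h
      have : l ≠ 0 := by rintro rfl; exact h ⟨n, rfl⟩
      simp [co_map_C, this]
  exact ⟨fun h τ z => (key τ z).mpr (h τ), fun h τ => (key τ 0).mp (h τ 0)⟩

lemma HasQ.unique {g : ℍ → ℂ} {a b : PowerSeries ℂ} (ha : HasQ g a) (hb : HasQ g b) : a = b := by
  ext n
  exact congrFun (qSeries_unique ha hb) n

lemma HasQ.congr_left {f g : ℍ → ℂ} {a : PowerSeries ℂ} (h : HasQ f a) (hfg : ∀ τ, f τ = g τ) :
    HasQ g a := funext hfg ▸ h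

lemma HasQ.const (c : ℂ) : HasQ (fun _ => c) (PowerSeries.C c) := by
  intro τ
  convert hasSum_single (f := fun n => PowerSeries.coeff n (PowerSeries.C c) * qy n 0 τ 0) 0 ?_
    using 1
  · simp [qy]
  · intro n hn
    simp [PowerSeries.coeff_C, hn]

lemma HasQ.add {f g : ℍ → ℂ} {a b : PowerSeries ℂ} (hf : HasQ f a) (hg : HasQ g b) :
    HasQ (fun τ => f τ + g τ) (a + b) := by
  rw [hasQ_iff_hasExp] at *
  rw [map_add]
  exact hf.add hg

lemma HasQ.sub {f g : ℍ → ℂ} {a b : PowerSeries ℂ} (hf : HasQ f a) (hg : HasQ g b) :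
    HasQ (fun τ => f τ - g τ) (a - b) := by
  rw [hasQ_iff_hasExp] at *
  rw [map_sub]
  exact hf.sub hg

lemma HasQ.mul {f g : ℍ → ℂ} {a b : PowerSeries ℂ} (hf : HasQ f a) (hg : HasQ g b) :
    HasQ (fun τ => f τ * g τ) (a * b) := by
  rw [hasQ_iff_hasExp] at *
  rw [map_mul]
  exact hf.mul hg

lemma HasQ.pow {f : ℍ → ℂ} {a : PowerSeries ℂ} (hf : HasQ f a) (k : ℕ) :
    HasQ (fun τ => f τ ^ k) (a ^ k) := by
  induction k with
  | zero => simpa using HasQ.const 1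
  | succ k ih => simp only [pow_succ]; exact ih.mul hf

lemma HasQ.sum {ι : Type*} (s : Finset ι) {f : ι → ℍ → ℂ} {a : ι → PowerSeries ℂ}
    (hf : ∀ i ∈ s, HasQ (f i) (a i)) : HasQ (fun τ => ∑ i ∈ s, f i τ) (∑ i ∈ s, a i) := by
  classical
  induction s using Finset.induction_on with
  | empty => simpa using HasQ.const 0
  | insert i s hi ih =>
    simp only [Finset.sum_insert hi]
    exact (hf i (Finset.mem_insert_self _ _)).add
      (ih fun j hj => hf j (Finset.mem_insert_of_mem hj))

lemma HasExp.const (c : ℂ) : HasExp (fun _ _ => c) (PowerSeries.C (C c)) := by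
  simpa using hasQ_iff_hasExp.mp (HasQ.const c)

lemma HasExp.one : HasExp 1 1 := by simpa using! HasExp.const 1

/-- Evaluation at `y = 1`. -/
noncomputable def evalOne : ℂ[T;T⁻¹] →+* ℂ := LaurentPolynomial.eval₂ (RingHom.id ℂ) 1

@[simp] lemma evalOne_C_mul_T (a : ℂ) (n : ℤ) : evalOne (C a * T n) = a := by
  rw [evalOne, LaurentPolynomial.eval₂_C_mul_T]; simp

@[simp] lemma evalOne_T (n : ℤ) : evalOne (T n) = 1 := by
  simpa using evalOne_C_mul_T 1 n

lemma hasSum_evalOne (P : ℂ[T;T⁻¹]) : HasSum (fun l => P.coeff l) (evalOne P) := by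
  induction P using LaurentPolynomial.induction_on' with
  | add P P' h h' => simpa using h.add h'
  | C_mul_T k a =>
    rw [evalOne_C_mul_T, ← single_eq_C_mul_T]
    have := hasSum_ite_eq k a
    simpa [Finsupp.single_apply, eq_comm, -single_eq_C_mul_T] using this

lemma HasExp.hasQ_zero {φ : ℍ → ℂ → ℂ} {F : FormalExp ℂ} (hF : HasExp φ F) :
    HasQ (fun τ => φ τ 0) (PowerSeries.map evalOne F) := by
  intro τ
  refine HasSum.prod_fiberwise (hF τ 0) fun n => ?_
  have := (hasSum_evalOne (PowerSeries.coeff n F)).mul_right (qy n 0 τ 0)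
  simpa [qy, FormalExp.co] using this

/-! ### The modular transformation law -/

/-- `c τ + d`. -/
noncomputable def cocycleDenom (γ : SL(2, ℤ)) (τ : ℍ) : ℂ := (γ 1 0 : ℂ) * τ + (γ 1 1 : ℂ)

lemma cocycleDenom_eq_denom (γ : SL(2, ℤ)) (τ : ℍ) : cocycleDenom γ τ = denom γ τ := by
  rw [ModularGroup.denom_apply]; rfl

lemma cocycleDenom_ne_zero (γ : SL(2, ℤ)) (τ : ℍ) : cocycleDenom γ τ ≠ 0 := by
  rw [cocycleDenom_eq_denom]; exact denom_ne_zero _ _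

lemma cocycleDenom_mul (γ γ' : SL(2, ℤ)) (τ : ℍ) :
    cocycleDenom (γ * γ') τ = cocycleDenom γ (γ' • τ) * cocycleDenom γ' τ := by
  have h2 := cocycleDenom_ne_zero γ' τ
  have e0 : (γ * γ') 1 0 = γ 1 0 * γ' 0 0 + γ 1 1 * γ' 1 0 := by
    simp [Matrix.SpecialLinearGroup.coe_mul, Matrix.mul_apply, Fin.sum_univ_two]
  have e1 : (γ * γ') 1 1 = γ 1 0 * γ' 0 1 + γ 1 1 * γ' 1 1 := by
    simp [Matrix.SpecialLinearGroup.coe_mul, Matrix.mul_apply, Fin.sum_univ_two]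
  have e : ((γ' • τ : ℍ) : ℂ) = ((γ' 0 0 : ℂ) * τ + γ' 0 1) / cocycleDenom γ' τ := by
    rw [UpperHalfPlane.specialLinearGroup_apply]
    simp [cocycleDenom]
  rw [cocycleDenom, cocycleDenom, e, e0, e1]
  field_simp
  rw [cocycleDenom]
  push_cast
  ring

/-- The factor of automorphy of Jacobi forms of weight `k` and index `m`. -/
noncomputable def jacobiFactor (k : ℤ) (m : ℕ) (γ : SL(2, ℤ)) (τ : ℍ) (z : ℂ) : ℂ :=
  cocycleDenom γ τ ^ k * cexp (2 * π * I * m * (γ 1 0 : ℂ) * z ^ 2 / cocycleDenom γ τ)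

lemma jacobiFactor_mul (k : ℤ) (m : ℕ) (γ γ' : SL(2, ℤ)) (τ : ℍ) (z : ℂ) :
    jacobiFactor k m (γ * γ') τ z =
      jacobiFactor k m γ (γ' • τ) (z / cocycleDenom γ' τ) * jacobiFactor k m γ' τ z := by
  have h1 := cocycleDenom_ne_zero γ (γ' • τ)
  have h2 := cocycleDenom_ne_zero γ' τ
  have h3 := cocycleDenom_mul γ γ' τ
  -- This is det γ' = 1 in disguise. Divided by the product of the two denominators and multiplied
  -- by z², it is the additive cocycle relation for the exponent c z² / (cτ + d).
  have key : (γ 1 0 : ℂ) + (γ' 1 0 : ℂ) * cocycleDenom (γ * γ') τ =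
      ((γ * γ') 1 0 : ℂ) * cocycleDenom γ' τ := by
    have hdet := Matrix.det_fin_two γ'.1
    rw [γ'.2] at hdet
    have hdet' : (1 : ℂ) = γ' 0 0 * γ' 1 1 - γ' 0 1 * γ' 1 0 := by exact_mod_cast hdet
    have e0 : (γ * γ') 1 0 = γ 1 0 * γ' 0 0 + γ 1 1 * γ' 1 0 := by
      simp [Matrix.SpecialLinearGroup.coe_mul, Matrix.mul_apply, Fin.sum_univ_two]
    have e1 : (γ * γ') 1 1 = γ 1 0 * γ' 0 1 + γ 1 1 * γ' 1 1 := by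
      simp [Matrix.SpecialLinearGroup.coe_mul, Matrix.mul_apply, Fin.sum_univ_two]
    simp only [cocycleDenom, e0, e1]
    push_cast
    linear_combination (γ 1 0 : ℂ) * hdet'
  rw [jacobiFactor, jacobiFactor, jacobiFactor, h3, mul_zpow, mul_mul_mul_comm, ← Complex.exp_add]
  congr 2
  rw [h3] at key
  field_simp
  linear_combination (-(m : ℂ) * z ^ 2) * key

lemma jacobiFactor_one (k : ℤ) (m : ℕ) (τ : ℍ) (z : ℂ) : jacobiFactor k m 1 τ z = 1 := by
  simp [jacobiFactor, cocycleDenom]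

/-- By the cocycle relation, the group elements obeying the law are closed under products and
inverses, and S, T generate. -/
lemma modular_of_generators {k : ℤ} {m : ℕ} {φ : ℍ → ℂ → ℂ}
    (hS : ∀ τ z, φ (ModularGroup.S • τ) (z / cocycleDenom ModularGroup.S τ) =
      jacobiFactor k m ModularGroup.S τ z * φ τ z)
    (hT : ∀ τ z, φ (ModularGroup.T • τ) (z / cocycleDenom ModularGroup.T τ) =
      jacobiFactor k m ModularGroup.T τ z * φ τ z) (γ : SL(2, ℤ)) :
    ∀ τ z, φ (γ • τ) (z / cocycleDenom γ τ) = jacobiFactor k m γ τ z * φ τ z := by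
  have : γ ∈ Subgroup.closure {ModularGroup.S, ModularGroup.T} := by
    simp [SpecialLinearGroup.SL2Z_generators]
  induction this using Subgroup.closure_induction with
  | mem g hg => rcases hg with rfl | rfl; exacts [hS, hT]
  | one => intro τ z; simp [jacobiFactor_one, cocycleDenom]
  | mul g g' _ _ h h' =>
    intro τ z
    rw [mul_smul, cocycleDenom_mul, jacobiFactor_mul, mul_assoc, ← h' τ z, ← h,
      mul_comm (cocycleDenom g _), ← div_div]
  | inv g _ h =>
    intro τ z
    have h1 := h (g⁻¹ • τ) (z / cocycleDenom g⁻¹ τ)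
    have h2 := cocycleDenom_mul g g⁻¹ τ
    have h3 := jacobiFactor_mul k m g g⁻¹ τ z
    rw [mul_inv_cancel, jacobiFactor_one] at h3
    have h4 : cocycleDenom 1 τ = 1 := by simp [cocycleDenom]
    rw [mul_inv_cancel, h4] at h2
    rw [smul_inv_smul, div_div, mul_comm (cocycleDenom g⁻¹ τ), ← h2, div_one] at h1
    rw [h1, ← mul_assoc, mul_comm (jacobiFactor k m g⁻¹ τ z), ← h3, one_mul]

lemma IsWeakJacobiForm.modular' {k : ℤ} {m : ℕ} {φ : ℍ → ℂ → ℂ} (h : IsWeakJacobiForm k m φ)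
    (γ : SL(2, ℤ)) (τ : ℍ) (z : ℂ) :
    φ (γ • τ) (z / cocycleDenom γ τ) = jacobiFactor k m γ τ z * φ τ z := h.modular γ τ z

lemma cocycleDenom_S (τ : ℍ) : cocycleDenom ModularGroup.S τ = τ := by
  simp [cocycleDenom, ModularGroup.S]

lemma cocycleDenom_T (τ : ℍ) : cocycleDenom ModularGroup.T τ = 1 := by
  simp [cocycleDenom, ModularGroup.T]

lemma jacobiFactor_S (k : ℤ) (m : ℕ) (τ : ℍ) (z : ℂ) :
    jacobiFactor k m ModularGroup.S τ z = (τ : ℂ) ^ k * cexp (2 * π * I * m * z ^ 2 / τ) := by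
  rw [jacobiFactor, cocycleDenom_S]
  simp [ModularGroup.S]

lemma jacobiFactor_T (k : ℤ) (m : ℕ) (τ : ℍ) (z : ℂ) :
    jacobiFactor k m ModularGroup.T τ z = 1 := by
  rw [jacobiFactor, cocycleDenom_T]
  simp [ModularGroup.T]

lemma coe_T_smul (τ : ℍ) : ((ModularGroup.T • τ : ℍ) : ℂ) = τ + 1 := by
  rw [modular_T_smul, add_comm]; simp

lemma coe_S_smul (τ : ℍ) : ((ModularGroup.S • τ : ℍ) : ℂ) = -1 / τ := by
  rw [modular_S_smul]
  change (-(τ : ℂ))⁻¹ = _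
  rw [inv_neg, neg_div, one_div]

lemma qy_T_smul (n : ℕ) (l : ℤ) (τ : ℍ) (z : ℂ) : qy n l (ModularGroup.T • τ) z = qy n l τ z := by
  rw [qy, qy, coe_T_smul, Complex.exp_eq_exp_iff_exists_int]
  exact ⟨n, by push_cast; ring⟩

lemma qy_add_one (n : ℕ) (l : ℤ) (τ : ℍ) (z : ℂ) : qy n l τ (z + 1) = qy n l τ z := by
  rw [qy, qy, Complex.exp_eq_exp_iff_exists_int]
  exact ⟨l, by ring⟩

lemma HasFourierExpansion.T_smul {φ : ℍ → ℂ → ℂ} {f : ℕ → ℤ → ℂ} (h : HasFourierExpansion φ f)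
    (τ : ℍ) (z : ℂ) : φ (ModularGroup.T • τ) z = φ τ z := by
  have := h (ModularGroup.T • τ) z
  simp only [qy_T_smul] at this
  exact this.unique (h τ z)

lemma HasFourierExpansion.add_one {φ : ℍ → ℂ → ℂ} {f : ℕ → ℤ → ℂ} (h : HasFourierExpansion φ f)
    (τ : ℍ) (z : ℂ) : φ τ (z + 1) = φ τ z := by
  have := h τ (z + 1)
  simp only [qy_add_one] at this
  exact this.unique (h τ z)

lemma HasFourierExpansion.add_int {φ : ℍ → ℂ → ℂ} {f : ℕ → ℤ → ℂ} (h : HasFourierExpansion φ f)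
    (τ : ℍ) (z : ℂ) (b : ℤ) : φ τ (z + b) = φ τ z := by
  have hp : Function.Periodic (φ τ) 1 := fun z => h.add_one τ z
  simpa using hp.int_mul b z

/-- A function with a Fourier expansion is a weak Jacobi form as soon as it transforms correctly
under `τ ↦ -1 / τ` and `z ↦ z + τ`. -/
lemma isWeakJacobiForm_of_fourier {k : ℤ} {m : ℕ} {φ : ℍ → ℂ → ℂ} {f : ℕ → ℤ → ℂ}
    (h : HasFourierExpansion φ f)
    (hS : ∀ (τ : ℍ) (z : ℂ), φ (ModularGroup.S • τ) (z / τ) =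
      (τ : ℂ) ^ k * cexp (2 * π * I * m * z ^ 2 / τ) * φ τ z)
    (hE : ∀ (τ : ℍ) (z : ℂ), φ τ (z + τ) = cexp (-(2 * π * I * m * (τ + 2 * z))) * φ τ z) :
    IsWeakJacobiForm k m φ where
  holomorphic := h.differentiableOn
  modular := modular_of_generators (fun τ z => by rw [cocycleDenom_S, jacobiFactor_S, hS])
    (fun τ z => by rw [cocycleDenom_T, jacobiFactor_T, h.T_smul, div_one, one_mul])
  elliptic := by
    intro a b τ z
    rw [h.add_int]
    induction a using Int.induction_on generalizing z with
    | zero => simp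
    | succ a ih =>
      have e : z + ((a + 1 : ℤ) : ℂ) * (τ : ℂ) = (z + (a : ℤ) * τ) + τ := by push_cast; ring
      rw [e, hE, ih, ← mul_assoc, ← Complex.exp_add]
      congr 2
      push_cast
      ring
    | pred a ih =>
      have h1 := hE τ (z + ((-a - 1 : ℤ) : ℂ) * (τ : ℂ))
      have e : z + ((-a - 1 : ℤ) : ℂ) * (τ : ℂ) + τ = z + ((-a : ℤ) : ℂ) * τ := by push_cast; ring
      rw [e, ih] at h1
      refine mul_left_cancel₀ (Complex.exp_ne_zero _) (h1.symm.trans ?_)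
      rw [← mul_assoc, ← Complex.exp_add]
      congr 2
      push_cast
      ring
  fourier := ⟨f, h⟩

/-! ### Laurent expansions in `y` for fixed `τ` -/

/-- `g (z) = ∑ c l y ^ l`, absolutely convergent on `ℂ`. -/
def HasLaurent (g : ℂ → ℂ) (c : ℤ → ℂ) : Prop :=
  ∀ z, HasSum (fun l : ℤ => c l * cexp (2 * π * I * (l * z))) (g z)

lemma HasLaurent.unique {g : ℂ → ℂ} {c d : ℤ → ℂ} (hc : HasLaurent g c) (hd : HasLaurent g d) :
    c = d := cexp_coeff_unique hc hd

lemma HasLaurent.eq {g h : ℂ → ℂ} {c : ℤ → ℂ} (hg : HasLaurent g c) (hh : HasLaurent h c) :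
    g = h := funext fun z => (hg z).unique (hh z)

lemma HasLaurent.add {g h : ℂ → ℂ} {c d : ℤ → ℂ} (hg : HasLaurent g c) (hh : HasLaurent h d) :
    HasLaurent (g + h) (c + d) := fun z => by
  simpa [add_mul] using (hg z).add (hh z)

lemma HasLaurent.const_mul {g : ℂ → ℂ} {c : ℤ → ℂ} (hg : HasLaurent g c) (a : ℂ) :
    HasLaurent (fun z => a * g z) (fun l => a * c l) := fun z => by
  simpa [mul_assoc] using (hg z).mul_left a

lemma HasLaurent.comp_add {g : ℂ → ℂ} {c : ℤ → ℂ} (hg : HasLaurent g c) (w : ℂ) :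
    HasLaurent (fun z => g (z + w)) (fun l => c l * cexp (2 * π * I * (l * w))) := fun z => by
  refine (hg (z + w)).congr_fun fun l => ?_
  rw [mul_assoc, ← Complex.exp_add]
  ring_nf

lemma HasLaurent.comp_neg {g : ℂ → ℂ} {c : ℤ → ℂ} (hg : HasLaurent g c) :
    HasLaurent (fun z => g (-z)) (fun l => c (-l)) := fun z => by
  refine ((Equiv.neg ℤ).hasSum_iff.mpr (hg (-z))).congr_fun fun l => ?_
  simp

lemma HasLaurent.exp_mul {g : ℂ → ℂ} {c : ℤ → ℂ} (hg : HasLaurent g c) (k : ℤ) :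
    HasLaurent (fun z => cexp (2 * π * I * (k * z)) * g z) (fun l => c (l - k)) := fun z => by
  refine ((Equiv.subRight k).hasSum_iff.mpr ((hg z).mul_left _)).congr_fun fun l => ?_
  simp only [Function.comp, Equiv.subRight_apply]
  rw [show (2 * π * I * (l * z) : ℂ) = 2 * π * I * (k * z) + 2 * π * I * ((l - k : ℤ) * z) by
    push_cast; ring, Complex.exp_add]
  ring

lemma HasLaurent.mul {g h : ℂ → ℂ} {c d : ℤ → ℂ} (hg : HasLaurent g c) (hh : HasLaurent h d) :
    HasLaurent (g * h) (fun l => ∑' k, c k * d (l - k)) := by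
  have hsum : ∀ l, Summable fun k => c k * d (l - k) := by
    intro l
    have h1 := hasSum_mul_of_hasSum (hg 0) (hh 0)
    have h2 := h1.summable.comp_injective (i := fun k : ℤ => (k, l - k))
      (fun a b hab => (Prod.ext_iff.mp hab).1)
    simpa [Function.comp_def] using h2
  intro z
  have e : HasSum (fun p : ℤ × ℤ => c p.2 * d (p.1 - p.2) * cexp (2 * π * I * (p.1 * z)))
      (g z * h z) := by
    have h1 := hasSum_mul_of_hasSum (hg z) (hh z)
    let e : ℤ × ℤ ≃ ℤ × ℤ :=
      { toFun := fun p => (p.2, p.1 - p.2), invFun := fun p => (p.1 + p.2, p.1)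
        left_inv := fun p => by simp, right_inv := fun p => by simp }
    refine (e.hasSum_iff.mpr h1).congr_fun fun p => ?_
    simp only [Function.comp, e, Equiv.coe_fn_mk]
    rw [show (2 * π * I * (p.1 * z) : ℂ) = 2 * π * I * (p.2 * z) +
      2 * π * I * ((p.1 - p.2 : ℤ) * z) by push_cast; ring, Complex.exp_add]
    ring
  exact HasSum.prod_fiberwise e fun l => (hsum l).hasSum.mul_right _

/-- The coefficient recursion expressing quasi-periodicity under `z ↦ z + τ`. -/
lemma HasLaurent.recursion {g : ℂ → ℂ} {c : ℤ → ℂ} {m : ℕ} {τ : ℂ} (hg : HasLaurent g c)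
    (hE : ∀ z, g (z + τ) = cexp (-(2 * π * I * m * (τ + 2 * z))) * g z) (l : ℤ) :
    c (l + 2 * m) = cexp (2 * π * I * ((l + m) * τ)) * c l := by
  have h1 := hg.comp_add τ
  have h2 := (hg.exp_mul (-(2 * m))).const_mul (cexp (-(2 * π * I * m * τ)))
  have h3 : (fun z => g (z + τ)) = fun z => cexp (-(2 * π * I * m * τ)) *
      (cexp (2 * π * I * ((-(2 * m) : ℤ) * z)) * g z) := by
    funext z
    rw [hE, ← mul_assoc, ← Complex.exp_add]
    congr 2
    push_cast
    ring
  rw [h3] at h1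
  have h4 := congrFun (h1.unique h2) l
  simp only [sub_neg_eq_add] at h4
  rw [show (2 * π * I * ((l + m) * τ) : ℂ) = 2 * π * I * (l * τ) + 2 * π * I * m * τ by ring,
    Complex.exp_add, mul_right_comm, mul_comm _ (c l), h4, mul_right_comm, ← Complex.exp_add]
  simp

lemma HasFourierExpansion.hasLaurent {φ : ℍ → ℂ → ℂ} {f : ℕ → ℤ → ℂ}
    (h : HasFourierExpansion φ f) (τ : ℍ) : HasLaurent (φ τ) (fun l => yCoeff f l τ) :=
  h.hasSum_yCoeff τ

/-! ### Weak Jacobi forms with a formal expansion -/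

lemma IsWeakJacobiForm.E_law {k : ℤ} {m : ℕ} {φ : ℍ → ℂ → ℂ} (h : IsWeakJacobiForm k m φ)
    (τ : ℍ) (z : ℂ) : φ τ (z + τ) = cexp (-(2 * π * I * m * (τ + 2 * z))) * φ τ z := by
  simpa using h.elliptic 1 0 τ z

/-- The matrix -1 fixes τ and sends z to -z. -/
lemma IsWeakJacobiForm.even {k : ℤ} {m : ℕ} {φ : ℍ → ℂ → ℂ} (h : IsWeakJacobiForm k m φ)
    (hk : Even k) (τ : ℍ) (z : ℂ) : φ τ (-z) = φ τ z := by
  have h1 := h.modular' (-1) τ z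
  have e1 : cocycleDenom (-1) τ = -1 := by simp [cocycleDenom]
  have e2 : jacobiFactor k m (-1) τ z = 1 := by
    rw [jacobiFactor, e1, hk.neg_one_zpow]
    simp
  have e3 : (-1 : SL(2, ℤ)) • τ = τ := by simp
  rw [e1, e2, e3] at h1
  simpa [div_neg] using h1

/-- `φ` is a weak Jacobi form of weight `k` and index `m` with formal expansion `F`. -/
structure JacobiExp (k : ℤ) (m : ℕ) (φ : ℍ → ℂ → ℂ) (F : FormalExp ℂ) : Prop where
  hasExp : HasExp φ F
  S_law : ∀ (τ : ℍ) (z : ℂ), φ (ModularGroup.S • τ) (z / τ) =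
      (τ : ℂ) ^ k * cexp (2 * π * I * m * z ^ 2 / τ) * φ τ z
  E_law : ∀ (τ : ℍ) (z : ℂ), φ τ (z + τ) = cexp (-(2 * π * I * m * (τ + 2 * z))) * φ τ z

lemma JacobiExp.isWeakJacobiForm {k : ℤ} {m : ℕ} {φ : ℍ → ℂ → ℂ} {F : FormalExp ℂ}
    (h : JacobiExp k m φ F) : IsWeakJacobiForm k m φ :=
  isWeakJacobiForm_of_fourier h.hasExp h.S_law h.E_law

lemma JacobiExp.mul {k k' : ℤ} {m m' : ℕ} {φ ψ : ℍ → ℂ → ℂ} {F G : FormalExp ℂ}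
    (h : JacobiExp k m φ F) (h' : JacobiExp k' m' ψ G) :
    JacobiExp (k + k') (m + m') (φ * ψ) (F * G) where
  hasExp := h.hasExp.mul h'.hasExp
  S_law τ z := by
    have e : (2 * π * I * (m + m' : ℕ) * z ^ 2 / τ : ℂ) =
      2 * π * I * m * z ^ 2 / τ + 2 * π * I * m' * z ^ 2 / τ := by push_cast; ring
    simp only [Pi.mul_apply]
    rw [h.S_law, h'.S_law, e, Complex.exp_add, zpow_add₀ τ.ne_zero]
    ring
  E_law τ z := by
    have e : (-(2 * π * I * (m + m' : ℕ) * (τ + 2 * z)) : ℂ) =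
      -(2 * π * I * m * (τ + 2 * z)) + -(2 * π * I * m' * (τ + 2 * z)) := by push_cast; ring
    simp only [Pi.mul_apply]
    rw [h.E_law, h'.E_law, e, Complex.exp_add]
    ring

lemma JacobiExp.one : JacobiExp 0 0 1 1 where
  hasExp := HasExp.one
  S_law τ z := by simp
  E_law τ z := by simp

lemma JacobiExp.pow {k : ℤ} {m : ℕ} {φ : ℍ → ℂ → ℂ} {F : FormalExp ℂ}
    (h : JacobiExp k m φ F) (n : ℕ) : JacobiExp (n * k) (n * m) (φ ^ n) (F ^ n) := by
  induction n with
  | zero => simpa using JacobiExp.one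
  | succ n ih =>
    have := ih.mul h
    rw [pow_succ, pow_succ]
    convert this using 1
    · push_cast; ring
    · ring

lemma JacobiExp.zero (k : ℤ) (m : ℕ) : JacobiExp k m 0 0 where
  hasExp := HasExp.zero
  S_law τ z := by simp
  E_law τ z := by simp

lemma JacobiExp.add {k : ℤ} {m : ℕ} {φ ψ : ℍ → ℂ → ℂ} {F G : FormalExp ℂ}
    (h : JacobiExp k m φ F) (h' : JacobiExp k m ψ G) : JacobiExp k m (φ + ψ) (F + G) where
  hasExp := h.hasExp.add h'.hasExp
  S_law τ z := by simp only [Pi.add_apply, h.S_law, h'.S_law]; ring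
  E_law τ z := by simp only [Pi.add_apply, h.E_law, h'.E_law]; ring

lemma JacobiExp.sum {ι : Type*} (s : Finset ι) {k : ℤ} {m : ℕ} {φ : ι → ℍ → ℂ → ℂ}
    {F : ι → FormalExp ℂ} (h : ∀ i ∈ s, JacobiExp k m (φ i) (F i)) :
    JacobiExp k m (∑ i ∈ s, φ i) (∑ i ∈ s, F i) := by
  classical
  induction s using Finset.induction_on with
  | empty => simpa using JacobiExp.zero k m
  | insert i s hi ih =>
    simp only [Finset.sum_insert hi]
    exact (h i (Finset.mem_insert_self _ _)).add
      (ih fun j hj => h j (Finset.mem_insert_of_mem hj))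

lemma JacobiExp.const (c : ℂ) : JacobiExp 0 0 (fun _ _ => c) (PowerSeries.C (C c)) where
  hasExp := HasExp.const c
  S_law τ z := by simp
  E_law τ z := by simp

lemma JacobiExp.congr {k k' : ℤ} {m m' : ℕ} {φ : ℍ → ℂ → ℂ} {F : FormalExp ℂ}
    (h : JacobiExp k m φ F) (hk : k = k') (hm : m = m') : JacobiExp k' m' φ F := by
  subst hk hm; exact h

lemma JacobiExp.const_mul {k : ℤ} {m : ℕ} {φ : ℍ → ℂ → ℂ} {F : FormalExp ℂ}
    (h : JacobiExp k m φ F) (c : ℂ) :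
    JacobiExp k m (fun τ z => c * φ τ z) (PowerSeries.C (C c) * F) :=
  ((JacobiExp.const c).mul h).congr (zero_add k) (zero_add m)

/-! ### Modular forms -/

lemma qParam_one_pow (n : ℕ) (τ : ℍ) :
    Function.Periodic.qParam 1 (τ : ℂ) ^ n = qy n 0 τ 0 := by
  rw [Function.Periodic.qParam, ← Complex.exp_nat_mul, qy]
  congr 1
  push_cast
  ring

lemma hasQ_modularForm {k : ℤ} (f : ModularForm 𝒮ℒ k) : HasQ f (qExpansion 1 f) := by
  intro τ
  have := ModularForm.hasSum_qExpansion f one_pos one_mem_strictPeriods_SL τ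
  simpa only [qParam_one_pow, smul_eq_mul] using this

lemma modularForm_smul {k : ℤ} (f : ModularForm 𝒮ℒ k) (γ : SL(2, ℤ)) (τ : ℍ) :
    f (γ • τ) = cocycleDenom γ τ ^ k * f τ := by
  have := SlashInvariantForm.slash_action_eqn'' f (γ := (γ : GL (Fin 2) ℝ))
    (MonoidHom.mem_range.mpr ⟨γ, rfl⟩) τ
  rw [cocycleDenom_eq_denom]
  exact this

lemma JacobiExp.modularForm {k : ℤ} (f : ModularForm 𝒮ℒ k) :
    JacobiExp k 0 (fun τ _ => f τ) (PowerSeries.map C (qExpansion 1 f)) where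
  hasExp := hasQ_iff_hasExp.mp (hasQ_modularForm f)
  S_law τ z := by
    have := modularForm_smul f ModularGroup.S τ
    rw [cocycleDenom_S] at this
    simpa using this
  E_law τ z := by simp

/-- A function with a `q`-series and the transformation behaviour of a modular form is one. -/
lemma HasQ.exists_modularForm {k : ℤ} {g : ℍ → ℂ} {a : PowerSeries ℂ} (h : HasQ g a)
    (hg : ∀ (γ : SL(2, ℤ)) (τ : ℍ), g (γ • τ) = cocycleDenom γ τ ^ k * g τ) :
    ∃ f : ModularForm 𝒮ℒ k, ⇑f = g := by
  have hslash : ∀ γ : SL(2, ℤ), g ∣[k] γ = g := by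
    intro γ
    funext τ
    rw [ModularForm.SL_slash_apply, hg, cocycleDenom_eq_denom, mul_right_comm, ← zpow_add₀]
    · simp
    · exact denom_ne_zero _ _
  have hbdd : IsBoundedAtImInfty g :=
    isBoundedAtImInfty_of_hasSum_qExpansion one_pos (c := fun n => PowerSeries.coeff n a)
      fun τ => by simpa only [qParam_one_pow, smul_eq_mul] using h τ
  refine ⟨⟨⟨g, ?_⟩, ?_, ?_⟩, rfl⟩
  · rintro _ ⟨γ, rfl⟩
    exact hslash γ
  · rw [UpperHalfPlane.mdifferentiable_iff]
    have h1 := (hasQ_iff_hasExp.mp h).differentiableOn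
    have h2 : DifferentiableOn ℂ (fun t : ℂ => ((t, 0) : ℂ × ℂ)) {t | 0 < t.im} := by fun_prop
    exact h1.comp h2 fun t ht => ht
  · intro c hc
    rw [Subgroup.IsArithmetic.isCusp_iff_isCusp_SL2Z] at hc
    rw [OnePoint.isBoundedAt_iff_forall_SL2Z hc]
    intro γ _
    change IsBoundedAtImInfty (g ∣[k] γ)
    rw [hslash]
    exact hbdd

/-! ### Integral formal expansions -/

/-- The complex expansion defined by an integral one. -/
noncomputable def toComplex : FormalExp ℤ →+* FormalExp ℂ :=
  PowerSeries.map (AddMonoidAlgebra.mapRingHom ℤ (Int.castRingHom ℂ))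

@[simp] lemma co_toComplex (F : FormalExp ℤ) (n : ℕ) (l : ℤ) :
    (toComplex F).co n l = (F.co n l : ℂ) := by
  simp [toComplex, FormalExp.co]

lemma toComplex_injective : Function.Injective toComplex := fun F G h =>
  FormalExp.ext fun n l => by
    have := congrArg (fun H => FormalExp.co H n l) h
    simpa using this

lemma hasIntegralCoeffs_iff {φ : ℍ → ℂ → ℂ} :
    HasIntegralCoeffs φ ↔ ∃ F : FormalExp ℤ, HasExp φ (toComplex F) := by
  constructor
  · rintro ⟨f, hf⟩
    have hsupp : ∀ n, (Function.support (f n)).Finite := fun n => hf.finite_support n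
    refine ⟨FormalExp.ofCoeff f hsupp, ?_⟩
    intro τ z
    simp only [co_toComplex, FormalExp.co_ofCoeff]
    exact hf τ z
  · rintro ⟨F, hF⟩
    exact ⟨F.co, fun τ z => by simpa using hF τ z⟩

/-! ### Theta series -/

/-- The unary theta series `∑ χ (n) q ^ (n² / 8 M) y ^ (n / 2)`. -/
noncomputable def thetaSeries (χ : ℤ → ℤ) (M : ℕ) (τ : ℍ) (z : ℂ) : ℂ :=
  ∑' n : ℤ, (χ n : ℂ) * cexp (π * I * n ^ 2 / (4 * M) * (τ : ℂ) + π * I * n * z)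

/-- The properties of `(-4 / n)` (for `M = 1`) and `(12 / n)` (for `M = 3`) used below. -/
structure IsThetaChar (χ : ℤ → ℤ) (M : ℕ) : Prop where
  pos : 0 < M
  abs_le : ∀ n, |χ n| ≤ 1
  dvd : ∀ n, χ n ≠ 0 → (8 * M : ℤ) ∣ n ^ 2 - 1
  shift : ∀ n, χ (n + 2 * M) = -χ n

variable {χ : ℤ → ℤ} {M : ℕ}

lemma IsThetaChar.even_eq_zero (h : IsThetaChar χ M) {n : ℤ} (hn : Even n) : χ n = 0 := by
  by_contra h0
  have h1 : (2 : ℤ) ∣ n ^ 2 - 1 := (Dvd.intro _ (by ring : (2 : ℤ) * (4 * M) = 8 * M)).trans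
    (h.dvd n h0)
  have h2 : Even (n ^ 2) := hn.pow_of_ne_zero two_ne_zero
  obtain ⟨a, ha⟩ := h1
  obtain ⟨b, hb⟩ := h2
  omega

lemma IsThetaChar.hasSum (h : IsThetaChar χ M) (τ : ℍ) (z : ℂ) :
    HasSum (fun n : ℤ => (χ n : ℂ) * cexp (π * I * n ^ 2 / (4 * M) * (τ : ℂ) + π * I * n * z))
      (thetaSeries χ M τ z) := by
  have hM : (0 : ℝ) < 4 * M := by exact_mod_cast (by have := h.pos; omega : 0 < 4 * M)
  have h1 : Summable (jacobiTheta₂_term · (z / 2) ((τ : ℂ) / (4 * M : ℝ))) := by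
    rw [summable_jacobiTheta₂_term_iff, Complex.div_ofReal_im]
    exact div_pos τ.im_pos hM
  refine Summable.hasSum (Summable.of_norm_bounded h1.norm fun n => ?_)
  rw [norm_mul, jacobiTheta₂_term]
  have h2 : ‖(χ n : ℂ)‖ ≤ 1 := by rw [Complex.norm_intCast]; exact_mod_cast h.abs_le n
  refine (mul_le_of_le_one_left (norm_nonneg _) h2).trans_eq ?_
  congr 2
  push_cast
  ring

/-- Replacing n by n + 2M completes the square, and χ changes sign. -/
lemma IsThetaChar.add_tau (h : IsThetaChar χ M) (τ : ℍ) (z : ℂ) :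
    thetaSeries χ M τ (z + τ) = -cexp (-(π * I * M * (τ + 2 * z))) * thetaSeries χ M τ z := by
  have h1 := (h.hasSum τ z).mul_left (-cexp (-(π * I * M * (τ + 2 * z))))
  have h2 := (Equiv.addRight (2 * M : ℤ)).hasSum_iff.mpr h1
  have hM : (M : ℂ) ≠ 0 := by exact_mod_cast h.pos.ne'
  refine (h.hasSum τ (z + τ)).unique (h2.congr_fun fun n => ?_)
  simp only [Function.comp, Equiv.coe_addRight, h.shift]
  push_cast
  rw [mul_left_comm (-cexp _), neg_mul, neg_mul, mul_neg, neg_neg, ← Complex.exp_add]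
  congr 2
  field_simp
  ring

lemma IsThetaChar.neg (h : IsThetaChar χ M) {ε : ℤ} (hε : ∀ n, χ (-n) = ε * χ n) (τ : ℍ) (z : ℂ) :
    thetaSeries χ M τ (-z) = ε * thetaSeries χ M τ z := by
  have h1 := (Equiv.neg ℤ).hasSum_iff.mpr (h.hasSum τ (-z))
  refine h1.unique (((h.hasSum τ z).mul_left (ε : ℂ)).congr_fun fun n => ?_)
  simp only [Function.comp, Equiv.neg_apply, hε]
  push_cast
  ring_nf

lemma IsThetaChar.hasSum_odd (h : IsThetaChar χ M) (τ : ℍ) (z : ℂ) :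
    HasSum (fun l : ℤ => (χ (2 * l + 1) : ℂ) *
      cexp (π * I * (2 * l + 1) ^ 2 / (4 * M) * (τ : ℂ) + π * I * (2 * l + 1) * z))
      (thetaSeries χ M τ z) := by
  have hinj : Function.Injective (fun l : ℤ => 2 * l + 1) := fun a b hab => by
    simpa using hab
  have := (hinj.hasSum_iff (f := fun n : ℤ => (χ n : ℂ) *
    cexp (π * I * n ^ 2 / (4 * M) * (τ : ℂ) + π * I * n * z)) fun n hn => ?_).mpr (h.hasSum τ z)
  · refine this.congr_fun fun l => ?_
    simp
  · rw [h.even_eq_zero, Int.cast_zero, zero_mul]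
    by_contra hodd
    rw [Int.not_even_iff_odd] at hodd
    obtain ⟨k, rfl⟩ := hodd
    exact hn ⟨k, rfl⟩

/-- The theta series divided by `q ^ (1 / 8 M) y ^ (1 / 2)`, its leading monomial. -/
noncomputable def thetaRed (χ : ℤ → ℤ) (M : ℕ) (τ : ℍ) (z : ℂ) : ℂ :=
  cexp (-(π * I / (4 * M) * τ + π * I * z)) * thetaSeries χ M τ z

lemma thetaSeries_eq (χ : ℤ → ℤ) (M : ℕ) (τ : ℍ) (z : ℂ) :
    thetaSeries χ M τ z = cexp (π * I / (4 * M) * τ + π * I * z) * thetaRed χ M τ z := by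
  rw [thetaRed, ← mul_assoc, ← Complex.exp_add]
  simp

lemma IsThetaChar.hasLaurent (h : IsThetaChar χ M) (τ : ℍ) :
    HasLaurent (thetaRed χ M τ) fun l => (χ (2 * l + 1) : ℂ) *
      cexp (π * I * (2 * l + 1) ^ 2 / (4 * M) * τ - π * I / (4 * M) * τ) := fun z => by
  refine ((h.hasSum_odd τ z).mul_left _).congr_fun fun l => ?_
  rw [mul_left_comm (cexp (-_)), mul_assoc, ← Complex.exp_add, ← Complex.exp_add]
  congr 2
  ring

/-- The coefficients of `thetaRed`. -/
def thetaCoeff (χ : ℤ → ℤ) (M n : ℕ) (l : ℤ) : ℤ :=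
  if 8 * M * n = (2 * l + 1) ^ 2 - 1 then χ (2 * l + 1) else 0

lemma finite_support_thetaCoeff (χ : ℤ → ℤ) (M n : ℕ) :
    (Function.support (thetaCoeff χ M n)).Finite := by
  refine (Set.finite_Icc (-(8 * M * n + 1 : ℤ)) (8 * M * n + 1)).subset fun l hl => ?_
  have h : (8 * M * n : ℤ) = (2 * l + 1) ^ 2 - 1 := by
    by_contra h
    exact hl (if_neg h)
  have h1 : |l| ≤ 8 * M * n + 1 := by
    rw [h]
    rcases abs_cases l with ⟨h1, h2⟩ | ⟨h1, h2⟩ <;> rw [h1] <;> nlinarith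
  exact abs_le.mp h1

/-- The formal expansion of `thetaRed`. -/
noncomputable def thetaFormal (χ : ℤ → ℤ) (M : ℕ) : FormalExp ℤ :=
  FormalExp.ofCoeff (thetaCoeff χ M) (finite_support_thetaCoeff χ M)

lemma IsThetaChar.hasExp (h : IsThetaChar χ M) :
    HasExp (thetaRed χ M) (toComplex (thetaFormal χ M)) := by
  have hM : (8 * M : ℤ) ≠ 0 := by have := h.pos; omega
  have hM' : (M : ℂ) ≠ 0 := by exact_mod_cast h.pos.ne'
  intro τ z
  -- When 8M does not divide (2l+1)² - 1, the truncated quotient is meaningless, but then χ (2l+1) =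
  -- 0 by `dvd` and both terms vanish.
  let i : ℤ → ℕ × ℤ := fun l => ((((2 * l + 1) ^ 2 - 1) / (8 * M)).toNat, l)
  have hi : Function.Injective i := fun a b hab => (Prod.ext_iff.mp hab).2
  refine (hi.hasSum_iff fun p hp => ?_).mp ((h.hasLaurent τ z).congr_fun fun l => ?_)
  · obtain ⟨n, l⟩ := p
    have h0 : thetaCoeff χ M n l = 0 := by
      refine if_neg fun h1 => hp ⟨l, ?_⟩
      simp only [i, Prod.mk.injEq, and_true]
      rw [← h1, Int.mul_ediv_cancel_left _ hM]
      simp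
    simp [thetaFormal, h0]
  · simp only [Function.comp, i, co_toComplex, thetaFormal, FormalExp.co_ofCoeff]
    by_cases h0 : χ (2 * l + 1) = 0
    · simp [thetaCoeff, h0]
    · obtain ⟨k, hk⟩ := h.dvd _ h0
      have hk0 : 0 ≤ k := by
        by_contra hneg
        have h1 : (0 : ℤ) < 8 * M := by have := h.pos; omega
        have h2 : (0 : ℤ) ≤ (2 * l + 1) ^ 2 - 1 := by
          have : (2 * l + 1) ^ 2 - 1 = 4 * (l * (l + 1)) := by ring
          have h3 : 0 ≤ l * (l + 1) := by
            rcases le_or_gt 0 l with h3 | h3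
            · positivity
            · nlinarith
          omega
        nlinarith
      obtain ⟨n, rfl⟩ := Int.eq_ofNat_of_zero_le hk0
      have hk2 := hk
      rw [hk, Int.mul_ediv_cancel_left _ hM, Int.toNat_natCast, thetaCoeff, if_pos hk.symm, qy,
        mul_assoc (χ _ : ℂ), ← Complex.exp_add]
      congr 2
      have hk3 : ((2 * l + 1) ^ 2 - 1 : ℂ) = 8 * M * n := by exact_mod_cast hk2
      field_simp
      linear_combination -(τ : ℂ) * hk3

/-! ### The characters modulo `4` and `12` -/

/-- The Kronecker symbol `(-4 / n)`. -/
def chi4 (n : ℤ) : ℤ := ZMod.χ₄ (n : ZMod 4)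

lemma chi4_eq (n : ℤ) : chi4 n = if n % 2 = 0 then 0 else if n % 4 = 1 then 1 else -1 :=
  ZMod.χ₄_int_eq_if_mod_four n

lemma chi4_neg (n : ℤ) : chi4 (-n) = (-1) * chi4 n := by
  simp only [chi4_eq]; split_ifs <;> omega

lemma chi12_neg (n : ℤ) : chi12 (-n) = 1 * chi12 n := by
  simp only [chi12]; split_ifs <;> omega

lemma isThetaChar_chi4 : IsThetaChar chi4 1 where
  pos := one_pos
  abs_le n := by rw [chi4_eq]; split_ifs <;> simp
  dvd n hn := by
    have h1 : n % 4 = 1 ∨ n % 4 = 3 := by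
      by_contra h
      refine hn ?_
      rw [chi4_eq]
      split_ifs <;> omega
    obtain ⟨k, rfl | rfl⟩ : ∃ k, n = 4 * k + 1 ∨ n = 4 * k + 3 := ⟨n / 4, by omega⟩
    · exact ⟨2 * k ^ 2 + k, by push_cast; ring⟩
    · exact ⟨2 * k ^ 2 + 3 * k + 1, by push_cast; ring⟩
  shift n := by simp only [chi4_eq]; push_cast; split_ifs <;> omega

lemma isThetaChar_chi12 : IsThetaChar chi12 3 where
  pos := by norm_num
  abs_le n := by rw [chi12]; split_ifs <;> simp
  dvd n hn := by
    obtain ⟨k, h | h | h | h⟩ : ∃ k, n = 12 * k + 1 ∨ n = 12 * k + 5 ∨ n = 12 * k + 7 ∨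
        n = 12 * k + 11 := by
      refine ⟨n / 12, ?_⟩
      by_contra h
      refine hn ?_
      rw [chi12]
      split_ifs <;> omega
    · exact ⟨6 * k ^ 2 + k, by rw [h]; push_cast; ring⟩
    · exact ⟨6 * k ^ 2 + 5 * k + 1, by rw [h]; push_cast; ring⟩
    · exact ⟨6 * k ^ 2 + 7 * k + 2, by rw [h]; push_cast; ring⟩
    · exact ⟨6 * k ^ 2 + 11 * k + 5, by rw [h]; push_cast; ring⟩
  shift n := by simp only [chi12]; push_cast; split_ifs <;> omega

lemma theta_eq (τ : ℍ) (z : ℂ) : theta τ z = thetaSeries chi4 1 τ z := by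
  simp [theta, thetaSeries, chi4]

lemma theta_neg (τ : ℍ) (z : ℂ) : theta τ (-z) = -theta τ z := by
  rw [theta_eq, theta_eq, isThetaChar_chi4.neg chi4_neg]
  simp

/-! ### Transformation under `τ ↦ -1 / τ` -/

/-- The branch of `√(-i τ)` with positive real part. -/
noncomputable def sqrtNegI (τ : ℍ) : ℂ := (-I * (τ : ℂ)) ^ (1 / 2 : ℂ)

lemma sqrtNegI_sq (τ : ℍ) : sqrtNegI τ ^ 2 = -I * τ := by
  rw [sqrtNegI, ← Complex.cpow_nat_mul]
  norm_num

lemma sqrtNegI_ne_zero (τ : ℍ) : sqrtNegI τ ≠ 0 := by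
  intro h
  have := sqrtNegI_sq τ
  rw [h] at this
  have h2 : (-I * (τ : ℂ)) ≠ 0 := mul_ne_zero (neg_ne_zero.mpr I_ne_zero) τ.ne_zero
  exact h2 (by simpa using this.symm)

lemma eta_S (τ : ℍ) : ModularForm.eta ((ModularGroup.S • τ : ℍ) : ℂ) =
    sqrtNegI τ * ModularForm.eta τ := by
  have h := ModularForm.eta_comp_eq_csqrt_I_inv τ.2
  simp only [Function.comp, Pi.smul_apply, Pi.mul_apply, smul_eq_mul] at h
  rw [coe_S_smul]
  refine h.trans ?_
  rw [← mul_assoc]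
  congr 1
  have hτ : (τ : ℂ) ≠ 0 := τ.ne_zero
  have harg : 0 ≤ arg (τ : ℂ) := Complex.arg_nonneg_iff.mpr τ.im_pos.le
  have harg' := Complex.arg_le_pi (τ : ℂ)
  -- The principal logarithm is additive here because arg τ lies in [0, π] and arg (-i) = -π/2; this
  -- fixes the branch of the square root.
  have hlog : Complex.log (-I * τ) = Complex.log (-I) + Complex.log τ := by
    refine Complex.log_mul (neg_ne_zero.mpr I_ne_zero) hτ ?_
    rw [Complex.arg_neg_I]
    constructor <;> linarith [Real.pi_pos]
  rw [sqrt_eq_exp hτ, sqrt_eq_exp I_ne_zero, ← Complex.exp_neg,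
    ← Complex.exp_add, sqrtNegI,
    Complex.cpow_def_of_ne_zero (mul_ne_zero (neg_ne_zero.mpr I_ne_zero) hτ), hlog,
    Complex.log_neg_I, Complex.log_I]
  congr 1
  ring

lemma theta_eq_jacobiTheta₂ (τ : ℍ) (z : ℂ) :
    theta τ z = cexp (π * I * τ / 4 + π * I * z) * jacobiTheta₂ (z + τ / 2 + 1 / 2) τ := by
  have h1 := (hasSum_jacobiTheta₂_term (z + τ / 2 + 1 / 2) τ.im_pos).mul_left
    (cexp (π * I * τ / 4 + π * I * z))
  rw [theta_eq]
  refine (isThetaChar_chi4.hasSum_odd τ z).unique (h1.congr_fun fun l => ?_)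
  have hχ : ((chi4 (2 * l + 1) : ℤ) : ℂ) = cexp (π * I * l) := by
    rw [chi4_eq]
    rcases Int.even_or_odd' l with ⟨k, rfl | rfl⟩
    · rw [if_neg (by omega), if_pos (by omega),
        show (π * I * ((2 * k : ℤ) : ℂ)) = k * (2 * π * I) by push_cast; ring,
        Complex.exp_int_mul_two_pi_mul_I]
      simp
    · rw [if_neg (by omega), if_neg (by omega),
        show (π * I * ((2 * k + 1 : ℤ) : ℂ)) = k * (2 * π * I) + π * I by push_cast; ring,
        Complex.exp_add, Complex.exp_int_mul_two_pi_mul_I, Complex.exp_pi_mul_I]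
      simp
  rw [hχ, jacobiTheta₂_term, ← Complex.exp_add, ← Complex.exp_add]
  congr 1
  push_cast
  ring

lemma theta_S (τ : ℍ) (z : ℂ) : theta (ModularGroup.S • τ) (z / τ) =
    -I * sqrtNegI τ * cexp (π * I * z ^ 2 / τ) * theta τ z := by
  have hτ : (τ : ℂ) ≠ 0 := τ.ne_zero
  -- The half-period is taken with -1/2 so that division by τ turns it into the half-period of -1/τ
  -- with +1/2; on the other side periodicity changes the sign back.
  have h1 := jacobiTheta₂_functional_equation (z + τ / 2 - 1 / 2) τ
  have h2 : jacobiTheta₂ (z + τ / 2 + 1 / 2) τ = jacobiTheta₂ (z + τ / 2 - 1 / 2) τ := by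
    rw [← jacobiTheta₂_add_left (z + τ / 2 - 1 / 2)]
    congr 1
    ring
  have h3 : (z + τ / 2 - 1 / 2) / τ = z / τ + (-1 / τ) / 2 + 1 / 2 := by
    field_simp
    ring
  have h4 := sqrtNegI_ne_zero τ
  rw [theta_eq_jacobiTheta₂, theta_eq_jacobiTheta₂, h2, h1, h3, coe_S_smul]
  change _ = -I * sqrtNegI τ * _ * (_ * (1 / sqrtNegI τ * _ * _))
  have h5 : cexp (π * I * (-1 / τ) / 4 + π * I * (z / τ)) = -I * cexp (π * I * z ^ 2 / τ) *
      cexp (π * I * τ / 4 + π * I * z) * cexp (-π * I * (z + τ / 2 - 1 / 2) ^ 2 / τ) := by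
    have hI : -I = cexp (-(π / 2 * I)) := by
      rw [Complex.exp_neg, Complex.exp_pi_div_two_mul_I, Complex.inv_I]
    rw [hI, ← Complex.exp_add, ← Complex.exp_add, ← Complex.exp_add]
    congr 1
    field_simp
    ring
  rw [h5]
  field_simp

/-! ### The pentagonal number theorem over `ℂ` -/

/-- From 1 + t ≤ e^t and the geometric series. The bound does not depend on k or n, which gives the
convergence required by the pentagonal number theorem. -/
lemma norm_prod_one_sub_pow_le {x : ℂ} (hx : ‖x‖ < 1) (k n : ℕ) :
    ‖∏ i ∈ Finset.range n, (1 - x ^ (k + i + 1))‖ ≤ Real.exp (1 - ‖x‖)⁻¹ := by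
  rw [norm_prod]
  have hs := summable_geometric_of_lt_one (norm_nonneg x) hx
  calc ∏ i ∈ Finset.range n, ‖1 - x ^ (k + i + 1)‖
      ≤ ∏ i ∈ Finset.range n, Real.exp (‖x‖ ^ i) := by
        refine Finset.prod_le_prod (fun _ _ => norm_nonneg _) fun i _ => ?_
        refine (norm_sub_le _ _).trans ?_
        rw [norm_one, norm_pow, add_comm]
        refine le_trans ?_ (Real.add_one_le_exp _)
        gcongr ?_ + 1
        exact pow_le_pow_of_le_one (norm_nonneg _) hx.le (by omega)
    _ = Real.exp (∑ i ∈ Finset.range n, ‖x‖ ^ i) := (Real.exp_sum _ _).symm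
    _ ≤ _ := by
        rw [Real.exp_le_exp, ← tsum_geometric_of_lt_one (norm_nonneg x) hx]
        exact hs.sum_le_tsum _ fun i _ => by positivity

lemma le_pentagonal_neg (k : ℕ) : k ≤ pentagonal (-k) := by
  have := two_mul_natCast_pentagonal_neg k
  zify
  nlinarith

lemma le_pentagonal_add_one (k : ℕ) : k ≤ pentagonal (k + 1) := by
  have := two_mul_natCast_pentagonal (k + 1)
  zify
  nlinarith

lemma summable_of_norm_le_pow {x : ℂ} (hx : ‖x‖ < 1) {u : ℕ → ℂ} (C : ℝ)
    (hu : ∀ n, ‖u n‖ ≤ C * ‖x‖ ^ n) : Summable u :=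
  Summable.of_norm_bounded ((summable_geometric_of_lt_one (norm_nonneg x) hx).mul_left C) hu

lemma norm_neg_one_pow_mul_le {x : ℂ} (hx : ‖x‖ < 1) {n m k : ℕ} (h : n ≤ m) :
    ‖(-1) ^ k * x ^ m‖ ≤ 1 * ‖x‖ ^ n := by
  rw [norm_mul, norm_pow, norm_neg, norm_one, one_pow, one_mul, one_mul, norm_pow]
  exact pow_le_pow_of_le_one (norm_nonneg _) hx.le h

lemma hasSum_pentagonal {x : ℂ} (hx : ‖x‖ < 1) :
    HasSum (fun j : ℤ => (-1) ^ j.natAbs * x ^ pentagonal (-j)) (∏' n : ℕ, (1 - x ^ (n + 1))) := by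
  have hsum1 : Summable fun k : ℕ => (-1) ^ k * x ^ pentagonal (-k) :=
    summable_of_norm_le_pow hx 1 fun n => norm_neg_one_pow_mul_le hx (le_pentagonal_neg n)
  have hsum2 : Summable fun k : ℕ => (-1) ^ (k + 1) * x ^ pentagonal (k + 1) :=
    summable_of_norm_le_pow hx 1 fun n => norm_neg_one_pow_mul_le hx (le_pentagonal_add_one n)
  have hterm : ∀ k n : ℕ, ‖x ^ ((k + 1) * n) * ∏ i ∈ Finset.range (n + 1),
      (1 - x ^ (k + i + 1))‖ ≤ Real.exp (1 - ‖x‖)⁻¹ * ‖x‖ ^ n := by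
    intro k n
    rw [norm_mul, mul_comm]
    gcongr
    · exact norm_prod_one_sub_pow_le hx _ _
    · rw [norm_pow]
      exact pow_le_pow_of_le_one (norm_nonneg _) hx.le (Nat.le_mul_of_pos_left _ (by omega))
  have key := Pentagonal.tprod_one_sub_pow (x := x)
    (tendsto_pow_atTop_nhds_zero_of_norm_lt_one hx)
    (fun k => summable_of_norm_le_pow hx _ (hterm k))
    (fun k => by
      have h1 : Summable fun n : ℕ => ‖-x ^ (n + k + 1)‖ := by
        simp only [norm_neg, norm_pow, add_assoc]
        exact (summable_nat_add_iff (k + 1)).mpr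
          (summable_geometric_of_lt_one (norm_nonneg x) hx)
      simpa [sub_eq_add_neg] using multipliable_one_add_of_summable h1)
    ((hsum1.add hsum2).congr fun k => by ring) ?_
  · rw [key]
    have h := HasSum.of_nat_of_neg_add_one
      (f := fun j : ℤ => (-1) ^ j.natAbs * x ^ pentagonal (-j))
      (m := ∑' k : ℕ, (-1) ^ k * x ^ pentagonal (-k))
      (m' := ∑' k : ℕ, (-1) ^ (k + 1) * x ^ pentagonal (k + 1)) ?_ ?_
    · rw [← hsum1.tsum_add hsum2] at h
      convert h using 1
      refine tsum_congr fun k => ?_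
      ring
    · simpa using hsum1.hasSum
    · refine hsum2.hasSum.congr_fun fun k => ?_
      rw [neg_neg, Int.natAbs_neg]
      rfl
  -- The remainder after k steps carries a power of x of exponent at least k, times a tail bounded
  -- uniformly in k.
  · have hlim : Filter.Tendsto (fun k : ℕ => ‖x‖ ^ k * (Real.exp (1 - ‖x‖)⁻¹ * (1 - ‖x‖)⁻¹))
        Filter.atTop (𝓝 0) := by
      simpa using (tendsto_pow_atTop_nhds_zero_of_lt_one (norm_nonneg x) hx).mul_const
        (Real.exp (1 - ‖x‖)⁻¹ * (1 - ‖x‖)⁻¹)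
    refine squeeze_zero_norm (fun k => ?_) hlim
    rw [norm_mul]
    have hk : k ≤ (k + 1) * (3 * k + 4) / 2 := by
      rw [Nat.le_div_iff_mul_le two_pos]
      nlinarith
    have h1 := norm_neg_one_pow_mul_le hx (k := k + 1) hk
    rw [one_mul] at h1
    gcongr
    exact tsum_of_norm_bounded ((hasSum_geometric_of_lt_one (norm_nonneg x) hx).mul_left _)
      (hterm k)

/-- Euler's function `∏ (1 - q ^ n)`. -/
noncomputable def eulerFun (τ : ℍ) : ℂ := ∏' n : ℕ, (1 - ModularForm.eta_q n τ)

lemma eta_eq (τ : ℍ) : ModularForm.eta τ = cexp (2 * π * I * (τ / 24)) * eulerFun τ := by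
  rw [ModularForm.eta, eulerFun, Function.Periodic.qParam]
  congr 2
  push_cast
  ring

lemma eulerFun_ne_zero (τ : ℍ) : eulerFun τ ≠ 0 := ModularForm.eta_tprod_ne_zero τ.2

lemma eta_ne_zero' (τ : ℍ) : ModularForm.eta (τ : ℂ) ≠ 0 := ModularForm.eta_ne_zero τ.2

lemma hasSum_eulerFun (τ : ℍ) :
    HasSum (fun j : ℤ => (-1) ^ j.natAbs * cexp (2 * π * I * (pentagonal (-j) * τ)))
      (eulerFun τ) := by
  have h := hasSum_pentagonal (norm_exp_two_pi_I_lt_one τ)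
  have e : ∏' n : ℕ, (1 - cexp (2 * π * I * τ) ^ (n + 1)) = eulerFun τ := by
    rw [eulerFun]
    exact tprod_congr fun n => by rw [ModularForm.eta_q_eq_pow]
  rw [e] at h
  refine h.congr_fun fun j => ?_
  rw [← Complex.exp_nat_mul]
  congr 2
  ring

/-! ### The quintuple product identity in the form `ϑ (2z) / ϑ (z) = η⁻¹ ∑ (12 / n) …` -/

/-- The coefficient of `y ^ 0` in the product of the two theta series. -/
lemma tsum_thetaRed_mul (τ : ℍ) :
    ∑' k : ℤ, ((chi12 (2 * k + 1) : ℂ) *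
      cexp (π * I * (2 * k + 1) ^ 2 / (4 * (3 : ℕ)) * τ - π * I / (4 * (3 : ℕ)) * τ)) *
      ((chi4 (2 * (0 - k) + 1) : ℂ) * cexp (π * I * (2 * ((0 - k : ℤ) : ℂ) + 1) ^ 2 /
        (4 * (1 : ℕ)) * τ - π * I / (4 * (1 : ℕ)) * τ)) = eulerFun τ := by
  -- The exponent of q at k is k(2k - 1)/3, and χ₁₂(2k+1) vanishes for k ≡ 1 mod 3. The classes k ≡
  -- 0 and k ≡ 2 correspond to the even and the odd indices of pentagonal numbers.
  let i : ℤ → ℤ := fun j => if j % 2 = 0 then -3 * (j / 2) else 3 * (j / 2) + 2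
  have hi : Function.Injective i := by
    intro a b hab
    simp only [i] at hab
    split_ifs at hab <;> omega
  refine ((hi.hasSum_iff fun k hk => ?_).mp ((hasSum_eulerFun τ).congr_fun fun j => ?_)).tsum_eq
  · have h1 : k % 3 = 1 := by
      by_contra h
      refine hk ?_
      by_cases h0 : k % 3 = 0
      · exact ⟨-2 * (k / 3), by simp only [i]; split_ifs <;> omega⟩
      · exact ⟨2 * (k / 3) + 1, by simp only [i]; split_ifs <;> omega⟩
    have h2 : chi12 (2 * k + 1) = 0 := by
      rw [chi12]
      split_ifs <;> omega
    simp [h2]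
  · simp only [Function.comp, i]
    have hp := two_mul_natCast_pentagonal_neg j
    rw [mul_mul_mul_comm, ← Complex.exp_add]
    congr 1
    · split_ifs with hj
      · obtain ⟨b, rfl⟩ : ∃ b, j = 2 * b := ⟨j / 2, by omega⟩
        have e1 : (-1 : ℂ) ^ (2 * b).natAbs = 1 := by
          rw [Int.natAbs_mul]; simp [pow_mul]
        rw [e1, Int.mul_ediv_cancel_left _ two_ne_zero]
        norm_cast
        rw [chi12, chi4_eq]
        split_ifs <;> omega
      · obtain ⟨b, rfl⟩ : ∃ b, j = 2 * b + 1 := ⟨j / 2, by omega⟩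
        have e1 : (-1 : ℂ) ^ (2 * b + 1).natAbs = -1 :=
          Odd.neg_one_pow (Int.natAbs_odd.mpr ⟨b, rfl⟩)
        rw [e1, show (2 * b + 1) / 2 = b by omega]
        norm_cast
        rw [chi12, chi4_eq]
        split_ifs <;> omega
    · congr 1
      split_ifs with hj
      · obtain ⟨b, rfl⟩ : ∃ b, j = 2 * b := ⟨j / 2, by omega⟩
        rw [Int.mul_ediv_cancel_left _ two_ne_zero]
        have hp' : (2 * (pentagonal (-(2 * b)) : ℂ)) = (2 * b) * (3 * (2 * b) + 1) := by
          exact_mod_cast hp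
        push_cast
        linear_combination -(π * I * τ) * hp'
      · obtain ⟨b, rfl⟩ : ∃ b, j = 2 * b + 1 := ⟨j / 2, by omega⟩
        rw [show (2 * b + 1) / 2 = b by omega]
        have hp' : (2 * (pentagonal (-(2 * b + 1)) : ℂ)) =
          (2 * b + 1) * (3 * (2 * b + 1) + 1) := by exact_mod_cast hp
        push_cast
        linear_combination -(π * I * τ) * hp'

/-- A sequence satisfying the recursion of index `m` which vanishes for `-m < l ≤ m` vanishes. -/
lemma eq_zero_of_recursion {c : ℤ → ℂ} {m : ℕ} (hm : 0 < m) {E : ℤ → ℂ} (hE : ∀ l, E l ≠ 0)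
    (hc : ∀ l, c (l + 2 * m) = E l * c l) (h0 : ∀ l : ℤ, -m < l → l ≤ m → c l = 0) : c = 0 := by
  have key : ∀ a r : ℤ, -m < r → r ≤ m → c (r + a * (2 * m)) = 0 := by
    intro a
    induction a using Int.induction_on with
    | zero => intro r h1 h2; simpa using h0 r h1 h2
    | succ a ih =>
      intro r h1 h2
      rw [add_mul, one_mul, ← add_assoc, hc, ih r h1 h2, mul_zero]
    | pred a ih =>
      intro r h1 h2
      have h3 := hc (r + (-a - 1) * (2 * m))
      rw [add_assoc, sub_mul, one_mul, sub_add_cancel, ih r h1 h2] at h3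
      rw [sub_mul, one_mul]
      exact (mul_eq_zero.mp h3.symm).resolve_left (hE _)
  funext l
  have hm2 : (0 : ℤ) < 2 * m := by omega
  have h1 := Int.emod_add_mul_ediv (l + m - 1) (2 * m)
  have h2 := Int.emod_nonneg (l + m - 1) hm2.ne'
  have h3 := Int.emod_lt_of_pos (l + m - 1) hm2
  -- The residue (l + m - 1) mod 2m, shifted by 1 - m, is the representative of l modulo 2m in (-m,
  -- m].
  have h4 := key ((l + m - 1) / (2 * m)) ((l + m - 1) % (2 * m) + 1 - m) (by omega) (by omega)
  have h5 : (l + m - 1) % (2 * m) + 1 - m + (l + m - 1) / (2 * m) * (2 * m) = l := by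
    linarith
  rwa [h5] at h4

/-- An odd theta function of index `2` is determined by its coefficient at `y`. -/
lemma eq_of_odd_index_two {g : ℂ → ℂ} {c : ℤ → ℂ} {τ : ℂ} (hg : HasLaurent g c)
    (hE : ∀ z, g (z + τ) = cexp (-(2 * π * I * (2 : ℕ) * (τ + 2 * z))) * g z)
    (hodd : ∀ z, g (-z) = -g z) (h1 : c 1 = 0) : g = 0 := by
  have hrec := hg.recursion hE
  have hneg : ∀ l, c (-l) = -c l := by
    have h2 : (fun z => g (-z)) = fun z => (-1) * g z := funext fun z => by rw [hodd]; ring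
    have h3 := hg.comp_neg
    rw [h2] at h3
    intro l
    have := congrFun (h3.unique (hg.const_mul (-1))) l
    simpa using this
  have hc : c = 0 := by
    refine eq_zero_of_recursion (m := 2) two_pos (fun l => Complex.exp_ne_zero _) hrec
      fun l h2 h3 => ?_
    have hl : l = -1 ∨ l = 0 ∨ l = 1 ∨ l = 2 := by push_cast at h2 h3; omega
    rcases hl with rfl | rfl | rfl | rfl
    · rw [hneg, h1, neg_zero]
    · have := hneg 0
      rw [neg_zero] at this
      exact self_eq_neg.mp this
    · exact h1
    -- At l = -2 the recursion has factor 1 and gives c 2 = c (-2), while oddness gives c (-2) = -c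
    -- 2.
    · have h4 := hrec (-2)
      have h5 := hneg 2
      norm_num at h4
      rw [h5] at h4
      exact self_eq_neg.mp h4
  subst hc
  funext z
  exact (hg z).unique (by simp)

lemma theta_add_tau (τ : ℍ) (z : ℂ) :
    theta τ (z + τ) = -cexp (-(π * I * (τ + 2 * z))) * theta τ z := by
  rw [theta_eq, theta_eq, isThetaChar_chi4.add_tau]
  push_cast
  rw [mul_one]

/-- `∑ (12 / n) q ^ (n² / 24) y ^ (n / 2)`. -/
noncomputable def theta12 (τ : ℍ) (z : ℂ) : ℂ := thetaSeries chi12 3 τ z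

lemma theta12_add_tau (τ : ℍ) (z : ℂ) :
    theta12 τ (z + τ) = -cexp (-(3 * π * I * (τ + 2 * z))) * theta12 τ z := by
  rw [theta12, isThetaChar_chi12.add_tau]
  push_cast
  rw [mul_comm (π * I : ℂ) 3, ← mul_assoc 3, theta12]

lemma theta12_neg (τ : ℍ) (z : ℂ) : theta12 τ (-z) = theta12 τ z := by
  rw [theta12, isThetaChar_chi12.neg chi12_neg]
  simp [theta12]

lemma HasLaurent.comp_two_mul {g : ℂ → ℂ} {c : ℤ → ℂ} (hg : HasLaurent g c) :
    HasLaurent (fun z => g (2 * z)) (fun l => if l % 2 = 0 then c (l / 2) else 0) := fun z => by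
  have hinj : Function.Injective (fun l : ℤ => 2 * l) := fun a b h => by simpa using h
  refine (hinj.hasSum_iff fun l hl => ?_).mp ((hg (2 * z)).congr_fun fun l => ?_)
  · have h : ¬ l % 2 = 0 := fun h => hl ⟨l / 2, by simp only; omega⟩
    simp [h]
  · simp only [Function.comp, Int.mul_emod_right, if_true]
    rw [Int.mul_ediv_cancel_left _ two_ne_zero]
    push_cast
    ring_nf

/-- Equivalent to the quintuple product identity. The difference of the two sides is an odd theta
function of index 2, a type determined by its coefficient at y; that coefficient vanishes by
`tsum_thetaRed_mul`, which is Euler's pentagonal number theorem. -/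
lemma theta12_mul_theta (τ : ℍ) (z : ℂ) :
    theta12 τ z * theta τ z = ModularForm.eta τ * theta τ (2 * z) := by
  have h1 := ((isThetaChar_chi12.hasLaurent τ).mul (isThetaChar_chi4.hasLaurent τ)).exp_mul 1
  have h2 := ((isThetaChar_chi4.hasLaurent τ).comp_two_mul.exp_mul 1).const_mul (eulerFun τ)
  have h3 := (h1.add (h2.const_mul (-1))).const_mul (cexp (2 * π * I * (τ / 6)))
  have e : ∀ z, theta12 τ z * theta τ z - ModularForm.eta τ * theta τ (2 * z) =
      cexp (2 * π * I * (τ / 6)) * (((fun z => cexp (2 * π * I * ((1 : ℤ) * z)) *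
        (thetaRed chi12 3 τ * thetaRed chi4 1 τ) z) +
      fun z => -1 * (eulerFun τ * (cexp (2 * π * I * ((1 : ℤ) * z)) *
        thetaRed chi4 1 τ (2 * z)))) z) := by
    intro z
    rw [theta12, theta_eq, theta_eq, thetaSeries_eq chi12, thetaSeries_eq chi4 1 τ z,
      thetaSeries_eq chi4 1 τ (2 * z), eta_eq]
    simp only [Pi.add_apply, Pi.mul_apply]
    have e1 : cexp (π * I / (4 * (3 : ℕ)) * τ + π * I * z) *
        cexp (π * I / (4 * (1 : ℕ)) * τ + π * I * z) =
        cexp (2 * π * I * (τ / 6)) * cexp (2 * π * I * ((1 : ℤ) * z)) := by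
      rw [← Complex.exp_add, ← Complex.exp_add]
      congr 1
      push_cast
      ring
    have e2 : cexp (2 * π * I * (τ / 24)) * cexp (π * I / (4 * (1 : ℕ)) * τ + π * I * (2 * z)) =
        cexp (2 * π * I * (τ / 6)) * cexp (2 * π * I * ((1 : ℤ) * z)) := by
      rw [← Complex.exp_add, ← Complex.exp_add]
      congr 1
      push_cast
      ring
    linear_combination (thetaRed chi12 3 τ z * thetaRed chi4 1 τ z) * e1 -
      (eulerFun τ * thetaRed chi4 1 τ (2 * z)) * e2
  rw [← funext e] at h3
  have h4 := eq_of_odd_index_two (τ := τ) h3 ?_ ?_ ?_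
  · exact sub_eq_zero.mp (congrFun h4 z)
  · intro z
    rw [theta12_add_tau, theta_add_tau, show 2 * (z + (τ : ℂ)) = 2 * z + τ + τ by ring,
      theta_add_tau, theta_add_tau]
    have e1 : cexp (-(2 * π * I * (2 : ℕ) * (τ + 2 * z))) =
        cexp (-(3 * π * I * (τ + 2 * z))) * cexp (-(π * I * (τ + 2 * z))) := by
      rw [← Complex.exp_add]
      congr 1
      push_cast
      ring
    have e2 : cexp (-(2 * π * I * (2 : ℕ) * (τ + 2 * z))) =
        cexp (-(π * I * (τ + 2 * (2 * z + τ)))) * cexp (-(π * I * (τ + 2 * (2 * z)))) := by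
      rw [← Complex.exp_add]
      congr 1
      push_cast
      ring
    linear_combination -(theta12 τ z * theta τ z) * e1 +
      (ModularForm.eta τ * theta τ (2 * z)) * e2
  · intro z
    rw [theta12_neg, theta_neg, mul_neg 2, theta_neg]
    ring
  · simp only [Pi.add_apply, sub_self]
    rw [tsum_thetaRed_mul]
    simp [chi4_eq]

/-! ### Integral `q`-series -/

/-- `g` has the integral `q`-series `a`. -/
def HasQInt (g : ℍ → ℂ) (a : PowerSeries ℤ) : Prop :=
  HasQ g (PowerSeries.map (Int.castRingHom ℂ) a)

lemma T_coeff {R : Type*} [Semiring R] (k l : ℤ) :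
    (T k : R[T;T⁻¹]).coeff l = if l = k then 1 else 0 := by
  have h := coeff_T_mul (1 : R) k 1 l
  rw [map_one, one_mul, mul_one, one_mul] at h
  rw [h]
  have h1 : ∀ l : ℤ, (1 : R[T;T⁻¹]).coeff l = if l = 0 then 1 else 0 := by
    intro l
    rw [AddMonoidAlgebra.one_def, AddMonoidAlgebra.coeff_single, Finsupp.single_apply]
    simp [eq_comm]
  rw [h1]
  simp [sub_eq_zero]

lemma C_coeff {R : Type*} [Semiring R] (a : R) (l : ℤ) :
    (C a : R[T;T⁻¹]).coeff l = if l = 0 then a else 0 := by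
  have h := coeff_T_mul a 0 (T 0) l
  rw [T_zero, mul_one, mul_one] at h
  rw [h, ← T_zero, T_coeff]
  simp

lemma toComplex_map_C (a : PowerSeries ℤ) : toComplex (PowerSeries.map C a) =
    PowerSeries.map C (PowerSeries.map (Int.castRingHom ℂ) a) := by
  refine FormalExp.ext fun n l => ?_
  rw [co_toComplex, FormalExp.co, FormalExp.co, PowerSeries.coeff_map, PowerSeries.coeff_map,
    PowerSeries.coeff_map, C_coeff, C_coeff]
  split_ifs <;> simp

lemma HasQInt.hasExp {g : ℍ → ℂ} {a : PowerSeries ℤ} (h : HasQInt g a) :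
    HasExp (fun τ _ => g τ) (toComplex (PowerSeries.map C a)) := by
  rw [toComplex_map_C]
  exact hasQ_iff_hasExp.mp h

/-! ### The expansion of Euler's function and of its inverse -/

/-- The `q`-series of Euler's function. -/
noncomputable def eulerSeries : PowerSeries ℤ :=
  PowerSeries.mk fun n => (thetaFormal chi12 3 * thetaFormal chi4 1).co n 0

/-- Euler's function is the y^0-coefficient of a product of two theta series with integral
expansions, so its q-series is integral. -/
lemma hasQInt_eulerFun : HasQInt eulerFun eulerSeries := by
  have h := isThetaChar_chi12.hasExp.mul isThetaChar_chi4.hasExp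
  rw [← map_mul] at h
  intro τ
  have h1 := (h.hasLaurent τ).unique
    ((isThetaChar_chi12.hasLaurent τ).mul (isThetaChar_chi4.hasLaurent τ))
  have h2 := congrFun h1 0
  rw [tsum_thetaRed_mul] at h2
  rw [← h2]
  refine (h.summable_fiber τ 0).hasSum.congr_fun fun n => ?_
  rw [co_toComplex, PowerSeries.coeff_map, eulerSeries, PowerSeries.coeff_mk]
  rfl

lemma constantCoeff_thetaFormal_chi4 :
    PowerSeries.constantCoeff (thetaFormal chi4 1) = 1 - T (-1) := by
  refine LaurentPolynomial.ext fun l => ?_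
  rw [← PowerSeries.coeff_zero_eq_constantCoeff_apply, ← FormalExp.co,
    thetaFormal, FormalExp.co_ofCoeff, thetaCoeff, ← T_zero, AddMonoidAlgebra.coeff_sub,
    Finsupp.sub_apply, T_coeff, T_coeff]
  by_cases h0 : l = 0
  · subst h0; simp [chi4_eq]
  by_cases h1 : l = -1
  · subst h1; simp [chi4_eq]
  rw [if_neg h0, if_neg h1, if_neg]
  · simp
  · intro h
    have : l * (l + 1) = 0 := by push_cast at h; linarith
    rcases mul_eq_zero.mp this with h2 | h2 <;> omega

lemma constantCoeff_thetaFormal_chi12 :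
    PowerSeries.constantCoeff (thetaFormal chi12 3) = 1 + T (-1) := by
  refine LaurentPolynomial.ext fun l => ?_
  rw [← PowerSeries.coeff_zero_eq_constantCoeff_apply, ← FormalExp.co,
    thetaFormal, FormalExp.co_ofCoeff, thetaCoeff, ← T_zero, AddMonoidAlgebra.coeff_add,
    Finsupp.add_apply, T_coeff, T_coeff]
  by_cases h0 : l = 0
  · subst h0; simp [chi12]
  by_cases h1 : l = -1
  · subst h1; simp [chi12]
  rw [if_neg h0, if_neg h1, if_neg]
  · simp
  · intro h
    have : l * (l + 1) = 0 := by push_cast at h; linarith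
    rcases mul_eq_zero.mp this with h2 | h2 <;> omega

lemma constantCoeff_eulerSeries : PowerSeries.constantCoeff eulerSeries = 1 := by
  rw [← PowerSeries.coeff_zero_eq_constantCoeff_apply, eulerSeries, PowerSeries.coeff_mk,
    FormalExp.co, PowerSeries.coeff_zero_eq_constantCoeff_apply, map_mul,
    constantCoeff_thetaFormal_chi4, constantCoeff_thetaFormal_chi12]
  have : (1 + T (-1) : ℤ[T;T⁻¹]) * (1 - T (-1)) = T 0 - T (-2) := by
    rw [T_zero, show (-2 : ℤ) = -1 + -1 by norm_num, T_add]
    ring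
  rw [this, AddMonoidAlgebra.coeff_sub, Finsupp.sub_apply, T_coeff, T_coeff]
  simp

/-- The `q`-series of the inverse of Euler's function. -/
noncomputable def eulerInvSeries : PowerSeries ℤ := PowerSeries.invOfUnit eulerSeries 1

lemma eulerSeries_mul_inv : eulerSeries * eulerInvSeries = 1 :=
  PowerSeries.mul_invOfUnit _ _ constantCoeff_eulerSeries

lemma constantCoeff_eulerInvSeries : PowerSeries.constantCoeff eulerInvSeries = 1 := by
  simp [eulerInvSeries]

/-- The product has no zero in the unit disc, so its inverse is holomorphic there and its Taylor
series converges. By uniqueness this series is the formal inverse, which is integral since the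
constant term is 1. -/
lemma hasQInt_eulerFun_inv : HasQInt (fun τ => (eulerFun τ)⁻¹) eulerInvSeries := by
  have hne : ∀ q ∈ Metric.ball (0 : ℂ) 1, ∏' n : ℕ, (1 - q ^ (n + 1)) ≠ 0 := by
    intro q hq
    have hq' : ‖q‖ < 1 := by simpa using hq
    have hs : Summable fun n : ℕ => ‖-q ^ (n + 1)‖ := by
      simp only [norm_neg, norm_pow]
      exact (summable_nat_add_iff 1).mpr (summable_geometric_of_lt_one (norm_nonneg q) hq')
    have h := tprod_one_add_ne_zero_of_summable (f := fun n : ℕ => -q ^ (n + 1)) (fun n => ?_) hs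
    · simpa [sub_eq_add_neg] using h
    · rw [← sub_eq_add_neg, sub_ne_zero]
      intro h1
      have h2 : ‖q ^ (n + 1)‖ < 1 := by
        rw [norm_pow]
        exact pow_lt_one₀ (norm_nonneg q) hq' (by omega)
      rw [← h1, norm_one] at h2
      exact lt_irrefl _ h2
  have hdiff := ModularForm.differentiableOn_tprod_one_sub_pow.inv hne
  have hexp : ∃ b : PowerSeries ℂ, HasQ (fun τ => (eulerFun τ)⁻¹) b := by
    refine ⟨PowerSeries.mk fun n => (n.factorial : ℂ)⁻¹ * iteratedDeriv n
      (fun q => ∏' n : ℕ, (1 - q ^ (n + 1)))⁻¹ 0, fun τ => ?_⟩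
    have h1 := Complex.hasSum_taylorSeries_on_ball hdiff (z := cexp (2 * π * I * τ))
      (by simpa using norm_exp_two_pi_I_lt_one τ)
    have e : eulerFun τ = ∏' n : ℕ, (1 - cexp (2 * π * I * τ) ^ (n + 1)) := by
      rw [eulerFun]
      exact tprod_congr fun n => by rw [ModularForm.eta_q_eq_pow]
    simp only [e]
    refine h1.congr_fun fun n => ?_
    rw [PowerSeries.coeff_mk, sub_zero, smul_eq_mul, smul_eq_mul, qy, ← Complex.exp_nat_mul]
    rw [show (2 * π * I * (n * τ + (0 : ℤ) * 0) : ℂ) = n * (2 * π * I * τ) by push_cast; ring]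
    ring
  obtain ⟨b, hb⟩ := hexp
  have h1 := hasQInt_eulerFun.mul hb
  have h2 : HasQ (fun _ => 1) 1 := by simpa using HasQ.const 1
  have h3 := h1.unique (h2.congr_left ?_)
  · have h4 : b = PowerSeries.map (Int.castRingHom ℂ) eulerInvSeries := by
      have h5 := congrArg (PowerSeries.map (Int.castRingHom ℂ)) eulerSeries_mul_inv
      rw [map_mul, map_one] at h5
      calc b = b * (PowerSeries.map (Int.castRingHom ℂ) eulerSeries *
            PowerSeries.map (Int.castRingHom ℂ) eulerInvSeries) := by rw [h5, mul_one]
        _ = (PowerSeries.map (Int.castRingHom ℂ) eulerSeries * b) *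
            PowerSeries.map (Int.castRingHom ℂ) eulerInvSeries := by ring
        _ = _ := by rw [h3, one_mul]
    rw [HasQInt, ← h4]
    exact hb
  · intro τ
    simp [eulerFun_ne_zero τ]

/-! ### The Eisenstein series of weight `2` -/

/-- The `q`-series of `E2`. -/
def e2Series : PowerSeries ℤ :=
  PowerSeries.mk fun n => if n = 0 then 1 else -24 * (ArithmeticFunction.sigma 1 n : ℤ)

lemma hasQInt_E2 : HasQInt EisensteinSeries.E2 e2Series := by
  intro τ
  refine (EisensteinSeries.hasSum_qExpansion_E2 (z := τ)).congr_fun fun n => ?_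
  rw [← qParam_one_pow, PowerSeries.coeff_map, e2Series, PowerSeries.coeff_mk, smul_eq_mul,
    Function.Periodic.qParam]
  split_ifs <;> simp

lemma E2_S (τ : ℍ) : EisensteinSeries.E2 (ModularGroup.S • τ) =
    (τ : ℂ) ^ 2 * EisensteinSeries.E2 τ + 12 * τ / (2 * π * I) := by
  have h := congrFun (EisensteinSeries.E2_slash_action ModularGroup.S) τ
  rw [ModularForm.SL_slash_apply, Pi.sub_apply, Pi.smul_apply, EisensteinSeries.D2,
    riemannZeta_two, ModularGroup.denom_S, smul_eq_mul] at h
  have hτ : (τ : ℂ) ≠ 0 := τ.ne_zero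
  have hS : ((ModularGroup.S 1 0 : ℤ) : ℂ) = 1 := by simp [ModularGroup.S]
  rw [hS] at h
  have hpi : (π : ℂ) ≠ 0 := by exact_mod_cast Real.pi_ne_zero
  have h2 : EisensteinSeries.E2 (ModularGroup.S • τ) = (τ : ℂ) ^ 2 *
      (EisensteinSeries.E2 (ModularGroup.S • τ) * (τ : ℂ) ^ (-2 : ℤ)) := by
    rw [zpow_neg, mul_left_comm]
    norm_cast
    rw [mul_inv_cancel₀ (pow_ne_zero _ hτ), mul_one]
  rw [h2, h]
  field_simp
  linear_combination (-12) * I_sq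

/-! ### The derivation `y ∂/∂y` on formal expansions -/

/-- `y ∂/∂y` on formal expansions. -/
noncomputable def FormalExp.dy {R : Type*} [Ring R] (F : FormalExp R) : FormalExp R :=
  FormalExp.ofCoeff (fun n l => (l : R) * F.co n l) fun n =>
    ((PowerSeries.coeff n F).coeff.hasFiniteSupport).subset
      (Function.support_mul_subset_right _ _)

lemma FormalExp.co_dy {R : Type*} [Ring R] (F : FormalExp R) (n : ℕ) (l : ℤ) :
    F.dy.co n l = l * F.co n l := FormalExp.co_ofCoeff _ _ _ _

lemma toComplex_dy (F : FormalExp ℤ) : toComplex F.dy = (toComplex F).dy :=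
  FormalExp.ext fun n l => by simp [FormalExp.co_dy]

lemma HasExp.dz {φ : ℍ → ℂ → ℂ} {F : FormalExp ℂ} (h : HasExp φ F) : HasExp (dz φ) F.dy := by
  intro τ z
  simp only [FormalExp.co_dy]
  exact HasFourierExpansion.dz h τ z

lemma HasExp.differentiable {φ : ℍ → ℂ → ℂ} {F : FormalExp ℂ} (h : HasExp φ F) (τ : ℍ) :
    Differentiable ℂ (φ τ) := HasFourierExpansion.differentiable h τ

/-! ### Transformation of derivatives -/

lemma two_pi_I_ne_zero' : (2 * π * I : ℂ) ≠ 0 := Complex.two_pi_I_ne_zero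

lemma hasDerivAt_dz {φ : ℍ → ℂ → ℂ} {τ : ℍ} (h : Differentiable ℂ (φ τ)) (z : ℂ) :
    HasDerivAt (φ τ) (2 * π * I * dz φ τ z) z := by
  rw [dz, mul_inv_cancel_left₀ two_pi_I_ne_zero']
  exact (h z).hasDerivAt

lemma dz_eq {φ : ℍ → ℂ → ℂ} {τ : ℍ} {z g : ℂ} (h : HasDerivAt (φ τ) (2 * π * I * g) z) :
    dz φ τ z = g := by
  rw [dz, h.deriv, inv_mul_cancel_left₀ two_pi_I_ne_zero']

lemma hasDerivAt_gaussian (μ : ℂ) (τ : ℍ) (z : ℂ) :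
    HasDerivAt (fun z => cexp (2 * π * I * μ * z ^ 2 / τ))
      (2 * π * I * (2 * μ * z / τ * cexp (2 * π * I * μ * z ^ 2 / τ))) z := by
  have h : HasDerivAt (fun z : ℂ => 2 * π * I * μ * z ^ 2 / τ) (2 * π * I * μ * (2 * z) / τ) z := by
    simpa using ((hasDerivAt_pow 2 z).const_mul (2 * π * I * μ)).div_const (τ : ℂ)
  refine h.cexp.congr_deriv ?_
  ring

lemma dz_comp_S {φ : ℍ → ℂ → ℂ} {τ : ℍ} (hd : ∀ τ, Differentiable ℂ (φ τ)) {G : ℂ → ℂ} {g z : ℂ}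
    (h : ∀ z, φ (ModularGroup.S • τ) (z / τ) = G z) (hG : HasDerivAt G (2 * π * I * g) z) :
    dz φ (ModularGroup.S • τ) (z / τ) = τ * g := by
  have hτ : (τ : ℂ) ≠ 0 := τ.ne_zero
  have h1 := (hasDerivAt_dz (hd (ModularGroup.S • τ)) (z / τ)).comp z
    ((hasDerivAt_id z).div_const (τ : ℂ))
  have h2 : (φ (ModularGroup.S • τ)) ∘ (fun z => id z / (τ : ℂ)) = G := funext h
  rw [h2] at h1
  have h3 := h1.unique hG
  have h4 := two_pi_I_ne_zero'
  rw [mul_assoc] at h3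
  have h5 := mul_left_cancel₀ h4 h3
  rw [← h5]
  field_simp

/-- The derivative of a function transforming like a Jacobi form of index `μ` under `S`. -/
lemma dz_S {φ : ℍ → ℂ → ℂ} (hd : ∀ τ, Differentiable ℂ (φ τ)) {j μ : ℂ} {τ : ℍ}
    (h : ∀ z, φ (ModularGroup.S • τ) (z / τ) = j * cexp (2 * π * I * μ * z ^ 2 / τ) * φ τ z)
    (z : ℂ) : dz φ (ModularGroup.S • τ) (z / τ) =
      j * cexp (2 * π * I * μ * z ^ 2 / τ) * (τ * dz φ τ z + 2 * μ * z * φ τ z) := by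
  have hτ : (τ : ℂ) ≠ 0 := τ.ne_zero
  have h1 := ((hasDerivAt_gaussian μ τ z).const_mul j).mul (hasDerivAt_dz (hd τ) z)
  rw [dz_comp_S (g := j * cexp (2 * π * I * μ * z ^ 2 / τ) *
    (dz φ τ z + 2 * μ * z / τ * φ τ z)) hd h]
  · field_simp
  · refine h1.congr_deriv ?_
    ring

lemma dz_dz_S {φ : ℍ → ℂ → ℂ} (hd : ∀ τ, Differentiable ℂ (φ τ))
    (hd' : ∀ τ, Differentiable ℂ (dz φ τ)) {j μ : ℂ} {τ : ℍ}
    (h : ∀ z, φ (ModularGroup.S • τ) (z / τ) = j * cexp (2 * π * I * μ * z ^ 2 / τ) * φ τ z)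
    (z : ℂ) : dz (dz φ) (ModularGroup.S • τ) (z / τ) =
      j * cexp (2 * π * I * μ * z ^ 2 / τ) * (τ ^ 2 * dz (dz φ) τ z + 4 * μ * z * τ * dz φ τ z +
        (4 * μ ^ 2 * z ^ 2 + 2 * μ * τ / (2 * π * I)) * φ τ z) := by
  have hτ : (τ : ℂ) ≠ 0 := τ.ne_zero
  have hpi := two_pi_I_ne_zero'
  have h1 := ((hasDerivAt_gaussian μ τ z).const_mul j).mul
    (((hasDerivAt_dz (hd' τ) z).const_mul (τ : ℂ)).add
      (((hasDerivAt_id z).const_mul (2 * μ)).mul (hasDerivAt_dz (hd τ) z)))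
  rw [dz_comp_S (g := j * cexp (2 * π * I * μ * z ^ 2 / τ) *
    (τ * dz (dz φ) τ z + 2 * μ * z * dz φ τ z + 2 * μ / (2 * π * I) * φ τ z +
      2 * μ * z / τ * (τ * dz φ τ z + 2 * μ * z * φ τ z))) hd' (dz_S hd h)]
  · field_simp
    ring
  · refine h1.congr_deriv ?_
    simp only [id, Pi.add_apply, Pi.mul_apply]
    field_simp
    ring

/-- The Wronskian-type bracket `(D φ)² - φ D² φ`. -/
noncomputable def hirota (φ : ℍ → ℂ → ℂ) (τ : ℍ) (z : ℂ) : ℂ :=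
  dz φ τ z ^ 2 - φ τ z * dz (dz φ) τ z

/-- Formally the bracket is -φ² D² log φ. The Gaussian factor contributes a quadratic polynomial to
log φ, so only a multiple of φ² spoils the law. -/
lemma hirota_S {φ : ℍ → ℂ → ℂ} (hd : ∀ τ, Differentiable ℂ (φ τ))
    (hd' : ∀ τ, Differentiable ℂ (dz φ τ)) {j μ : ℂ} {τ : ℍ}
    (h : ∀ z, φ (ModularGroup.S • τ) (z / τ) = j * cexp (2 * π * I * μ * z ^ 2 / τ) * φ τ z)
    (z : ℂ) : hirota φ (ModularGroup.S • τ) (z / τ) =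
      (j * cexp (2 * π * I * μ * z ^ 2 / τ)) ^ 2 *
        (τ ^ 2 * hirota φ τ z - 2 * μ * τ / (2 * π * I) * φ τ z ^ 2) := by
  rw [hirota, hirota, dz_S hd h, dz_dz_S hd hd' h, h]
  ring

/-- Derivatives of a function which is quasi-periodic under `z ↦ z + τ`. -/
lemma dz_comp_add {φ : ℍ → ℂ → ℂ} {τ : ℍ} (hd : Differentiable ℂ (φ τ)) {j μ w : ℂ}
    (h : ∀ z, φ τ (z + w) = j * cexp (2 * π * I * (μ * z)) * φ τ z) (z : ℂ) :
    dz φ τ (z + w) = j * cexp (2 * π * I * (μ * z)) * (dz φ τ z + μ * φ τ z) := by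
  have h1 := (hasDerivAt_dz hd (z + w)).comp_add_const z w
  rw [funext h] at h1
  have h2 : HasDerivAt (fun z : ℂ => cexp (2 * π * I * (μ * z)))
      (cexp (2 * π * I * (μ * z)) * (2 * π * I * (μ * 1))) z :=
    (((hasDerivAt_id z).const_mul μ).const_mul (2 * π * I)).cexp
  have h3 := (h2.const_mul j).mul (hasDerivAt_dz hd z)
  refine mul_left_cancel₀ two_pi_I_ne_zero' ((h1.unique h3).trans ?_)
  ring

/-- The factor of quasi-periodicity has a logarithm linear in z, which D² log kills; no error term
remains. -/
lemma hirota_comp_add {φ : ℍ → ℂ → ℂ} {τ : ℍ} (hd : Differentiable ℂ (φ τ))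
    (hd' : Differentiable ℂ (dz φ τ)) {j μ w : ℂ}
    (h : ∀ z, φ τ (z + w) = j * cexp (2 * π * I * (μ * z)) * φ τ z) (z : ℂ) :
    hirota φ τ (z + w) = (j * cexp (2 * π * I * (μ * z))) ^ 2 * hirota φ τ z := by
  have h1 := dz_comp_add hd h
  have h2 : dz (dz φ) τ (z + w) = j * cexp (2 * π * I * (μ * z)) *
      (dz (dz φ) τ z + 2 * μ * dz φ τ z + μ ^ 2 * φ τ z) := by
    have h1' := (hasDerivAt_dz hd' (z + w)).comp_add_const z w
    rw [funext h1] at h1'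
    have h2 : HasDerivAt (fun z : ℂ => cexp (2 * π * I * (μ * z)))
        (cexp (2 * π * I * (μ * z)) * (2 * π * I * (μ * 1))) z :=
      (((hasDerivAt_id z).const_mul μ).const_mul (2 * π * I)).cexp
    have h3 := (h2.const_mul j).mul ((hasDerivAt_dz hd' z).add ((hasDerivAt_dz hd z).const_mul μ))
    refine mul_left_cancel₀ two_pi_I_ne_zero' ((h1'.unique h3).trans ?_)
    simp only [Pi.add_apply]
    ring
  rw [hirota, hirota, h1, h2, h]
  ring

/-! ### The forms `φ_{-2,1}` and `φ_{0,1}` -/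

lemma differentiable_thetaSeries {χ : ℤ → ℤ} {M : ℕ} (h : IsThetaChar χ M) (τ : ℍ) :
    Differentiable ℂ (thetaSeries χ M τ) := by
  have h1 := h.hasExp.differentiable τ
  have : thetaSeries χ M τ = fun z => cexp (π * I / (4 * M) * τ + π * I * z) * thetaRed χ M τ z :=
    funext fun z => thetaSeries_eq χ M τ z
  rw [this]
  fun_prop

/-- The formal expansion of `y^(1/2) D (y^(-1/2) ·)`, as used for theta series. -/
lemma dz_half_shift {φ ψ : ℍ → ℂ → ℂ} {τ : ℍ} {a : ℂ} (hd : Differentiable ℂ (ψ τ))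
    (h : ∀ z, φ τ z = cexp (a + π * I * z) * ψ τ z) (z : ℂ) :
    dz φ τ z = cexp (a + π * I * z) * (dz ψ τ z + ψ τ z / 2) := by
  have h1 : HasDerivAt (fun z : ℂ => cexp (a + π * I * z))
      (cexp (a + π * I * z) * (π * I * 1)) z :=
    (((hasDerivAt_id z).const_mul (π * I)).const_add a).cexp
  refine dz_eq ?_
  rw [show φ τ = fun z => cexp (a + π * I * z) * ψ τ z from funext h]
  refine (h1.mul (hasDerivAt_dz hd z)).congr_deriv ?_
  ring

lemma dz_thetaSeries {χ : ℤ → ℤ} {M : ℕ} (h : IsThetaChar χ M) (τ : ℍ) (z : ℂ) :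
    dz (thetaSeries χ M) τ z = cexp (π * I / (4 * M) * τ + π * I * z) *
      (dz (thetaRed χ M) τ z + thetaRed χ M τ z / 2) :=
  dz_half_shift (h.hasExp.differentiable τ) (fun z => thetaSeries_eq χ M τ z) z

lemma differentiable_dz_thetaSeries {χ : ℤ → ℤ} {M : ℕ} (h : IsThetaChar χ M) (τ : ℍ) :
    Differentiable ℂ (dz (thetaSeries χ M) τ) := by
  rw [show dz (thetaSeries χ M) τ = _ from funext (dz_thetaSeries h τ)]
  have h1 := h.hasExp.differentiable τ
  have h2 := h.hasExp.dz.differentiable τ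
  fun_prop

lemma hirota_thetaSeries {χ : ℤ → ℤ} {M : ℕ} (h : IsThetaChar χ M) (τ : ℍ) (z : ℂ) :
    hirota (thetaSeries χ M) τ z = cexp (π * I / (4 * M) * τ + π * I * z) ^ 2 *
      hirota (thetaRed χ M) τ z := by
  have h1 := h.hasExp.differentiable τ
  have h2 := h.hasExp.dz.differentiable τ
  have h4 := dz_half_shift (φ := dz (thetaSeries χ M))
    (ψ := fun τ z => dz (thetaRed χ M) τ z + thetaRed χ M τ z / 2) (τ := τ)
    (h2.add (h1.div_const 2)) (dz_thetaSeries h τ) z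
  have h5 : dz (fun τ z => dz (thetaRed χ M) τ z + thetaRed χ M τ z / 2) τ z =
      dz (dz (thetaRed χ M)) τ z + dz (thetaRed χ M) τ z / 2 := by
    refine dz_eq (((hasDerivAt_dz h2 z).add ((hasDerivAt_dz h1 z).div_const 2)).congr_deriv ?_)
    ring
  rw [hirota, hirota, h4, h5, dz_thetaSeries h, thetaSeries_eq]
  ring

lemma theta_fun_eq : theta = thetaSeries chi4 1 := funext fun τ => funext fun z => theta_eq τ z

lemma differentiable_theta (τ : ℍ) : Differentiable ℂ (theta τ) := by
  rw [theta_fun_eq]; exact differentiable_thetaSeries isThetaChar_chi4 τ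

lemma differentiable_dz_theta (τ : ℍ) : Differentiable ℂ (dz theta τ) := by
  rw [theta_fun_eq]; exact differentiable_dz_thetaSeries isThetaChar_chi4 τ

lemma theta_S' (τ : ℍ) (z : ℂ) : theta (ModularGroup.S • τ) (z / τ) =
    (-I * sqrtNegI τ) * cexp (2 * π * I * (1 / 2) * z ^ 2 / τ) * theta τ z := by
  rw [theta_S]
  ring_nf

lemma theta_add_tau' (τ : ℍ) (z : ℂ) : theta τ (z + τ) =
    -cexp (-(π * I * τ)) * cexp (2 * π * I * (-1 * z)) * theta τ z := by
  rw [theta_add_tau, neg_mul, neg_mul, neg_mul, neg_mul, ← Complex.exp_add]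
  ring_nf

/-- `φ_{-2,1} = ϑ² / η⁶`. -/
noncomputable def phiNeg (τ : ℍ) (z : ℂ) : ℂ := theta τ z ^ 2 * (ModularForm.eta τ)⁻¹ ^ 6

/-- `φ_{0,1}`. -/
noncomputable def phi01 (τ : ℍ) (z : ℂ) : ℂ :=
  12 * (hirota theta τ z * (ModularForm.eta τ)⁻¹ ^ 6) + EisensteinSeries.E2 τ * phiNeg τ z

/-- The `q`-series of the inverse of Euler's function, as a formal expansion. -/
noncomputable def eulerInvFormal : FormalExp ℤ := PowerSeries.map C eulerInvSeries

/-- The formal expansion of `φ_{-2,1}`. -/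
noncomputable def phiNegFormal : FormalExp ℤ :=
  PowerSeries.C (T 1) * (thetaFormal chi4 1 ^ 2 * eulerInvFormal ^ 6)

/-- The formal expansion of `φ_{0,1}`. -/
noncomputable def phi01Formal : FormalExp ℤ :=
  12 * (PowerSeries.C (T 1) * (((thetaFormal chi4 1).dy ^ 2 -
    thetaFormal chi4 1 * (thetaFormal chi4 1).dy.dy) * eulerInvFormal ^ 6)) +
      PowerSeries.map C e2Series * phiNegFormal

lemma hasExp_eulerInv :
    HasExp (fun τ _ => (eulerFun τ)⁻¹) (toComplex eulerInvFormal) := hasQInt_eulerFun_inv.hasExp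

lemma hasExp_y : HasExp (fun _ z => cexp (2 * π * I * z)) (toComplex (PowerSeries.C (T 1))) := by
  intro τ z
  have h := hasSum_single (f := fun p : ℕ × ℤ =>
    (toComplex (PowerSeries.C (T 1))).co p.1 p.2 * qy p.1 p.2 τ z) (0, 1) ?_
  · convert h using 1
    rw [co_toComplex, FormalExp.co, PowerSeries.coeff_C, if_pos rfl, T_coeff, qy]
    simp
  · rintro ⟨n, l⟩ hp
    rw [co_toComplex, FormalExp.co, PowerSeries.coeff_C]
    split_ifs with h
    · rw [T_coeff, if_neg]
      · simp
      · rintro rfl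
        exact hp (by simp_all)
    · simp

lemma exp_eta_inv (τ : ℍ) (z : ℂ) :
    cexp (π * I / (4 * (1 : ℕ)) * τ + π * I * z) ^ 2 * (ModularForm.eta τ)⁻¹ ^ 6 =
      cexp (2 * π * I * z) * (eulerFun τ)⁻¹ ^ 6 := by
  rw [eta_eq, mul_inv, mul_pow, ← mul_assoc, ← Complex.exp_neg, ← Complex.exp_nat_mul,
    ← Complex.exp_nat_mul, ← Complex.exp_add]
  congr 2
  push_cast
  ring

lemma hasExp_phiNeg : HasExp phiNeg (toComplex phiNegFormal) := by
  have h := hasExp_y.mul ((isThetaChar_chi4.hasExp.pow HasExp.one 2).mul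
    (hasExp_eulerInv.pow HasExp.one 6))
  rw [phiNegFormal, map_mul, map_mul, map_pow, map_pow]
  convert h using 1
  funext τ z
  simp only [Pi.mul_apply, Pi.pow_apply]
  rw [phiNeg, theta_eq, thetaSeries_eq]
  linear_combination thetaRed chi4 1 τ z ^ 2 * exp_eta_inv τ z

lemma hasExp_phi01 : HasExp phi01 (toComplex phi01Formal) := by
  have hθ := isThetaChar_chi4.hasExp
  have h := ((HasExp.const 12).mul (hasExp_y.mul (((hθ.dz.pow HasExp.one 2).sub
    (hθ.mul hθ.dz.dz)).mul (hasExp_eulerInv.pow HasExp.one 6)))).add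
      (hasQInt_E2.hasExp.mul hasExp_phiNeg)
  have e12 : toComplex 12 = PowerSeries.C (C 12) := by
    rw [map_ofNat, map_ofNat, map_ofNat]
  rw [phi01Formal, map_add, map_mul, map_mul, map_mul, map_mul, map_sub, map_pow, map_mul,
    toComplex_dy, toComplex_dy, toComplex_dy, map_pow, e12]
  convert h using 1
  funext τ z
  simp only [Pi.mul_apply, Pi.pow_apply, Pi.add_apply, Pi.sub_apply]
  rw [phi01, theta_fun_eq, hirota_thetaSeries isThetaChar_chi4, hirota]
  linear_combination 12 * (dz (thetaRed chi4 1) τ z ^ 2 - thetaRed chi4 1 τ z *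
    dz (dz (thetaRed chi4 1)) τ z) * exp_eta_inv τ z

lemma eta_S_pow_six (τ : ℍ) : (ModularForm.eta ((ModularGroup.S • τ : ℍ) : ℂ))⁻¹ ^ 6 =
    (-I * τ)⁻¹ ^ 3 * (ModularForm.eta τ)⁻¹ ^ 6 := by
  rw [eta_S, mul_inv, mul_pow, ← sqrtNegI_sq]
  ring

lemma jacobiExp_phiNeg : JacobiExp (-2) 1 phiNeg (toComplex phiNegFormal) where
  hasExp := hasExp_phiNeg
  S_law τ z := by
    have hτ : (τ : ℂ) ≠ 0 := τ.ne_zero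
    rw [phiNeg, phiNeg, theta_S', eta_S_pow_six, mul_pow, mul_pow, mul_pow, sqrtNegI_sq,
      ← Complex.exp_nat_mul]
    rw [show ((2 : ℕ) * (2 * π * I * (1 / 2) * z ^ 2 / τ) : ℂ) = 2 * π * I * (1 : ℕ) * z ^ 2 / τ by
      push_cast; ring, show (-2 : ℤ) = -(2 : ℕ) by norm_num, zpow_neg, zpow_natCast]
    field_simp
  E_law τ z := by
    rw [phiNeg, phiNeg, theta_add_tau, mul_pow, neg_sq, ← Complex.exp_nat_mul]
    rw [show ((2 : ℕ) * -(π * I * (τ + 2 * z)) : ℂ) = -(2 * π * I * (1 : ℕ) * (τ + 2 * z)) by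
      push_cast; ring]
    ring

/-- The theta function has index 1/2, so twelve times the bracket contributes the error -12τ/(2πi)
ϑ² under S. The quasi-modularity term of `E2`, multiplied by φ_{-2,1}, cancels it. -/
lemma jacobiExp_phi01 : JacobiExp 0 1 phi01 (toComplex phi01Formal) where
  hasExp := hasExp_phi01
  S_law τ z := by
    have hτ : (τ : ℂ) ≠ 0 := τ.ne_zero
    have hpi : (π : ℂ) ≠ 0 := by exact_mod_cast Real.pi_ne_zero
    have hA := jacobiExp_phiNeg.S_law τ z
    rw [phi01, phi01, hA, E2_S, eta_S_pow_six,
      hirota_S differentiable_theta differentiable_dz_theta (theta_S' τ) z, phiNeg, mul_pow,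
      mul_pow, sqrtNegI_sq, ← Complex.exp_nat_mul]
    rw [show ((2 : ℕ) * (2 * π * I * (1 / 2) * z ^ 2 / τ) : ℂ) = 2 * π * I * (1 : ℕ) * z ^ 2 / τ by
      push_cast; ring, show (-2 : ℤ) = -(2 : ℕ) by norm_num, zpow_neg, zpow_natCast]
    have hI : I ≠ 0 := I_ne_zero
    have hη := eta_ne_zero' τ
    field_simp
    ring
  E_law τ z := by
    have hA := jacobiExp_phiNeg.E_law τ z
    rw [phi01, phi01, hA, hirota_comp_add (differentiable_theta τ) (differentiable_dz_theta τ)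
      (theta_add_tau' τ), mul_pow, neg_sq, ← Complex.exp_nat_mul, ← Complex.exp_nat_mul,
      ← Complex.exp_add]
    rw [show ((2 : ℕ) * -(π * I * τ) + (2 : ℕ) * (2 * π * I * (-1 * z)) : ℂ) =
      -(2 * π * I * (1 : ℕ) * (τ + 2 * z)) by push_cast; ring]
    ring

/-! ### Leading terms -/

lemma constantCoeff_coeff {R : Type*} [Semiring R] (F : FormalExp R) (l : ℤ) :
    (PowerSeries.constantCoeff F).coeff l = F.co 0 l := by
  rw [FormalExp.co, PowerSeries.coeff_zero_eq_constantCoeff_apply]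

lemma constantCoeff_map {R S : Type*} [Semiring R] [Semiring S] (f : R →+* S) (F : PowerSeries R) :
    PowerSeries.constantCoeff (PowerSeries.map f F) = f (PowerSeries.constantCoeff F) := by
  rw [← PowerSeries.coeff_zero_eq_constantCoeff_apply, PowerSeries.coeff_map,
    PowerSeries.coeff_zero_eq_constantCoeff_apply]

lemma constantCoeff_dy_theta :
    PowerSeries.constantCoeff (thetaFormal chi4 1).dy = T (-1) := by
  refine LaurentPolynomial.ext fun l => ?_
  rw [constantCoeff_coeff, FormalExp.co_dy, ← constantCoeff_coeff, constantCoeff_thetaFormal_chi4,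
    ← T_zero, AddMonoidAlgebra.coeff_sub, Finsupp.sub_apply, T_coeff, T_coeff]
  by_cases h0 : l = 0
  · subst h0; simp
  by_cases h1 : l = -1
  · subst h1; simp
  simp [h0, h1]

lemma constantCoeff_dy_dy_theta :
    PowerSeries.constantCoeff (thetaFormal chi4 1).dy.dy = -T (-1) := by
  refine LaurentPolynomial.ext fun l => ?_
  rw [constantCoeff_coeff, FormalExp.co_dy, ← constantCoeff_coeff, constantCoeff_dy_theta,
    AddMonoidAlgebra.coeff_neg, Finsupp.neg_apply, T_coeff]
  by_cases h1 : l = -1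
  · subst h1; simp
  simp [h1]

/-- `y - 2 + y⁻¹`. -/
noncomputable def uPoly (R : Type*) [Ring R] : R[T;T⁻¹] := T 1 - 2 + T (-1)

lemma T_one_mul_T_neg_one {R : Type*} [Semiring R] : (T 1 * T (-1) : R[T;T⁻¹]) = 1 := by
  rw [← T_add, ← T_zero]
  norm_num

lemma constantCoeff_eulerInvFormal : PowerSeries.constantCoeff eulerInvFormal = 1 := by
  rw [eulerInvFormal, constantCoeff_map, constantCoeff_eulerInvSeries, map_one]

lemma constantCoeff_phiNegFormal : PowerSeries.constantCoeff phiNegFormal = uPoly ℤ := by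
  rw [phiNegFormal, map_mul, map_mul, map_pow, map_pow, constantCoeff_thetaFormal_chi4,
    constantCoeff_eulerInvFormal, PowerSeries.constantCoeff_C, uPoly]
  linear_combination (-2 + T (-1)) * T_one_mul_T_neg_one (R := ℤ)

lemma constantCoeff_e2Series : PowerSeries.constantCoeff e2Series = 1 := by
  rw [← PowerSeries.coeff_zero_eq_constantCoeff_apply, e2Series, PowerSeries.coeff_mk, if_pos rfl]

lemma constantCoeff_phi01Formal : PowerSeries.constantCoeff phi01Formal = 12 + uPoly ℤ := by
  rw [phi01Formal, map_add, map_mul, map_mul, map_mul, map_mul, map_sub, map_pow, map_mul, map_pow,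
    constantCoeff_dy_dy_theta, constantCoeff_dy_theta, constantCoeff_thetaFormal_chi4,
    constantCoeff_eulerInvFormal, constantCoeff_phiNegFormal, PowerSeries.constantCoeff_C,
    constantCoeff_map, constantCoeff_e2Series, map_ofNat, map_one]
  linear_combination 12 * T_one_mul_T_neg_one (R := ℤ)

lemma constantCoeff_toComplex (F : FormalExp ℤ) : PowerSeries.constantCoeff (toComplex F) =
    AddMonoidAlgebra.mapRingHom ℤ (Int.castRingHom ℂ) (PowerSeries.constantCoeff F) :=
  constantCoeff_map _ _

lemma mapRingHom_T (k : ℤ) :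
    AddMonoidAlgebra.mapRingHom ℤ (Int.castRingHom ℂ) (T k : ℤ[T;T⁻¹]) = T k := by
  refine LaurentPolynomial.ext fun l => ?_
  rw [AddMonoidAlgebra.coeff_mapRingHom, T_coeff, T_coeff]
  split_ifs <;> simp

lemma mapRingHom_uPoly :
    AddMonoidAlgebra.mapRingHom ℤ (Int.castRingHom ℂ) (uPoly ℤ) = uPoly ℂ := by
  rw [uPoly, uPoly, map_add, map_sub, mapRingHom_T, mapRingHom_T, map_ofNat]

/-! ### Modular forms from `q`-series -/

/-- Regarding g as a Jacobi form of index 0 reduces all of SL₂(ℤ) to the generator S; T acts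
trivially on q-series. -/
lemma HasQ.exists_modularForm_of_S {k : ℤ} {g : ℍ → ℂ} {a : PowerSeries ℂ} (h : HasQ g a)
    (hg : ∀ τ : ℍ, g (ModularGroup.S • τ) = (τ : ℂ) ^ k * g τ) :
    ∃ f : ModularForm 𝒮ℒ k, ⇑f = g := by
  have hJ : IsWeakJacobiForm k 0 (fun τ _ => g τ) :=
    isWeakJacobiForm_of_fourier (hasQ_iff_hasExp.mp h) (fun τ z => by simpa using hg τ)
      (fun τ z => by simp)
  refine h.exists_modularForm fun γ τ => ?_
  have := hJ.modular' γ τ 0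
  rw [this, jacobiFactor]
  simp

lemma HasQ.coeff_zero_of_const {g : ℍ → ℂ} {a : PowerSeries ℂ} (h : HasQ g a) {c : ℂ}
    (hc : ∀ τ, g τ = c) : c = PowerSeries.constantCoeff a := by
  have h1 := (h.congr_left hc).unique (HasQ.const c)
  rw [h1, PowerSeries.constantCoeff_C]

/-- A modular function of weight `0` with a `q`-series is constant. -/
lemma HasQ.eq_const {g : ℍ → ℂ} {a : PowerSeries ℂ} (h : HasQ g a)
    (hg : ∀ τ : ℍ, g (ModularGroup.S • τ) = g τ) (τ : ℍ) : g τ = PowerSeries.constantCoeff a := by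
  obtain ⟨f, hf⟩ := h.exists_modularForm_of_S (k := 0) (by simpa using hg)
  obtain ⟨c, hc⟩ := ModularFormClass.levelOne_weight_zero_const f
  rw [hf] at hc
  have h1 : ∀ τ, g τ = c := fun τ => congrFun hc τ
  rw [h1 τ]
  exact h.coeff_zero_of_const h1

/-! ### The behaviour of `φ_{-2,1}` and `φ_{0,1}` at `z = 0` -/

lemma theta_zero (τ : ℍ) : theta τ 0 = 0 := by
  have := theta_neg τ 0
  rw [neg_zero] at this
  exact self_eq_neg.mp this

lemma phiNeg_zero (τ : ℍ) : phiNeg τ 0 = 0 := by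
  rw [phiNeg, theta_zero]
  simp

lemma evalOne_uPoly : evalOne (uPoly ℂ) = 0 := by
  rw [uPoly, map_add, map_sub, evalOne_T, evalOne_T, map_ofNat]
  norm_num

/-- At z = 0 a form of weight 0 becomes a modular function of weight 0, hence a constant: here 12 +
u at y = 1. -/
lemma phi01_zero (τ : ℍ) : phi01 τ 0 = 12 := by
  have h := hasExp_phi01.hasQ_zero.eq_const (fun τ => by
    have := jacobiExp_phi01.S_law τ 0
    simpa using this) τ
  rw [h, constantCoeff_map, constantCoeff_toComplex, constantCoeff_phi01Formal, map_add,
    mapRingHom_uPoly, map_add, evalOne_uPoly, map_ofNat, map_ofNat, add_zero]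

/-- Zeros are isolated unless ϑ(τ, ·) vanishes identically, which its Laurent coefficient 1 at l = 0
excludes. -/
lemma theta_ne_zero_near (τ : ℍ) (w : ℂ) : ∀ᶠ z in 𝓝[≠] w, theta τ z ≠ 0 := by
  have hd := differentiable_theta τ
  rcases (hd.analyticAt w).eventually_eq_zero_or_eventually_ne_zero with h | h
  · exfalso
    have h1 : theta τ = 0 := by
      have ha : AnalyticOnNhd ℂ (theta τ) Set.univ := fun z _ => hd.analyticAt z
      have := ha.eqOn_of_preconnected_of_eventuallyEq (g := 0)
        (fun z _ => analyticAt_const) isPreconnected_univ (Set.mem_univ w) h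
      exact funext fun z => this (Set.mem_univ z)
    have h2 := isThetaChar_chi4.hasLaurent τ
    have h3 : thetaRed chi4 1 τ = 0 := by
      funext z
      rw [thetaRed, ← theta_eq, h1]
      simp
    rw [h3] at h2
    have h4 : HasLaurent 0 0 := fun z => by simp
    have h5 := congrFun (h2.unique h4) 0
    norm_num [chi4_eq] at h5
  · exact h

lemma phiNeg_ne_zero_near (τ : ℍ) (w : ℂ) : ∀ᶠ z in 𝓝[≠] w, phiNeg τ z ≠ 0 := by
  filter_upwards [theta_ne_zero_near τ w] with z hz
  exact mul_ne_zero (pow_ne_zero _ hz) (pow_ne_zero _ (inv_ne_zero (eta_ne_zero' τ)))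

lemma thetaRed_zero (τ : ℍ) : thetaRed chi4 1 τ 0 = 0 := by
  rw [thetaRed, ← theta_eq, theta_zero, mul_zero]

lemma dz_theta_zero (τ : ℍ) :
    dz theta τ 0 = cexp (π * I / (4 * (1 : ℕ)) * τ) * dz (thetaRed chi4 1) τ 0 := by
  rw [theta_fun_eq, dz_thetaSeries isThetaChar_chi4, thetaRed_zero]
  simp

/-- A form of the identity `ϑ'(0) = 2 π i η³`. -/
lemma dz_theta_zero_sq (τ : ℍ) : dz theta τ 0 ^ 2 * (ModularForm.eta τ)⁻¹ ^ 6 = 1 := by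
  have hQ : HasQ (fun τ => dz theta τ 0 ^ 2 * (ModularForm.eta τ)⁻¹ ^ 6) _ :=
    (((isThetaChar_chi4.hasExp.dz.hasQ_zero).pow 2).mul (hasQInt_eulerFun_inv.pow 6)).congr_left
      fun τ => by
        have := exp_eta_inv τ 0
        simp only [mul_zero, add_zero, Complex.exp_zero, one_mul] at this
        rw [dz_theta_zero, mul_pow]
        linear_combination -(dz (thetaRed chi4 1) τ 0 ^ 2) * this
  rw [hQ.eq_const (fun τ => ?_) τ]
  · rw [map_mul, map_pow, map_pow, constantCoeff_map, constantCoeff_map,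
      constantCoeff_eulerInvSeries, ← toComplex_dy, constantCoeff_toComplex,
      constantCoeff_dy_theta, mapRingHom_T, evalOne_T]
    simp
  · have h := dz_S differentiable_theta (theta_S' τ) 0
    rw [theta_zero, zero_div] at h
    have hτ : (τ : ℂ) ≠ 0 := τ.ne_zero
    have hI : I ≠ 0 := I_ne_zero
    rw [h, eta_S_pow_six]
    simp only [mul_pow, sqrtNegI_sq]
    simp
    field_simp
    rw [I_pow_four, one_mul]

lemma tendsto_phiNeg_div_sq (τ : ℍ) :
    Filter.Tendsto (fun z => phiNeg τ z / z ^ 2) (𝓝[≠] 0) (𝓝 ((2 * π * I) ^ 2)) := by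
  have h := (hasDerivAt_dz (differentiable_theta τ) 0).tendsto_slope
  have h1 : Filter.Tendsto (fun z => slope (theta τ) 0 z ^ 2 * (ModularForm.eta τ)⁻¹ ^ 6) (𝓝[≠] 0)
      (𝓝 ((2 * π * I * dz theta τ 0) ^ 2 * (ModularForm.eta τ)⁻¹ ^ 6)) :=
    (h.pow 2).mul_const _
  rw [mul_pow, mul_assoc, dz_theta_zero_sq, mul_one] at h1
  refine h1.congr fun z => ?_
  rw [slope_def_field, theta_zero, phiNeg]
  ring

lemma tendsto_phi01 (τ : ℍ) : Filter.Tendsto (phi01 τ) (𝓝[≠] 0) (𝓝 12) := by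
  rw [← phi01_zero τ]
  exact (hasExp_phi01.differentiable τ 0).continuousAt.tendsto.mono_left nhdsWithin_le_nhds

/-! ### Linear independence of `φ_{-2,1} ^ j φ_{0,1} ^ (m - j)` -/

/-- The quotient tends to 0 without being 0, so near z = 0 it avoids the roots of any given non-zero
polynomial. -/
lemma tendsto_phi_ratio (τ : ℍ) :
    Filter.Tendsto (fun z => phiNeg τ z / phi01 τ z) (𝓝[≠] 0) (𝓝[≠] 0) := by
  refine tendsto_nhdsWithin_iff.mpr ⟨?_, ?_⟩
  · have h1 : Filter.Tendsto (phiNeg τ) (𝓝[≠] 0) (𝓝 0) := by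
      have h := (hasExp_phiNeg.differentiable τ 0).continuousAt.tendsto
      rw [phiNeg_zero] at h
      exact h.mono_left nhdsWithin_le_nhds
    have h2 := h1.div (tendsto_phi01 τ) (by norm_num)
    rw [zero_div] at h2
    exact h2
  · filter_upwards [phiNeg_ne_zero_near τ 0, (tendsto_phi01 τ).eventually_ne
      (by norm_num : (12 : ℂ) ≠ 0)] with z h1 h2
    exact div_ne_zero h1 h2

lemma eventually_eval_ratio_ne_zero (τ : ℍ) {P : Polynomial ℂ} (hP : P ≠ 0) :
    ∀ᶠ z in 𝓝[≠] 0, P.eval (phiNeg τ z / phi01 τ z) ≠ 0 := by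
  have h1 : ∀ᶠ x in 𝓝[≠] (0 : ℂ), P.eval x ≠ 0 := by
    have hfin : ((P.roots.toFinset : Set ℂ) \ {0}).Finite := (Finset.finite_toSet _).sdiff
    have h2 := hfin.isClosed.isOpen_compl.mem_nhds (x := 0) (by simp)
    filter_upwards [nhdsWithin_le_nhds h2, self_mem_nhdsWithin] with x hx hx0 h0
    exact hx ⟨by simpa [hP] using h0, hx0⟩
  exact (tendsto_phi_ratio τ).eventually h1

/-! ### Theta functions of index `m` for fixed `τ` -/

lemma HasLaurent.zero : HasLaurent 0 0 := fun z => by simp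

/-- The space of even theta functions of index `m`. -/
def evenTheta (m : ℕ) (τ : ℍ) : Submodule ℂ (ℂ → ℂ) where
  carrier := {g | (∃ c, HasLaurent g c) ∧ (∀ z, g (-z) = g z) ∧
    ∀ z, g (z + τ) = cexp (-(2 * π * I * m * (τ + 2 * z))) * g z}
  zero_mem' := ⟨⟨0, HasLaurent.zero⟩, by simp, by simp⟩
  add_mem' := by
    rintro g h ⟨⟨c, hc⟩, h1, h2⟩ ⟨⟨d, hd⟩, h3, h4⟩
    refine ⟨⟨_, hc.add hd⟩, fun z => ?_, fun z => ?_⟩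
    · simp only [Pi.add_apply, h1, h3]
    · simp only [Pi.add_apply, h2, h4, mul_add]
  smul_mem' := by
    rintro a g ⟨⟨c, hc⟩, h1, h2⟩
    refine ⟨⟨_, hc.const_mul a⟩, fun z => ?_, fun z => ?_⟩
    · simp only [Pi.smul_apply, h1]
    · simp only [Pi.smul_apply, h2, smul_eq_mul]
      ring

lemma IsWeakJacobiForm.mem_evenTheta {k : ℤ} {m : ℕ} {φ : ℍ → ℂ → ℂ}
    (h : IsWeakJacobiForm k m φ) (hk : Even k) (τ : ℍ) : φ τ ∈ evenTheta m τ := by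
  obtain ⟨f, hf⟩ := h.fourier
  exact ⟨⟨_, hf.hasLaurent τ⟩, h.even hk τ, h.E_law τ⟩

lemma exp_two_pi_I_mul_ne_one (τ : ℍ) {l : ℤ} (hl : l ≠ 0) : cexp (2 * π * I * (l * τ)) ≠ 1 := by
  intro h
  obtain ⟨n, hn⟩ := Complex.exp_eq_one_iff.mp h
  have h1 : (l * τ : ℂ) = n := by
    refine mul_left_cancel₀ Complex.two_pi_I_ne_zero ?_
    rw [hn]
    ring
  have h2 := congrArg Complex.im h1
  simp only [mul_im, intCast_re, intCast_im, zero_mul, add_zero] at h2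
  have h3 : (τ : ℂ).im ≠ 0 := τ.im_pos.ne'
  rcases mul_eq_zero.mp h2 with h4 | h4
  · exact hl (by exact_mod_cast h4)
  · exact h3 h4

/-- An even theta function of index `m` is determined by `m + 1` coefficients. -/
lemma eq_zero_of_mem_evenTheta {m : ℕ} {τ : ℍ} {g : ℂ → ℂ} (hg : g ∈ evenTheta m τ) {c : ℤ → ℂ}
    (hc : HasLaurent g c) (h0 : ∀ l : ℕ, l ≤ m → c l = 0) : g = 0 := by
  obtain ⟨-, heven, hE⟩ := hg
  have hrec := hc.recursion hE
  have hneg : ∀ l, c (-l) = c l := by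
    have h2 : (fun z => g (-z)) = g := funext heven
    have h3 := hc.comp_neg
    rw [h2] at h3
    exact fun l => congrFun (h3.unique hc) l
  suffices c = 0 by
    subst this
    exact hc.eq HasLaurent.zero
  -- In index 0 the recursion does not move l; it reads c l = e^(2πilτ) c l and kills c l for l ≠ 0.
  rcases Nat.eq_zero_or_pos m with rfl | hm
  · funext l
    by_cases hl : l = 0
    · subst hl; exact h0 0 le_rfl
    · have h1 := hrec l
      simp only [Nat.cast_zero, mul_zero, add_zero] at h1
      have h2 : (cexp (2 * π * I * (l * τ)) - 1) * c l = 0 := by linear_combination -h1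
      exact (mul_eq_zero.mp h2).resolve_left (sub_ne_zero.mpr (exp_two_pi_I_mul_ne_one τ hl))
  · refine eq_zero_of_recursion hm (fun l => Complex.exp_ne_zero _) hrec fun l h1 h2 => ?_
    rcases le_or_gt 0 l with h3 | h3
    · obtain ⟨n, rfl⟩ := Int.eq_ofNat_of_zero_le h3
      exact h0 n (by omega)
    · obtain ⟨n, hn⟩ := Int.eq_ofNat_of_zero_le (by omega : 0 ≤ -l)
      rw [← hneg, hn]
      exact h0 n (by omega)

lemma HasLaurent.sum {ι : Type*} (s : Finset ι) {g : ι → ℂ → ℂ} {c : ι → ℤ → ℂ}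
    (h : ∀ i ∈ s, HasLaurent (g i) (c i)) : HasLaurent (∑ i ∈ s, g i) (∑ i ∈ s, c i) := by
  classical
  induction s using Finset.induction_on with
  | empty => simpa using HasLaurent.zero
  | insert i s hi ih =>
    simp only [Finset.sum_insert hi]
    exact (h i (Finset.mem_insert_self _ _)).add
      (ih fun j hj => h j (Finset.mem_insert_of_mem hj))

/-- The monomial `φ_{-2,1} ^ j φ_{0,1} ^ (m - j)`. -/
noncomputable def phiMon (m j : ℕ) : ℍ → ℂ → ℂ := phiNeg ^ j * phi01 ^ (m - j)

lemma phiMon_apply (m j : ℕ) (τ : ℍ) (z : ℂ) :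
    phiMon m j τ z = phiNeg τ z ^ j * phi01 τ z ^ (m - j) := rfl

lemma jacobiExp_phiMon {m j : ℕ} (hj : j ≤ m) : JacobiExp (-2 * j) m (phiMon m j)
    (toComplex (phiNegFormal ^ j * phi01Formal ^ (m - j))) := by
  rw [map_mul, map_pow, map_pow]
  refine ((jacobiExp_phiNeg.pow j).mul (jacobiExp_phi01.pow (m - j))).congr (by ring) ?_
  rw [mul_one, mul_one, Nat.add_sub_cancel' hj]

/-- Dividing a relation by φ_{0,1}^m turns it into a polynomial relation for the quotient φ_{-2,1} /
φ_{0,1}. -/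
lemma phiMon_linearIndependent {m : ℕ} {τ : ℍ} {a : Fin (m + 1) → ℂ}
    (h : ∀ z, ∑ j, a j * phiMon m j τ z = 0) : a = 0 := by
  by_contra ha
  let P : Polynomial ℂ := ∑ j : Fin (m + 1), Polynomial.monomial (j : ℕ) (a j)
  have hP : P ≠ 0 := by
    intro h0
    refine ha (funext fun j => ?_)
    have h1 : P.coeff j = a j := by
      simp [P, Polynomial.finsetSum_coeff, Polynomial.coeff_monomial, Fin.val_inj]
    rw [← h1, h0]
    simp
  obtain ⟨z, hz1, hz2⟩ := ((eventually_eval_ratio_ne_zero τ hP).and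
    ((tendsto_phi01 τ).eventually_ne (by norm_num : (12 : ℂ) ≠ 0))).exists
  refine hz1 ?_
  have h1 : P.eval (phiNeg τ z / phi01 τ z) * phi01 τ z ^ m = ∑ j, a j * phiMon m j τ z := by
    rw [Polynomial.eval_finsetSum, Finset.sum_mul]
    refine Finset.sum_congr rfl fun j _ => ?_
    have hj : (j : ℕ) ≤ m := Nat.lt_succ_iff.mp j.2
    have hpow : phi01 τ z ^ m = phi01 τ z ^ (m - j) * phi01 τ z ^ (j : ℕ) := by
      rw [← pow_add, Nat.sub_add_cancel hj]
    rw [Polynomial.eval_monomial, phiMon_apply, div_pow, hpow]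
    field_simp
  rw [h z] at h1
  exact (mul_eq_zero.mp h1).resolve_right (pow_ne_zero _ hz2)

/-- Even theta functions are combinations of the `φ_{-2,1} ^ j φ_{0,1} ^ (m - j)`. -/
lemma exists_coeffs_of_mem_evenTheta {m : ℕ} {τ : ℍ} {g : ℂ → ℂ} (hg : g ∈ evenTheta m τ) :
    ∃ a : Fin (m + 1) → ℂ, ∀ z, g z = ∑ j, a j * phiMon m j τ z := by
  have hmem : ∀ j : Fin (m + 1), phiMon m j τ ∈ evenTheta m τ := fun j =>
    (jacobiExp_phiMon (Nat.lt_succ_iff.mp j.2)).isWeakJacobiForm.mem_evenTheta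
      (by rw [neg_mul]; exact (even_two_mul _).neg) τ
  choose c hc using fun j => (hmem j).1
  obtain ⟨d, hd⟩ := hg.1
  -- The coefficients at l = 0, …, m embed the even theta functions of index m in ℂ^(m+1). The m + 1
  -- monomials stay independent there and therefore span.
  have hlin : LinearIndependent ℂ (fun j : Fin (m + 1) => fun i : Fin (m + 1) => c j (i : ℕ)) := by
    rw [Fintype.linearIndependent_iff]
    intro a ha
    refine congrFun (phiMon_linearIndependent (τ := τ) fun z => ?_)
    have h1 : HasLaurent (∑ j, fun z => a j * phiMon m j τ z) (∑ j, fun l => a j * c j l) :=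
      HasLaurent.sum _ fun j _ => (hc j).const_mul (a j)
    have h2 : (∑ j, fun z => a j * phiMon m j τ z) ∈ evenTheta m τ :=
      Submodule.sum_mem _ fun j _ => (evenTheta m τ).smul_mem (a j) (hmem j)
    have h3 := eq_zero_of_mem_evenTheta h2 h1 fun l hl => by
      have h4 := congrFun ha ⟨l, Nat.lt_succ_iff.mpr hl⟩
      simpa using h4
    have h5 := congrFun h3 z
    simpa using h5
  have hspan := hlin.span_eq_top_of_card_eq_finrank' (by simp)
  have h1 : (fun i : Fin (m + 1) => d (i : ℕ)) ∈ Submodule.span ℂ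
      (Set.range fun j : Fin (m + 1) => fun i : Fin (m + 1) => c j (i : ℕ)) := by
    rw [hspan]; trivial
  obtain ⟨a, ha⟩ := (Submodule.mem_span_range_iff_exists_fun ℂ).mp h1
  refine ⟨a, fun z => ?_⟩
  have h2 : HasLaurent (∑ j, fun z => a j * phiMon m j τ z) (∑ j, fun l => a j * c j l) :=
    HasLaurent.sum _ fun j _ => (hc j).const_mul (a j)
  have h3 : (∑ j, fun z => a j * phiMon m j τ z) ∈ evenTheta m τ :=
    Submodule.sum_mem _ fun j _ => (evenTheta m τ).smul_mem (a j) (hmem j)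
  have h4 := eq_zero_of_mem_evenTheta (Submodule.add_mem _ hg ((evenTheta m τ).smul_mem (-1) h3))
    (hd.add (h2.const_mul (-1))) fun l hl => by
      have h5 := congrFun ha ⟨l, Nat.lt_succ_iff.mpr hl⟩
      simp only [Finset.sum_apply, Pi.smul_apply, smul_eq_mul] at h5
      simp [h5]
  have h6 := congrFun h4 z
  simp only [Pi.add_apply, Pi.smul_apply, Finset.sum_apply, smul_eq_mul, Pi.zero_apply] at h6
  linear_combination h6

/-! ### Taylor coefficients -/

/-- After subtraction of c z^k the quotient by z^k tends to 0, so the remainder vanishes to order at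
least k + 1. -/
lemma iteratedDeriv_of_tendsto {g : ℂ → ℂ} (hg : Differentiable ℂ g) {k : ℕ} {c : ℂ}
    (h : Filter.Tendsto (fun z => g z / z ^ k) (𝓝[≠] 0) (𝓝 c)) :
    iteratedDeriv k g 0 = k.factorial * c := by
  let f : ℂ → ℂ := fun z => g z - c * z ^ k
  have hf : Differentiable ℂ f := hg.sub ((differentiable_id.pow k).const_mul c)
  have hf0 : Filter.Tendsto (fun z => f z / z ^ k) (𝓝[≠] 0) (𝓝 0) := by
    have h1 := h.sub_const c
    rw [sub_self] at h1
    refine h1.congr' ?_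
    filter_upwards [self_mem_nhdsWithin] with z hz
    have : z ^ k ≠ 0 := pow_ne_zero _ hz
    simp only [f]
    field_simp
  have hord : ((k + 1 : ℕ) : ℕ∞) ≤ analyticOrderAt f 0 := by
    by_contra hlt
    rw [not_le] at hlt
    obtain ⟨n, hn⟩ := ENat.ne_top_iff_exists.mp (hlt.ne_top)
    have hnk : n ≤ k := by
      rw [← hn] at hlt
      have : n < k + 1 := by exact_mod_cast hlt
      omega
    obtain ⟨v, hv, hv0, hfv⟩ := ((hf.analyticAt 0).analyticOrderAt_eq_natCast).mp hn.symm
    have h1 : Filter.Tendsto v (𝓝[≠] 0) (𝓝 (v 0)) :=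
      hv.continuousAt.tendsto.mono_left nhdsWithin_le_nhds
    have h2 : Filter.Tendsto (fun z : ℂ => z ^ (k - n) * (f z / z ^ k)) (𝓝[≠] 0) (𝓝 0) := by
      have h3 : Filter.Tendsto (fun z : ℂ => z ^ (k - n)) (𝓝[≠] 0) (𝓝 (0 ^ (k - n))) :=
        ((continuous_pow (k - n)).tendsto 0).mono_left nhdsWithin_le_nhds
      simpa using h3.mul hf0
    refine hv0 (tendsto_nhds_unique (h1.congr' ?_) h2)
    filter_upwards [nhdsWithin_le_nhds hfv, self_mem_nhdsWithin] with z hz hz0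
    have hz0' : z ≠ 0 := hz0
    rw [hz, sub_zero, smul_eq_mul, ← Nat.sub_add_cancel hnk, pow_add]
    simp only [Nat.add_sub_cancel]
    field_simp
  have h1 := (natCast_le_analyticOrderAt_iff_iteratedDeriv_eq_zero (hf.analyticAt 0)).mp hord k
    (Nat.lt_succ_self k)
  have h2 : g = f + fun z => c * z ^ k := by
    funext z
    simp [f]
  have h3 : ContDiffAt ℂ k f 0 := hf.contDiff.contDiffAt
  have h4 : ContDiffAt ℂ k (fun z : ℂ => c * z ^ k) 0 := by fun_prop
  rw [h2, iteratedDeriv_add h3 h4, h1, iteratedDeriv_const_mul_field,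
    iteratedDeriv_fun_pow_zero, if_pos rfl]
  ring

lemma iteratedDeriv_eq_dz {φ : ℍ → ℂ → ℂ} {f : ℕ → ℤ → ℂ} (h : HasFourierExpansion φ f) (k : ℕ)
    (τ : ℍ) : iteratedDeriv k (φ τ) = fun z => (2 * π * I) ^ k * (dz^[k] φ) τ z := by
  have hexp : ∀ k : ℕ, ∃ f', HasFourierExpansion (dz^[k] φ) f' := by
    intro k
    induction k with
    | zero => exact ⟨f, h⟩
    | succ k ih =>
      obtain ⟨f', hf'⟩ := ih
      rw [Function.iterate_succ_apply']
      exact ⟨_, hf'.dz⟩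
  induction k with
  | zero => simp
  | succ k ih =>
    obtain ⟨f', hf'⟩ := hexp k
    funext z
    rw [iteratedDeriv_succ, ih, Function.iterate_succ_apply',
      ((hasDerivAt_dz (hf'.differentiable τ) z).const_mul _).deriv, pow_succ]
    ring

/-- A general expansion may have infinitely many l for one n; the sums over l still converge, by
absolute convergence at z = 0. -/
lemma HasFourierExpansion.exists_hasQ_zero {φ : ℍ → ℂ → ℂ} {f : ℕ → ℤ → ℂ}
    (h : HasFourierExpansion φ f) : ∃ s, HasQ (fun τ => φ τ 0) s := by
  refine ⟨PowerSeries.mk fun n => ∑' l, f n l, fun τ => ?_⟩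
  refine HasSum.prod_fiberwise (h τ 0) fun n => ?_
  have h1 : Summable fun l => f n l * qy n l τ 0 :=
    (h τ 0).summable.comp_injective (i := fun l : ℤ => (n, l)) (Prod.mk_right_injective n)
  have h2 : ∀ l : ℤ, qy n l τ 0 = qy n 0 τ 0 := fun l => by simp [qy]
  have h3 : Summable fun l => f n l := by
    refine (summable_mul_right_iff (qy_ne_zero n 0 τ 0)).mp (h1.congr fun l => ?_)
    rw [h2]
  rw [PowerSeries.coeff_mk]
  refine (h3.hasSum.mul_right (qy n 0 τ 0)).congr_fun fun l => ?_
  rw [h2]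

lemma HasFourierExpansion.exists_hasQ_iteratedDeriv {φ : ℍ → ℂ → ℂ} {f : ℕ → ℤ → ℂ}
    (h : HasFourierExpansion φ f) (k : ℕ) :
    ∃ s, HasQ (fun τ => iteratedDeriv k (φ τ) 0) s := by
  have hexp : ∃ f', HasFourierExpansion (WeakJacobi.dz^[k] φ) f' := by
    induction k with
    | zero => exact ⟨f, h⟩
    | succ k ih =>
      obtain ⟨f', hf'⟩ := ih
      rw [Function.iterate_succ_apply']
      exact ⟨_, hf'.dz⟩
  obtain ⟨f', hf'⟩ := hexp
  obtain ⟨s, hs⟩ := hf'.exists_hasQ_zero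
  have h1 := (HasQ.const ((2 * π * I) ^ k)).mul hs
  refine ⟨_, h1.congr_left fun τ => ?_⟩
  rw [iteratedDeriv_eq_dz h]

/-! ### The structure theorem -/

/-- Since φ_{-2,1} ~ (2πiz)² and φ_{0,1} → 12 as z → 0, the even Taylor coefficients of the
monomials form a triangular matrix with constant non-zero diagonal. -/
lemma tendsto_phiMon_div (m : ℕ) {i j : ℕ} (hij : j ≤ i) (τ : ℍ) :
    Filter.Tendsto (fun z => phiMon m i τ z / z ^ (2 * j)) (𝓝[≠] 0)
      (𝓝 (if i = j then ((2 * π * I) ^ 2) ^ j * 12 ^ (m - j) else 0)) := by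
  have h1 : Filter.Tendsto (phiNeg τ) (𝓝[≠] 0) (𝓝 0) := by
    have h := (hasExp_phiNeg.differentiable τ 0).continuousAt.tendsto
    rw [phiNeg_zero] at h
    exact h.mono_left nhdsWithin_le_nhds
  have h2 := (((tendsto_phiNeg_div_sq τ).pow j).mul (h1.pow (i - j))).mul
    ((tendsto_phi01 τ).pow (m - i))
  convert h2.congr fun z => ?_ using 2
  · split_ifs with h
    · subst h; simp
    · rw [zero_pow (by omega)]; simp
  · have : phiNeg τ z ^ i = phiNeg τ z ^ j * phiNeg τ z ^ (i - j) := by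
      rw [← pow_add, Nat.add_sub_cancel' hij]
    rw [phiMon_apply, this, div_pow, ← pow_mul]
    ring

/-- The triangular system for the Taylor coefficients of φ at z = 0 is solved recursively; those
coefficients have q-series, hence so do its solutions `b j`. -/
lemma exists_hasQ_coeffs {m : ℕ} {φ : ℍ → ℂ → ℂ} {f : ℕ → ℤ → ℂ} (h : HasFourierExpansion φ f)
    {b : ℕ → ℍ → ℂ} (hb : ∀ τ z, φ τ z = ∑ j ∈ Finset.range (m + 1), b j τ * phiMon m j τ z)
    (j : ℕ) (hj : j ≤ m) : ∃ s, HasQ (b j) s := by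
  induction j using Nat.strong_induction_on with
  | _ j ih =>
  have hT : ∀ i ∈ Finset.range j, ∃ s, HasQ (fun τ =>
      b i τ * iteratedDeriv (2 * j) (phiMon m i τ) 0) s := by
    intro i hi
    rw [Finset.mem_range] at hi
    obtain ⟨s, hs⟩ := ih i hi (by omega)
    obtain ⟨t, ht⟩ := HasFourierExpansion.exists_hasQ_iteratedDeriv
      (jacobiExp_phiMon (m := m) (j := i) (by omega)).hasExp (2 * j)
    exact ⟨_, hs.mul ht⟩
  obtain ⟨s, hs⟩ := h.exists_hasQ_iteratedDeriv (2 * j)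
  choose! t ht using hT
  have hdiff : ∀ i ∈ Finset.range j, ∀ τ, Differentiable ℂ (phiMon m i τ) := fun i hi τ =>
    (jacobiExp_phiMon (m := m) (j := i)
      (by rw [Finset.mem_range] at hi; omega)).hasExp.differentiable τ
  have key : ∀ τ, iteratedDeriv (2 * j) (φ τ) 0 -
      ∑ i ∈ Finset.range j, b i τ * iteratedDeriv (2 * j) (phiMon m i τ) 0 =
      (2 * j).factorial * (b j τ * (((2 * π * I) ^ 2) ^ j * 12 ^ (m - j))) := by
    intro τ
    let g : ℂ → ℂ := φ τ - ∑ i ∈ Finset.range j, fun z => b i τ * phiMon m i τ z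
    have hterm : ∀ i ∈ Finset.range j, Differentiable ℂ (fun z => b i τ * phiMon m i τ z) :=
      fun i hi => (hdiff i hi τ).const_mul _
    have hsum : Differentiable ℂ (∑ i ∈ Finset.range j, fun z => b i τ * phiMon m i τ z) :=
      Differentiable.sum hterm
    have hg : Differentiable ℂ g := (h.differentiable τ).sub hsum
    have h1 : iteratedDeriv (2 * j) g 0 = iteratedDeriv (2 * j) (φ τ) 0 -
        ∑ i ∈ Finset.range j, b i τ * iteratedDeriv (2 * j) (phiMon m i τ) 0 := by
      rw [iteratedDeriv_sub (h.differentiable τ).contDiff.contDiffAt hsum.contDiff.contDiffAt,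
        iteratedDeriv_sum fun i hi => (hterm i hi).contDiff.contDiffAt]
      congr 1
      exact Finset.sum_congr rfl fun i _ => iteratedDeriv_const_mul_field _ _
    rw [← h1]
    refine iteratedDeriv_of_tendsto hg ?_
    have h2 : ∀ z, g z / z ^ (2 * j) =
        ∑ i ∈ Finset.Ico j (m + 1), b i τ * (phiMon m i τ z / z ^ (2 * j)) := by
      intro z
      simp only [g, Pi.sub_apply, Finset.sum_apply]
      rw [hb, ← Finset.sum_range_add_sum_Ico _ (by omega : j ≤ m + 1), add_sub_cancel_left,
        Finset.sum_div]
      exact Finset.sum_congr rfl fun i _ => mul_div_assoc _ _ _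
    simp only [h2]
    have h3 := tendsto_finsetSum (Finset.Ico j (m + 1)) fun i hi =>
      (tendsto_phiMon_div m (Finset.mem_Ico.mp hi).1 τ).const_mul (b i τ)
    convert h3 using 2
    rw [Finset.sum_eq_single_of_mem j (Finset.mem_Ico.mpr ⟨le_rfl, by omega⟩)
      fun i _ hi => by rw [if_neg hi, mul_zero], if_pos rfl]
  refine ⟨_, ((HasQ.const (((2 * j).factorial * (((2 * π * I) ^ 2) ^ j * 12 ^ (m - j)) : ℂ)⁻¹)).mul
    (hs.sub (HasQ.sum _ ht))).congr_left fun τ => ?_⟩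
  have hne : ((2 * j).factorial * (((2 * π * I) ^ 2) ^ j * 12 ^ (m - j)) : ℂ) ≠ 0 := by
    refine mul_ne_zero (by exact_mod_cast (2 * j).factorial_ne_zero) (mul_ne_zero ?_ ?_)
    · exact pow_ne_zero _ (pow_ne_zero _ Complex.two_pi_I_ne_zero)
    · exact pow_ne_zero _ (by norm_num)
  rw [inv_mul_eq_iff_eq_mul₀ hne, key]
  ring

/-- Weak Jacobi forms of even weight are polynomials in `φ_{-2,1}` and `φ_{0,1}` over the ring of
modular forms. -/
theorem IsWeakJacobiForm.exists_modularForms {k : ℤ} {m : ℕ} {φ : ℍ → ℂ → ℂ}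
    (h : IsWeakJacobiForm k m φ) (hk : Even k) : ∃ F : ∀ j : ℕ, ModularForm 𝒮ℒ (k + 2 * j),
      ∀ τ z, φ τ z = ∑ j ∈ Finset.range (m + 1), F j τ * phiMon m j τ z := by
  choose a ha using fun τ => exists_coeffs_of_mem_evenTheta (h.mem_evenTheta hk τ)
  let b : ℕ → ℍ → ℂ := fun j τ => if hj : j < m + 1 then a τ ⟨j, hj⟩ else 0
  have hba : ∀ τ (j : Fin (m + 1)), b j τ = a τ j := fun τ j => dif_pos j.2
  have hb : ∀ τ z, φ τ z = ∑ j ∈ Finset.range (m + 1), b j τ * phiMon m j τ z := by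
    intro τ z
    rw [ha, Finset.sum_range]
    exact Finset.sum_congr rfl fun j _ => by rw [hba]
  obtain ⟨f, hf⟩ := h.fourier
  have hF : ∀ j : ℕ, ∃ F : ModularForm 𝒮ℒ (k + 2 * j), ⇑F = b j := by
    intro j
    by_cases hj : j < m + 1
    · obtain ⟨s, hs⟩ := exists_hasQ_coeffs hf hb j (by omega)
      refine hs.exists_modularForm fun γ τ => ?_
      have hd := cocycleDenom_ne_zero γ τ
      -- Expanding φ at the transformed point by the laws of the monomials gives a linear relation
      -- at the old point; independence makes each coefficient zero, which is modularity of weight k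
      -- + 2j.
      have h1 : (fun i : Fin (m + 1) => b i (γ • τ) * cocycleDenom γ τ ^ (-2 * (i : ℤ)) -
          cocycleDenom γ τ ^ k * b i τ) = 0 := by
        refine phiMon_linearIndependent (τ := τ) fun z => ?_
        have h2 := h.modular' γ τ z
        rw [hb, hb, Finset.mul_sum, ← sub_eq_zero, ← Finset.sum_sub_distrib, Finset.sum_range] at h2
        refine (mul_eq_zero.mp (Eq.trans ?_ h2)).resolve_left
          (Complex.exp_ne_zero (2 * π * I * m * (γ 1 0 : ℂ) * z ^ 2 / cocycleDenom γ τ))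
        rw [Finset.mul_sum]
        refine Finset.sum_congr rfl fun i _ => ?_
        rw [(jacobiExp_phiMon (Nat.lt_succ_iff.mp i.2)).isWeakJacobiForm.modular' γ τ z,
          jacobiFactor, jacobiFactor]
        ring
      have h3 := congrFun h1 ⟨j, hj⟩
      simp only [Pi.zero_apply, sub_eq_zero] at h3
      rw [zpow_add₀ hd, mul_right_comm, ← h3, mul_assoc, ← zpow_add₀ hd]
      simp
    · refine ⟨0, ?_⟩
      funext τ
      simp only [b]
      rw [dif_neg hj]
      rfl
  choose F hF using hF
  exact ⟨F, fun τ z => by simp only [hb, hF]⟩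

/-! ### Division of formal expansions and integrality -/

/-- The inclusion of `ℤ[T;T⁻¹]` in `ℂ[T;T⁻¹]`. -/
noncomputable abbrev laurentToComplex : ℤ[T;T⁻¹] →+* ℂ[T;T⁻¹] :=
  AddMonoidAlgebra.mapRingHom ℤ (Int.castRingHom ℂ)

/-- The quotient by `f a` of an element of the range of `f` lies in the range of `f`. -/
def Saturated {R S : Type*} [CommRing R] [CommRing S] (f : R →+* S) (a : R) : Prop :=
  ∀ x : S, f a * x ∈ f.range → x ∈ f.range

lemma Saturated.mul {R S : Type*} [CommRing R] [CommRing S] {f : R →+* S} {a b : R}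
    (ha : Saturated f a) (hb : Saturated f b) : Saturated f (a * b) := fun x hx =>
  hb x (ha _ (by rwa [map_mul, mul_assoc] at hx))

lemma Saturated.of_isUnit {R S : Type*} [CommRing R] [CommRing S] {f : R →+* S} {a : R}
    (ha : IsUnit a) : Saturated f a := by
  obtain ⟨b, hb⟩ := ha.exists_left_inv
  rintro x ⟨y, hy⟩
  refine ⟨b * y, ?_⟩
  rw [map_mul, hy, ← mul_assoc, ← map_mul, hb, map_one, one_mul]

lemma Saturated.pow {R S : Type*} [CommRing R] [CommRing S] {f : R →+* S} {a : R}
    (ha : Saturated f a) (n : ℕ) : Saturated f (a ^ n) := by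
  induction n with
  | zero => rw [pow_zero]; exact .of_isUnit isUnit_one
  | succ n ih => rw [pow_succ]; exact ih.mul ha

lemma mem_range_laurentToComplex {P : ℂ[T;T⁻¹]} :
    P ∈ laurentToComplex.range ↔ ∀ l, ∃ n : ℤ, P.coeff l = n := by
  constructor
  · rintro ⟨Q, rfl⟩ l
    exact ⟨Q.coeff l, by simp⟩
  · intro h
    choose c hc using h
    have hfin : (Function.support c).Finite := P.coeff.support.finite_toSet.subset fun l hl => by
      simpa [hc] using hl
    refine ⟨AddMonoidAlgebra.ofCoeff (Finsupp.ofSupportFinite c hfin), ?_⟩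
    refine LaurentPolynomial.ext fun l => ?_
    rw [AddMonoidAlgebra.coeff_mapRingHom, hc]
    rfl

/-- The differences of consecutive coefficients are integers and the coefficients vanish for large
exponents, so descending induction applies. -/
lemma saturated_one_sub_T : Saturated laurentToComplex (1 - T (-1)) := by
  intro P hP
  rw [mem_range_laurentToComplex] at hP ⊢
  have hstep : ∀ l, ∃ n : ℤ, P.coeff l - P.coeff (l + 1) = n := by
    intro l
    obtain ⟨n, hn⟩ := hP l
    refine ⟨n, ?_⟩
    rw [← hn, map_sub, map_one, mapRingHom_T, sub_mul, one_mul, AddMonoidAlgebra.coeff_sub,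
      Finsupp.sub_apply]
    have := coeff_T_mul (1 : ℂ) (-1) P l
    rw [map_one, one_mul, one_mul, sub_neg_eq_add] at this
    rw [this]
  obtain ⟨N, hN⟩ := P.coeff.support.bddAbove
  have hbig : ∀ l, N < l → P.coeff l = 0 := fun l hl => by
    by_contra h
    exact absurd (hN (Finsupp.mem_support_iff.mpr h)) (not_le.mpr hl)
  have key : ∀ k : ℕ, ∀ l, N < l + k → ∃ n : ℤ, P.coeff l = n := by
    intro k
    induction k with
    | zero => exact fun l hl => ⟨0, by simpa using hbig l (by simpa using hl)⟩
    | succ k ih =>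
      intro l hl
      obtain ⟨a, ha⟩ := hstep l
      obtain ⟨b, hb⟩ := ih (l + 1) (by push_cast at hl; omega)
      exact ⟨a + b, by push_cast; linear_combination ha + hb⟩
  intro l
  exact key (N - l + 1).toNat l (by omega)

lemma saturated_uPoly : Saturated laurentToComplex (uPoly ℤ) := by
  have h : uPoly ℤ = T 1 * (1 - T (-1)) ^ 2 := by
    rw [uPoly]
    linear_combination (2 - T (-1)) * T_one_mul_T_neg_one (R := ℤ)
  rw [h]
  exact (Saturated.of_isUnit (isUnit_T 1)).mul (saturated_one_sub_T.pow 2)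

lemma mem_range_toComplex {F : FormalExp ℂ} :
    F ∈ toComplex.range ↔ ∀ n, PowerSeries.coeff n F ∈ laurentToComplex.range := by
  constructor
  · rintro ⟨G, rfl⟩ n
    exact ⟨PowerSeries.coeff n G, (PowerSeries.coeff_map _ _ _).symm⟩
  · intro h
    choose g hg using h
    refine ⟨PowerSeries.mk g, PowerSeries.ext fun n => ?_⟩
    rw [toComplex, PowerSeries.coeff_map, PowerSeries.coeff_mk, hg]

/-- The quotient is determined recursively in powers of q, each step dividing an integral Laurent
polynomial by the constant coefficient of G. -/
lemma Saturated.of_constantCoeff {G : FormalExp ℤ}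
    (hG : Saturated laurentToComplex (PowerSeries.constantCoeff G)) : Saturated toComplex G := by
  intro Ψ h
  rw [mem_range_toComplex] at h ⊢
  intro n
  induction n using Nat.strong_induction_on with
  | _ n ih =>
  refine hG _ ?_
  have h1 := h n
  rw [PowerSeries.coeff_mul, Finset.Nat.sum_antidiagonal_eq_sum_range_succ_mk,
    Finset.sum_range_succ', Nat.sub_zero] at h1
  rw [PowerSeries.coeff_zero_eq_constantCoeff_apply, constantCoeff_toComplex] at h1
  refine (add_mem_cancel_left ?_).mp h1
  refine Subring.sum_mem _ fun i hi => Subring.mul_mem _ ?_ (ih _ ?_)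
  · exact mem_range_toComplex.mp ⟨G, rfl⟩ _
  · rw [Finset.mem_range] at hi
    omega

lemma saturated_X : Saturated toComplex PowerSeries.X := by
  intro Ψ h
  rw [mem_range_toComplex] at h ⊢
  intro n
  have := h (n + 1)
  rwa [toComplex, PowerSeries.map_X, PowerSeries.coeff_succ_X_mul] at this

lemma saturated_phiNegFormal : Saturated toComplex phiNegFormal :=
  .of_constantCoeff (by rw [constantCoeff_phiNegFormal]; exact saturated_uPoly)

/-! ### Polynomials in `y - 2 + y⁻¹` -/

/-- The value of a Laurent polynomial at a non-zero number. -/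
noncomputable def evalAt (x : ℂˣ) : ℂ[T;T⁻¹] →+* ℂ := LaurentPolynomial.eval₂ (RingHom.id ℂ) x

@[simp] lemma evalAt_T (x : ℂˣ) (k : ℤ) : evalAt x (T k) = ((x ^ k : ℂˣ) : ℂ) := by
  simp [evalAt]

@[simp] lemma evalAt_C (x : ℂˣ) (a : ℂ) : evalAt x (C a) = a := by
  simp [evalAt]

lemma exists_evalAt_uPoly (v : ℂ) : ∃ x : ℂˣ, evalAt x (uPoly ℂ) = v := by
  -- The equation y - 2 + y⁻¹ = v is the quadratic y² - (2 + v) y + 1 = 0; its roots have product 1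
  -- and so are units.
  obtain ⟨s, hs⟩ := IsAlgClosed.exists_eq_mul_self ((2 + v) ^ 2 - 4)
  have hne : (2 + v + s) / 2 ≠ 0 := by
    intro h
    have h1 : s = -(2 + v) := by linear_combination 2 * h
    rw [h1] at hs
    have : (4 : ℂ) = 0 := by linear_combination -hs
    norm_num at this
  refine ⟨Units.mk0 _ hne, ?_⟩
  rw [uPoly, map_add, map_sub, evalAt_T, evalAt_T, map_ofNat]
  simp only [zpow_one, zpow_neg, Units.val_inv_eq_inv_val, Units.val_mk0]
  have h2 : 2 + v + s ≠ 0 := by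
    intro h
    rw [h] at hne
    simp at hne
  field_simp
  linear_combination -hs

/-- Every complex number is a value of u at some y ≠ 0, so a polynomial in u determines the values
of the polynomial everywhere. -/
lemma aeval_uPoly_injective :
    Function.Injective (Polynomial.aeval (R := ℂ) (uPoly ℂ)) := by
  intro p q h
  refine Polynomial.funext fun v => ?_
  obtain ⟨x, hx⟩ := exists_evalAt_uPoly v
  have key : ∀ p : Polynomial ℂ, evalAt x (Polynomial.aeval (uPoly ℂ) p) = p.eval v := by
    intro p
    rw [Polynomial.aeval_def, Polynomial.hom_eval₂, hx, Polynomial.eval]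
    congr 1
    ext a
    exact evalAt_C x a
  rw [← key, ← key, h]

/-- The polynomial `∑ a_j X ^ j (X + 12) ^ (m - j)`. -/
noncomputable def twistedPoly (m : ℕ) (a : ℕ → ℂ) : Polynomial ℂ :=
  ∑ j ∈ Finset.range (m + 1),
    Polynomial.C (a j) * (Polynomial.X ^ j * (12 + Polynomial.X) ^ (m - j))

/-- The substitution X = 12w/(1 - w) makes X + 12 = 12/(1 - w), so that up to the factor (12/(1 -
w))^m the sum becomes the polynomial ∑ a_j w^j. -/
lemma eq_zero_of_twistedPoly_eq_zero {m : ℕ} {a : ℕ → ℂ} (h : twistedPoly m a = 0) {j : ℕ}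
    (hj : j ≤ m) : a j = 0 := by
  have h1 : (∑ j ∈ Finset.range (m + 1), Polynomial.C (a j) * Polynomial.X ^ j) = 0 := by
    refine Polynomial.eq_zero_of_infinite_isRoot _
      (Set.Infinite.mono ?_ (Set.Finite.infinite_compl (Set.finite_singleton (1 : ℂ))))
    intro w hw
    have hw1 : 1 - w ≠ 0 := sub_ne_zero.mpr (Ne.symm hw)
    have h2 := congrArg (Polynomial.eval (12 * w / (1 - w))) h
    rw [twistedPoly, Polynomial.eval_finsetSum, Polynomial.eval_zero] at h2
    change Polynomial.eval w _ = 0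
    rw [Polynomial.eval_finsetSum]
    have h3 : (12 / (1 - w)) ^ m ≠ 0 := pow_ne_zero _ (div_ne_zero (by norm_num) hw1)
    refine (mul_eq_zero.mp ((Finset.mul_sum _ _ _).trans (Eq.trans ?_ h2))).resolve_left h3
    refine Finset.sum_congr rfl fun j hj => ?_
    have hj' : j ≤ m := Finset.mem_range_succ_iff.mp hj
    simp only [Polynomial.eval_mul, Polynomial.eval_C, Polynomial.eval_pow, Polynomial.eval_X,
      Polynomial.eval_add, Polynomial.eval_ofNat]
    rw [show (12 + 12 * w / (1 - w) : ℂ) = 12 / (1 - w) by field_simp; ring,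
      show (12 * w / (1 - w) : ℂ) = 12 / (1 - w) * w by ring, mul_pow]
    obtain ⟨i, rfl⟩ := Nat.exists_eq_add_of_le hj'
    rw [Nat.add_sub_cancel_left, pow_add]
    ring
  have h2 := congrArg (fun p => Polynomial.coeff p j) h1
  simpa [Polynomial.finsetSum_coeff, Polynomial.coeff_C_mul, Polynomial.coeff_X_pow,
    Nat.lt_succ_iff.mpr hj] using h2

/-! ### The `q ^ 0`-term of a form of weight `0` -/

/-- The combination of the `φ_{-2,1} ^ j φ_{0,1} ^ (m - j)` with coefficients `F j`. -/
noncomputable def phiSum (m : ℕ) (F : ℕ → ℍ → ℂ) (τ : ℍ) (z : ℂ) : ℂ :=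
  ∑ j ∈ Finset.range (m + 1), F j τ * phiMon m j τ z

/-- The formal expansion of `phiSum`. -/
noncomputable def phiSumFormal (m : ℕ) (a : ℕ → PowerSeries ℂ) : FormalExp ℂ :=
  ∑ j ∈ Finset.range (m + 1),
    PowerSeries.map C (a j) * toComplex (phiNegFormal ^ j * phi01Formal ^ (m - j))

lemma jacobiExp_phiSum {k : ℤ} (m : ℕ) {c : ℕ → ℤ} (hc : ∀ j, c j = k + 2 * j)
    (F : ∀ j : ℕ, ModularForm 𝒮ℒ (c j)) :
    JacobiExp k m (phiSum m fun j => F j) (phiSumFormal m fun j => qExpansion 1 (F j)) := by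
  have h := JacobiExp.sum (Finset.range (m + 1)) (k := k) (m := m) fun j hj =>
    ((JacobiExp.modularForm (F j)).mul
      (jacobiExp_phiMon (Finset.mem_range_succ_iff.mp hj))).congr (by rw [hc]; ring) (zero_add m)
  convert h using 1
  · funext τ z
    simp only [Finset.sum_apply, Pi.mul_apply, phiSum]
  · rfl

lemma constantCoeff_phiSumFormal (m : ℕ) (a : ℕ → PowerSeries ℂ) :
    PowerSeries.constantCoeff (phiSumFormal m a) = Polynomial.aeval (uPoly ℂ)
      (twistedPoly m fun j => PowerSeries.constantCoeff (a j)) := by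
  rw [phiSumFormal, twistedPoly, map_sum, map_sum]
  refine Finset.sum_congr rfl fun j _ => ?_
  rw [map_mul, constantCoeff_map, constantCoeff_toComplex, map_mul, map_pow, map_pow, map_mul,
    map_pow, map_pow, constantCoeff_phiNegFormal, constantCoeff_phi01Formal, map_add,
    mapRingHom_uPoly, map_ofNat, map_mul, map_mul, map_pow, map_pow, Polynomial.aeval_C,
    Polynomial.aeval_X, map_add, Polynomial.aeval_X, map_ofNat]
  rfl

lemma modularForm_weight_two_eq_zero {k : ℤ} (hk : k = 2) (f : ModularForm 𝒮ℒ k) : f = 0 := by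
  subst hk
  exact rank_zero_iff_forall_zero.mp ModularForm.levelOne_weight_two_rank_zero f

/-- The condition `a 1 = 0` comes from the absence of modular forms of weight 2; it is the only
linear constraint on q^0-terms in the end. -/
lemma IsWeakJacobiForm.constantCoeff_eq {m : ℕ} {φ : ℍ → ℂ → ℂ} (h : IsWeakJacobiForm 0 m φ)
    {F : FormalExp ℂ} (hF : HasExp φ F) : ∃ a : ℕ → ℂ, a 1 = 0 ∧
      PowerSeries.constantCoeff F = Polynomial.aeval (uPoly ℂ) (twistedPoly m a) := by
  obtain ⟨f, hf⟩ := h.exists_modularForms Even.zero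
  refine ⟨fun j => PowerSeries.constantCoeff (qExpansion 1 (f j)), ?_, ?_⟩
  · change PowerSeries.constantCoeff (qExpansion 1 (f 1)) = 0
    rw [modularForm_weight_two_eq_zero (by norm_num) (f 1), FunLike.coe_zero, qExpansion_zero, map_zero]
  · have h1 : φ = phiSum m fun j => f j := funext fun τ => funext fun z => hf τ z
    rw [← constantCoeff_phiSumFormal,
      hF.unique (h1 ▸ (jacobiExp_phiSum (k := 0) m (fun _ => rfl) f).hasExp)]

/-! ### Divisibility by the discriminant and by φ_{-2,1} -/

lemma exists_discriminant_mul {k : ℤ} (f : ModularForm 𝒮ℒ k)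
    (h : PowerSeries.constantCoeff (qExpansion 1 f) = 0) :
    ∃ g : ModularForm 𝒮ℒ (k - 12), ∀ τ, f τ = ModularForm.discriminant τ * g τ := by
  rw [← PowerSeries.coeff_zero_eq_constantCoeff_apply] at h
  exact ⟨CuspForm.discriminantEquiv (ModularForm.toCuspForm f h), fun τ => by
    rw [ModularForm.discriminant_mul_discriminantEquiv_apply, ModularForm.toCuspForm_apply]⟩

lemma phiSum_eq_mul {m r : ℕ} (hr : r ≤ m) {F : ℕ → ℍ → ℂ} (hF : ∀ j < r, F j = 0) (τ : ℍ) (z : ℂ) :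
    phiSum m F τ z = phiNeg τ z ^ r * phiSum (m - r) (fun j => F (j + r)) τ z := by
  obtain ⟨n, rfl⟩ := Nat.exists_eq_add_of_le hr
  rw [phiSum, phiSum, Nat.add_sub_cancel_left, add_assoc, Finset.sum_range_add,
    Finset.sum_eq_zero fun j hj => by simp [hF j (Finset.mem_range.mp hj)], zero_add,
    Finset.mul_sum]
  refine Finset.sum_congr rfl fun j _ => ?_
  rw [phiMon_apply, phiMon_apply, add_comm r j, Nat.add_comm r n, Nat.add_sub_add_right, pow_add]
  ring

lemma phiSum_eq_zero {m : ℕ} {F : ℕ → ℍ → ℂ} (hF : ∀ j ≤ m, F j = 0) : phiSum m F = 0 := by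
  funext τ z
  exact Finset.sum_eq_zero fun j hj => by simp [hF j (Finset.mem_range_succ_iff.mp hj)]

/-- A form without `q ^ 0`-term is divisible by `Δ φ_{-2,1} ^ 6`. -/
theorem IsWeakJacobiForm.eq_discriminant_mul {m : ℕ} {φ : ℍ → ℂ → ℂ} (h : IsWeakJacobiForm 0 m φ)
    {F : FormalExp ℂ} (hF : HasExp φ F) (h0 : PowerSeries.constantCoeff F = 0) :
    (m < 6 ∧ φ = 0) ∨ (6 ≤ m ∧ ∃ ψ G, JacobiExp 0 (m - 6) ψ G ∧
      ∀ τ z, φ τ z = ModularForm.discriminant τ * phiNeg τ z ^ 6 * ψ τ z) := by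
  obtain ⟨f, hf⟩ := h.exists_modularForms Even.zero
  have h1 : φ = phiSum m fun j => f j := funext fun τ => funext fun z => hf τ z
  rw [hF.unique (h1 ▸ (jacobiExp_phiSum (k := 0) m (fun _ => rfl) f).hasExp),
    constantCoeff_phiSumFormal, ← map_zero (Polynomial.aeval (R := ℂ) (uPoly ℂ))] at h0
  have h2 := fun j (hj : j ≤ m) => eq_zero_of_twistedPoly_eq_zero (aeval_uPoly_injective h0) hj
  have h3 : ∀ j : ℕ, ∃ g : ModularForm 𝒮ℒ (0 + 2 * j - 12), j ≤ m →
      ∀ τ, f j τ = ModularForm.discriminant τ * g τ := fun j => by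
    by_cases hj : j ≤ m
    · obtain ⟨g, hg⟩ := exists_discriminant_mul (f j) (h2 j hj)
      exact ⟨g, fun _ => hg⟩
    · exact ⟨0, fun h => absurd h hj⟩
  choose g hg using h3
  have hφ : ∀ τ z, φ τ z = ModularForm.discriminant τ * phiSum m (fun j => g j) τ z := by
    intro τ z
    rw [hf, phiSum, Finset.mul_sum]
    exact Finset.sum_congr rfl fun j hj => by
      rw [hg j (Finset.mem_range_succ_iff.mp hj)]; ring
  -- The quotient `g j` has weight 2j - 12, negative for j < 6; only multiples of φ_{-2,1}^6
  -- survive.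
  have hneg : ∀ j < 6, (⇑(g j) : ℍ → ℂ) = 0 := fun j hj =>
    ModularFormClass.levelOne_neg_weight_eq_zero (by omega) (g j)
  rcases lt_or_ge m 6 with hm | hm
  · refine Or.inl ⟨hm, ?_⟩
    funext τ z
    rw [hφ, phiSum_eq_zero fun j hj => hneg j (by omega)]
    simp
  · refine Or.inr ⟨hm, _, _, jacobiExp_phiSum (k := 0) (m - 6)
      (fun j => by push_cast; ring) (fun j => g (j + 6)), fun τ z => ?_⟩
    rw [hφ, phiSum_eq_mul hm hneg, mul_assoc]

/-- A form of weight `0` and index less than `6` is determined by its `q ^ 0`-term. -/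
lemma IsWeakJacobiForm.eq_of_constantCoeff_eq {m : ℕ} (hm : m < 6) {φ ψ : ℍ → ℂ → ℂ}
    {F G : FormalExp ℂ} (h : JacobiExp 0 m φ F) (h' : JacobiExp 0 m ψ G)
    (h0 : PowerSeries.constantCoeff F = PowerSeries.constantCoeff G) : φ = ψ := by
  have h1 := h.add (h'.const_mul (-1))
  have h2 := h1.isWeakJacobiForm.eq_discriminant_mul h1.hasExp (by
    rw [map_add, map_mul, PowerSeries.constantCoeff_C, h0, map_neg, map_one]; ring)
  rcases h2 with ⟨-, h3⟩ | ⟨h3, -⟩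
  · funext τ z
    have := congrFun (congrFun h3 τ) z
    simp only [Pi.add_apply, Pi.zero_apply] at this
    linear_combination this
  · omega

/-- A form of weight `-2` is divisible by `φ_{-2,1}`. -/
lemma JacobiExp.eq_phiNeg_mul {m : ℕ} {φ : ℍ → ℂ → ℂ} {F : FormalExp ℂ}
    (h : JacobiExp (-2) (m + 1) φ F) :
    ∃ ψ G, JacobiExp 0 m ψ G ∧ ∀ τ z, φ τ z = phiNeg τ z * ψ τ z := by
  obtain ⟨f, hf⟩ := h.isWeakJacobiForm.exists_modularForms (by decide)
  refine ⟨_, _, jacobiExp_phiSum (k := 0) m (fun j => by push_cast; ring) (fun j => f (j + 1)),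
    fun τ z => ?_⟩
  -- The coefficient for j = 0 has weight -2 and vanishes.
  have h1 := phiSum_eq_mul (m := m + 1) (r := 1) (by omega) (F := fun j => f j) (fun j hj =>
    ModularFormClass.levelOne_neg_weight_eq_zero (by omega) (f j)) τ z
  rw [pow_one] at h1
  exact (hf τ z).trans h1

/-! ### The discriminant -/

lemma hasQInt_discriminant :
    HasQInt ModularForm.discriminant (PowerSeries.X * eulerSeries ^ 24) := by
  have hX : HasQ (fun τ : ℍ => cexp (2 * π * I * τ)) PowerSeries.X := by
    intro τ
    convert hasSum_single (f := fun n => PowerSeries.coeff n PowerSeries.X * qy n 0 τ 0) 1 ?_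
      using 1
    · simp [qy]
    · intro n hn
      simp [PowerSeries.coeff_X, hn]
  rw [HasQInt, map_mul, PowerSeries.map_X, map_pow]
  refine (hX.mul (HasQ.pow hasQInt_eulerFun 24)).congr_left fun τ => ?_
  rw [ModularForm.discriminant, eta_eq, mul_pow, ← Complex.exp_nat_mul]
  congr 2
  push_cast
  ring

/-- The formal expansion of `Δ φ_{-2,1} ^ 6`. -/
noncomputable def discPhiFormal : FormalExp ℤ :=
  PowerSeries.map C (PowerSeries.X * eulerSeries ^ 24) * phiNegFormal ^ 6

lemma hasExp_discPhi : HasExp (fun τ z => ModularForm.discriminant τ * phiNeg τ z ^ 6)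
    (toComplex discPhiFormal) := by
  rw [discPhiFormal, map_mul, map_pow]
  exact hasQInt_discriminant.hasExp.mul (hasExp_phiNeg.pow HasExp.one 6)

/-- The expansion is a product of q, a power series with constant term 1, and a power of the
expansion of φ_{-2,1}; each factor is saturated. -/
lemma saturated_discPhiFormal : Saturated toComplex discPhiFormal := by
  rw [discPhiFormal, map_mul, PowerSeries.map_X, map_pow]
  refine (saturated_X.mul (Saturated.pow (.of_constantCoeff ?_) 24)).mul
    (saturated_phiNegFormal.pow 6)
  rw [constantCoeff_map, constantCoeff_eulerSeries, map_one]
  exact .of_isUnit isUnit_one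

/-- A form with integral coefficients and without `q ^ 0`-term is `Δ φ_{-2,1} ^ 6` times a form
with integral coefficients. -/
theorem JZ.eq_discriminant_mul {m : ℕ} {φ : ℍ → ℂ → ℂ} (h : φ ∈ JZ m)
    {F : FormalExp ℂ} (hF : HasExp φ F) (h0 : PowerSeries.constantCoeff F = 0) :
    (m < 6 ∧ φ = 0) ∨ (6 ≤ m ∧ ∃ ψ ∈ JZ (m - 6),
      ∀ τ z, φ τ z = ModularForm.discriminant τ * phiNeg τ z ^ 6 * ψ τ z) := by
  rcases h.1.eq_discriminant_mul hF h0 with h1 | ⟨h1, ψ, G, hG, hψ⟩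
  · exact Or.inl h1
  · refine Or.inr ⟨h1, ψ, ⟨hG.isWeakJacobiForm, ?_⟩, hψ⟩
    obtain ⟨F', hF'⟩ := hasIntegralCoeffs_iff.mp h.2
    have h2 := hasExp_discPhi.mul hG.hasExp
    have h3 : φ = (fun τ z => ModularForm.discriminant τ * phiNeg τ z ^ 6) * ψ :=
      funext fun τ => funext fun z => hψ τ z
    rw [← h3] at h2
    obtain ⟨G', rfl⟩ := saturated_discPhiFormal G ⟨F', hF'.unique h2⟩
    exact hasIntegralCoeffs_iff.mpr ⟨G', hG.hasExp⟩

/-! ### Quotients by the theta series -/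

lemma eq_of_mul_theta_eq {g h : ℂ → ℂ} (hg : Continuous g) (hh : Continuous h) (τ : ℍ)
    (H : ∀ z, g z * theta τ z = h z * theta τ z) (z : ℂ) : g z = h z := by
  refine tendsto_nhds_unique_of_eventuallyEq (hg.continuousAt.tendsto.mono_left nhdsWithin_le_nhds)
    (hh.continuousAt.tendsto.mono_left nhdsWithin_le_nhds) (l := 𝓝[≠] z) ?_
  filter_upwards [theta_ne_zero_near τ z] with w hw
  exact mul_right_cancel₀ hw (H w)

lemma thetaQuotient_eq {N : ℕ} {τ : ℍ} {g : ℂ → ℂ} (hg : Continuous g)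
    (h : ∀ w, theta τ (N * w) = g w * theta τ w) (z : ℂ) : thetaQuotient N τ z = g z := by
  refine Filter.Tendsto.limUnder_eq ?_
  refine (hg.continuousAt.tendsto.mono_left nhdsWithin_le_nhds).congr' ?_
  filter_upwards [theta_ne_zero_near τ z] with w hw
  rw [h, mul_div_cancel_right₀ _ hw]

/-! ### The form `φ_{0,3}` -/

lemma differentiable_theta12 (τ : ℍ) : Differentiable ℂ (theta12 τ) :=
  differentiable_thetaSeries isThetaChar_chi12 τ

/-- The law follows from those of ϑ(z), ϑ(2z) and η through `theta12_mul_theta`; the index is 4/2 -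
1/2 = 3/2. Cancelling ϑ at its zeros uses continuity. -/
lemma theta12_S (τ : ℍ) (z : ℂ) : theta12 (ModularGroup.S • τ) (z / τ) =
    sqrtNegI τ * cexp (2 * π * I * (3 / 2) * z ^ 2 / τ) * theta12 τ z := by
  have hd := (differentiable_theta12 (ModularGroup.S • τ)).continuous
  have hd' := (differentiable_theta12 τ).continuous
  refine eq_of_mul_theta_eq (g := fun z => theta12 (ModularGroup.S • τ) (z / τ))
    (h := fun z => sqrtNegI τ * cexp (2 * π * I * (3 / 2) * z ^ 2 / τ) * theta12 τ z)
    (by fun_prop) (by fun_prop) τ (fun z => ?_) z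
  have h1 := theta12_mul_theta (ModularGroup.S • τ) (z / τ)
  have h2 := theta12_mul_theta τ z
  rw [← mul_div_assoc, theta_S', theta_S', eta_S] at h1
  have h3 : cexp (2 * π * I * (1 / 2) * (2 * z) ^ 2 / τ) =
      cexp (2 * π * I * (3 / 2) * z ^ 2 / τ) * cexp (2 * π * I * (1 / 2) * z ^ 2 / τ) := by
    rw [← Complex.exp_add]
    ring_nf
  rw [h3] at h1
  refine mul_left_cancel₀ (mul_ne_zero (mul_ne_zero (neg_ne_zero.mpr I_ne_zero)
    (sqrtNegI_ne_zero τ)) (Complex.exp_ne_zero (2 * π * I * (1 / 2) * z ^ 2 / τ))) ?_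
  linear_combination h1 - sqrtNegI τ * cexp (2 * π * I * (3 / 2) * z ^ 2 / τ) *
    (-I * sqrtNegI τ) * cexp (2 * π * I * (1 / 2) * z ^ 2 / τ) * h2

lemma thetaQuotient_two (τ : ℍ) (z : ℂ) :
    thetaQuotient 2 τ z = theta12 τ z * (ModularForm.eta τ)⁻¹ := by
  refine thetaQuotient_eq (g := fun z => theta12 τ z * (ModularForm.eta τ)⁻¹)
    ((differentiable_theta12 τ).continuous.mul_const _) (fun w => ?_) z
  have h := theta12_mul_theta τ w
  have h0 := eta_ne_zero' τ
  push_cast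
  field_simp
  linear_combination -h

lemma phi03_eq (τ : ℍ) (z : ℂ) :
    phi03 τ z = theta12 τ z ^ 2 * (ModularForm.eta τ)⁻¹ ^ 2 := by
  rw [phi03, thetaQuotient_two, mul_pow]

/-- The formal expansion of `φ_{0,3}`. -/
noncomputable def phi03Formal : FormalExp ℤ :=
  PowerSeries.C (T 1) * (thetaFormal chi12 3 ^ 2 * eulerInvFormal ^ 2)

lemma constantCoeff_phi03Formal : PowerSeries.constantCoeff phi03Formal = 4 + uPoly ℤ := by
  rw [phi03Formal, map_mul, map_mul, map_pow, map_pow, constantCoeff_thetaFormal_chi12,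
    constantCoeff_eulerInvFormal, PowerSeries.constantCoeff_C, uPoly]
  linear_combination (2 + T (-1)) * T_one_mul_T_neg_one (R := ℤ)

lemma hasExp_phi03 : HasExp phi03 (toComplex phi03Formal) := by
  have h := hasExp_y.mul ((isThetaChar_chi12.hasExp.pow HasExp.one 2).mul
    (hasExp_eulerInv.pow HasExp.one 2))
  rw [phi03Formal, map_mul, map_mul, map_pow, map_pow]
  convert h using 1
  funext τ z
  simp only [Pi.mul_apply, Pi.pow_apply]
  have e : cexp (π * I / (4 * (3 : ℕ)) * τ + π * I * z) ^ 2 * (ModularForm.eta τ)⁻¹ ^ 2 =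
      cexp (2 * π * I * z) * (eulerFun τ)⁻¹ ^ 2 := by
    rw [eta_eq, mul_inv, mul_pow, ← mul_assoc, ← Complex.exp_neg, ← Complex.exp_nat_mul,
      ← Complex.exp_nat_mul, ← Complex.exp_add]
    congr 2
    push_cast
    ring
  rw [phi03_eq, theta12, thetaSeries_eq]
  linear_combination thetaRed chi12 3 τ z ^ 2 * e

lemma jacobiExp_phi03 : JacobiExp 0 3 phi03 (toComplex phi03Formal) where
  hasExp := hasExp_phi03
  S_law τ z := by
    have e : cexp (2 * π * I * (3 : ℕ) * z ^ 2 / τ) =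
        cexp (2 * π * I * (3 / 2) * z ^ 2 / τ) ^ 2 := by
      rw [← Complex.exp_nat_mul]
      push_cast
      ring_nf
    have h0 := sqrtNegI_ne_zero τ
    rw [phi03_eq, phi03_eq, theta12_S, eta_S, e]
    field_simp
  E_law τ z := by
    have e : cexp (-(2 * π * I * (3 : ℕ) * (τ + 2 * z))) =
        cexp (-(3 * π * I * (τ + 2 * z))) ^ 2 := by
      rw [← Complex.exp_nat_mul]
      push_cast
      ring_nf
    rw [phi03_eq, phi03_eq, theta12_add_tau, e]
    ring

/-! ### The form `φ_{0,2}` -/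

lemma HasExp.hasLaurent_dz {φ : ℍ → ℂ → ℂ} {F : FormalExp ℂ} (h : HasExp φ F) {τ : ℍ}
    {c : ℤ → ℂ} (hc : HasLaurent (φ τ) c) : HasLaurent (WeakJacobi.dz φ τ) fun l => l * c l := by
  rw [hc.unique (HasFourierExpansion.hasLaurent h τ)]
  have h1 := (HasFourierExpansion.dz h).hasLaurent τ
  convert h1 using 2 with l
  simp only [yCoeff]
  rw [← tsum_mul_left]
  simp only [mul_assoc]

lemma IsThetaChar.hasSum_dz {χ : ℤ → ℤ} {M : ℕ} (h : IsThetaChar χ M) (τ : ℍ) (z : ℂ) :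
    HasSum (fun n : ℤ => (n / 2 : ℂ) *
      ((χ n : ℂ) * cexp (π * I * n ^ 2 / (4 * M) * (τ : ℂ) + π * I * n * z)))
      (dz (thetaSeries χ M) τ z) := by
  have h1 := ((h.hasExp.hasLaurent_dz (h.hasLaurent τ) z).add
    ((h.hasLaurent τ z).div_const 2)).mul_left (cexp (π * I / (4 * M) * τ + π * I * z))
  rw [← dz_thetaSeries h] at h1
  have hinj : Function.Injective (fun l : ℤ => 2 * l + 1) := fun a b hab => by
    have : 2 * a + 1 = 2 * b + 1 := hab
    omega
  refine (hinj.hasSum_iff fun n hn => ?_).mp (h1.congr_fun fun l => ?_)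
  · rw [h.even_eq_zero]
    · simp
    · by_contra hodd
      obtain ⟨l, hl⟩ := Int.not_even_iff_odd.mp hodd
      exact hn ⟨l, hl.symm⟩
  · have e : cexp (π * I * ((2 * l + 1 : ℤ) : ℂ) ^ 2 / (4 * M) * (τ : ℂ) +
        π * I * ((2 * l + 1 : ℤ) : ℂ) * z) = cexp (π * I / (4 * M) * τ + π * I * z) *
        (cexp (π * I * (2 * l + 1) ^ 2 / (4 * M) * τ - π * I / (4 * M) * τ) *
          cexp (2 * π * I * (l * z))) := by
      rw [← Complex.exp_add, ← Complex.exp_add]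
      congr 1
      push_cast
      ring
    simp only [Function.comp]
    rw [e]
    push_cast
    ring

/-- The operator D multiplies the terms of the two theta series by m/2 and n/2, so the factor 3m - n
is twice a bracket of first derivatives, and the 1/2 in the definition cancels. -/
lemma phi02_eq (τ : ℍ) (z : ℂ) : phi02 τ z = (ModularForm.eta τ)⁻¹ ^ 4 *
    (3 * dz theta τ z * theta12 τ z - theta τ z * dz theta12 τ z) := by
  have h1 := hasSum_mul_of_hasSum (isThetaChar_chi4.hasSum_dz τ z) (isThetaChar_chi12.hasSum τ z)
  have h2 := hasSum_mul_of_hasSum (isThetaChar_chi4.hasSum τ z) (isThetaChar_chi12.hasSum_dz τ z)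
  have h3 := ((h1.mul_left 3).sub h2).mul_left 2
  rw [← theta_fun_eq] at h3
  rw [phi02, (h3.congr_fun fun p => ?_).tsum_eq]
  · rw [show (-4 : ℤ) = -(4 : ℕ) by norm_num, zpow_neg, zpow_natCast, inv_pow]
    change _ = _ * (3 * _ * thetaSeries chi12 3 τ z - _ * dz (thetaSeries chi12 3) τ z)
    ring
  · have e : cexp (2 * π * I * ((3 * (p.1 : ℂ) ^ 2 + (p.2 : ℂ) ^ 2) / 24 * (τ : ℂ) +
        ((p.1 : ℂ) + p.2) / 2 * z)) =
        cexp (π * I * p.1 ^ 2 / (4 * (1 : ℕ)) * (τ : ℂ) + π * I * p.1 * z) *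
          cexp (π * I * p.2 ^ 2 / (4 * (3 : ℕ)) * (τ : ℂ) + π * I * p.2 * z) := by
      rw [← Complex.exp_add]
      congr 1
      push_cast
      ring
    rw [e, chi4]
    ring

/-- The formal expansion of `φ_{0,2}`. -/
noncomputable def phi02Formal : FormalExp ℤ :=
  PowerSeries.C (T 1) * (eulerInvFormal ^ 4 *
    (3 * (thetaFormal chi4 1).dy * thetaFormal chi12 3 + thetaFormal chi4 1 * thetaFormal chi12 3 -
      thetaFormal chi4 1 * (thetaFormal chi12 3).dy))

lemma constantCoeff_dy_theta12 :
    PowerSeries.constantCoeff (thetaFormal chi12 3).dy = -T (-1) := by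
  refine LaurentPolynomial.ext fun l => ?_
  rw [constantCoeff_coeff, FormalExp.co_dy, ← constantCoeff_coeff, constantCoeff_thetaFormal_chi12,
    ← T_zero, AddMonoidAlgebra.coeff_add, Finsupp.add_apply, AddMonoidAlgebra.coeff_neg,
    Finsupp.neg_apply, T_coeff, T_coeff]
  by_cases h0 : l = 0
  · subst h0; simp
  · by_cases h1 : l = -1
    · subst h1; simp
    · simp [h0, h1]

lemma constantCoeff_phi02Formal : PowerSeries.constantCoeff phi02Formal = 6 + uPoly ℤ := by
  rw [phi02Formal, map_mul, map_mul, map_pow, map_sub, map_add, map_mul, map_mul, map_mul, map_mul,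
    constantCoeff_dy_theta12, constantCoeff_dy_theta, constantCoeff_thetaFormal_chi4,
    constantCoeff_thetaFormal_chi12, constantCoeff_eulerInvFormal, PowerSeries.constantCoeff_C,
    map_ofNat, uPoly]
  linear_combination (4 + T (-1)) * T_one_mul_T_neg_one (R := ℤ)

lemma hasExp_phi02 : HasExp phi02 (toComplex phi02Formal) := by
  have hΘ := isThetaChar_chi4.hasExp
  have hK := isThetaChar_chi12.hasExp
  have h := hasExp_y.mul ((hasExp_eulerInv.pow HasExp.one 4).mul
    (((((HasExp.const 3).mul hΘ.dz).mul hK).add (hΘ.mul hK)).sub (hΘ.mul hK.dz)))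
  simp only [map_ofNat] at h
  rw [phi02Formal, map_mul, map_mul, map_pow, map_sub, map_add, map_mul, map_mul, map_mul, map_mul,
    toComplex_dy, toComplex_dy, map_ofNat]
  convert h using 1
  funext τ z
  simp only [Pi.mul_apply, Pi.pow_apply, Pi.sub_apply, Pi.add_apply]
  have e : cexp (π * I / (4 * (1 : ℕ)) * τ + π * I * z) *
      cexp (π * I / (4 * (3 : ℕ)) * τ + π * I * z) * (ModularForm.eta τ)⁻¹ ^ 4 =
      cexp (2 * π * I * z) * (eulerFun τ)⁻¹ ^ 4 := by
    rw [eta_eq, mul_inv, mul_pow, ← mul_assoc, ← Complex.exp_neg, ← Complex.exp_nat_mul,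
      ← Complex.exp_add, ← Complex.exp_add]
    congr 2
    push_cast
    ring
  rw [phi02_eq, theta_fun_eq, show theta12 = thetaSeries chi12 3 from rfl,
    dz_thetaSeries isThetaChar_chi4, dz_thetaSeries isThetaChar_chi12, thetaSeries_eq,
    thetaSeries_eq]
  linear_combination (3 * dz (thetaRed chi4 1) τ z * thetaRed chi12 3 τ z +
    thetaRed chi4 1 τ z * thetaRed chi12 3 τ z -
      thetaRed chi4 1 τ z * dz (thetaRed chi12 3) τ z) * e

/-- The indices of the two theta functions are 1/2 and 3/2. The weights 3 and -1 in the bracket are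
in inverse proportion to them, so the terms without derivatives cancel under both z ↦ z + τ and S.
-/
lemma jacobiExp_phi02 : JacobiExp 0 2 phi02 (toComplex phi02Formal) where
  hasExp := hasExp_phi02
  S_law τ z := by
    have e : cexp (2 * π * I * (2 : ℕ) * z ^ 2 / τ) =
        cexp (2 * π * I * (1 / 2) * z ^ 2 / τ) * cexp (2 * π * I * (3 / 2) * z ^ 2 / τ) := by
      rw [← Complex.exp_add]
      push_cast
      ring_nf
    have h0 := sqrtNegI_ne_zero τ
    have h1 : (τ : ℂ) = I * sqrtNegI τ ^ 2 := by
      rw [sqrtNegI_sq]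
      linear_combination (τ : ℂ) * I_mul_I
    rw [phi02_eq, phi02_eq, dz_S differentiable_theta (fun z => theta_S' τ z),
      dz_S differentiable_theta12 (fun z => theta12_S τ z), theta12_S, theta_S', eta_S, e,
      zpow_zero, mul_inv, mul_pow]
    have h2 : (sqrtNegI τ)⁻¹ ^ 4 * (-I * sqrtNegI τ * sqrtNegI τ * τ) = 1 := by
      rw [h1]
      field_simp
      linear_combination -I_mul_I
    linear_combination (ModularForm.eta τ)⁻¹ ^ 4 *
      (cexp (2 * π * I * (1 / 2) * z ^ 2 / τ) * cexp (2 * π * I * (3 / 2) * z ^ 2 / τ)) *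
      (3 * dz theta τ z * theta12 τ z - theta τ z * dz theta12 τ z) * h2
  E_law τ z := by
    have hK : ∀ z, theta12 τ (z + τ) =
        -cexp (-(3 * π * I * τ)) * cexp (2 * π * I * (-3 * z)) * theta12 τ z := fun z => by
      rw [theta12_add_tau, neg_mul, neg_mul, neg_mul, neg_mul, ← Complex.exp_add]
      ring_nf
    have e : cexp (-(2 * π * I * (2 : ℕ) * (τ + 2 * z))) =
        cexp (-(π * I * τ)) * cexp (2 * π * I * (-1 * z)) *
          (cexp (-(3 * π * I * τ)) * cexp (2 * π * I * (-3 * z))) := by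
      rw [← Complex.exp_add, ← Complex.exp_add, ← Complex.exp_add]
      push_cast
      ring_nf
    rw [phi02_eq, phi02_eq, dz_comp_add (differentiable_theta τ) (theta_add_tau' τ),
      dz_comp_add (differentiable_theta12 τ) hK, theta_add_tau', hK, e]
    ring

/-! ### The form `φ_{0,4}` -/

/-- The formal expansion of `φ (τ, N z)`. -/
noncomputable def FormalExp.dilate {R : Type*} [Semiring R] (N : ℕ) (F : FormalExp R) :
    FormalExp R :=
  FormalExp.ofCoeff (fun n l => if (N : ℤ) ∣ l then F.co n (l / N) else 0) fun n => by
    refine ((PowerSeries.coeff n F).coeff.support.finite_toSet.image fun l => (N : ℤ) * l).subset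
      fun l hl => ?_
    rw [Function.mem_support, ite_ne_right_iff] at hl
    exact ⟨l / N, Finset.mem_coe.mpr (Finsupp.mem_support_iff.mpr hl.2), Int.mul_ediv_cancel' hl.1⟩

lemma FormalExp.co_dilate {R : Type*} [Semiring R] (N : ℕ) (F : FormalExp R) (n : ℕ) (l : ℤ) :
    (F.dilate N).co n l = if (N : ℤ) ∣ l then F.co n (l / N) else 0 := by
  rw [FormalExp.dilate, FormalExp.co_ofCoeff]

lemma toComplex_dilate (N : ℕ) (F : FormalExp ℤ) :
    toComplex (F.dilate N) = (toComplex F).dilate N :=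
  FormalExp.ext fun n l => by
    rw [co_toComplex, FormalExp.co_dilate, FormalExp.co_dilate, co_toComplex]
    split_ifs <;> simp

lemma HasExp.dilate {φ : ℍ → ℂ → ℂ} {F : FormalExp ℂ} (h : HasExp φ F) {N : ℕ} (hN : N ≠ 0) :
    HasExp (fun τ z => φ τ (N * z)) (F.dilate N) := by
  intro τ z
  have hN' : (N : ℤ) ≠ 0 := by exact_mod_cast hN
  have hinj : Function.Injective (fun p : ℕ × ℤ => (p.1, (N : ℤ) * p.2)) := by
    rintro ⟨a, b⟩ ⟨c, d⟩ h
    simp only [Prod.mk.injEq] at h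
    rw [h.1, mul_left_cancel₀ hN' h.2]
  refine (hinj.hasSum_iff fun p hp => ?_).mp ((h τ (N * z)).congr_fun fun p => ?_)
  · rw [FormalExp.co_dilate, if_neg, zero_mul]
    rintro ⟨l, hl⟩
    exact hp ⟨(p.1, l), Prod.ext rfl hl.symm⟩
  · simp only [Function.comp, FormalExp.co_dilate, dvd_mul_right, if_true,
      Int.mul_ediv_cancel_left _ hN', qy]
    congr 2
    push_cast
    ring

/-- The formal expansion of `ϑ (τ, 3z) ϑ (τ, z) / η ^ 6`. -/
noncomputable def thetaTripleFormal : FormalExp ℤ :=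
  PowerSeries.C (T 1) * (PowerSeries.C (T 1) *
    ((thetaFormal chi4 1).dilate 3 * thetaFormal chi4 1 * eulerInvFormal ^ 6))

lemma constantCoeff_dilate_theta :
    PowerSeries.constantCoeff ((thetaFormal chi4 1).dilate 3) = 1 - T (-3) := by
  refine LaurentPolynomial.ext fun l => ?_
  rw [constantCoeff_coeff, FormalExp.co_dilate, ← constantCoeff_coeff,
    constantCoeff_thetaFormal_chi4, ← T_zero, AddMonoidAlgebra.coeff_sub, Finsupp.sub_apply,
    AddMonoidAlgebra.coeff_sub, Finsupp.sub_apply, T_coeff, T_coeff, T_coeff, T_coeff]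
  split_ifs <;> first | rfl | omega

lemma constantCoeff_thetaTripleFormal :
    PowerSeries.constantCoeff thetaTripleFormal = uPoly ℤ * (3 + uPoly ℤ) := by
  have h : (T (-3) : ℤ[T;T⁻¹]) = T (-1) ^ 3 := by rw [T_pow]; norm_num
  rw [thetaTripleFormal, map_mul, map_mul, map_mul, map_mul, map_pow, constantCoeff_dilate_theta,
    constantCoeff_thetaFormal_chi4, constantCoeff_eulerInvFormal, PowerSeries.constantCoeff_C, h,
    uPoly]
  linear_combination (-T 1 - 2 + (T (-1) ^ 2 - T (-1)) * (T 1 * T (-1) + 1)) *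
    T_one_mul_T_neg_one (R := ℤ)

/-- An auxiliary form of index 9/2 + 1/2 whose quotient by φ_{-2,1} = ϑ²/η⁶ is ϑ(3z)/ϑ(z). -/
lemma jacobiExp_thetaTriple : JacobiExp (-2) 5
    (fun τ z => theta τ (3 * z) * theta τ z * (ModularForm.eta τ)⁻¹ ^ 6)
    (toComplex thetaTripleFormal) where
  hasExp := by
    have h := hasExp_y.mul (hasExp_y.mul (((isThetaChar_chi4.hasExp.dilate three_ne_zero).mul
      isThetaChar_chi4.hasExp).mul (hasExp_eulerInv.pow HasExp.one 6)))
    rw [thetaTripleFormal, map_mul, map_mul, map_mul, map_mul, map_pow, toComplex_dilate]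
    convert h using 1
    funext τ z
    simp only [Pi.mul_apply, Pi.pow_apply]
    have e : cexp (π * I / (4 * (1 : ℕ)) * τ + π * I * (3 * z)) =
        cexp (2 * π * I * z) * cexp (π * I / (4 * (1 : ℕ)) * τ + π * I * z) := by
      rw [← Complex.exp_add]
      ring_nf
    rw [theta_eq, theta_eq, thetaSeries_eq, thetaSeries_eq, e]
    push_cast
    have h := exp_eta_inv τ z
    push_cast at h
    linear_combination cexp (2 * π * I * z) * thetaRed chi4 1 τ (3 * z) * thetaRed chi4 1 τ z * h
  S_law τ z := by
    have hτ : (τ : ℂ) ≠ 0 := τ.ne_zero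
    have h1 := theta_S' τ (3 * z)
    rw [mul_div_assoc] at h1
    have e : cexp (2 * π * I * (5 : ℕ) * z ^ 2 / τ) =
        cexp (2 * π * I * (1 / 2) * (3 * z) ^ 2 / τ) * cexp (2 * π * I * (1 / 2) * z ^ 2 / τ) := by
      rw [← Complex.exp_add]
      push_cast
      ring_nf
    rw [h1, theta_S', eta_S_pow_six, e, show (-2 : ℤ) = -(2 : ℕ) by norm_num, zpow_neg,
      zpow_natCast]
    have h2 : (-I * sqrtNegI τ) * (-I * sqrtNegI τ) * (-I * τ)⁻¹ ^ 3 = ((τ : ℂ) ^ 2)⁻¹ := by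
      rw [show (-I * sqrtNegI τ) * (-I * sqrtNegI τ) = (-I) ^ 2 * sqrtNegI τ ^ 2 by ring,
        sqrtNegI_sq]
      have := I_ne_zero
      field_simp
    linear_combination (cexp (2 * π * I * (1 / 2) * (3 * z) ^ 2 / τ) *
      cexp (2 * π * I * (1 / 2) * z ^ 2 / τ)) * theta τ (3 * z) * theta τ z *
        (ModularForm.eta τ)⁻¹ ^ 6 * h2
  E_law τ z := by
    have e : cexp (-(2 * π * I * (5 : ℕ) * (τ + 2 * z))) =
        cexp (-(π * I * (τ + 2 * (3 * z + τ + τ)))) * cexp (-(π * I * (τ + 2 * (3 * z + τ)))) *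
          cexp (-(π * I * (τ + 2 * (3 * z)))) * cexp (-(π * I * (τ + 2 * z))) := by
      rw [← Complex.exp_add, ← Complex.exp_add, ← Complex.exp_add]
      push_cast
      ring_nf
    rw [show 3 * (z + τ) = 3 * z + τ + τ + τ by ring, theta_add_tau, theta_add_tau, theta_add_tau,
      theta_add_tau, e]
    ring

/-- Holomorphy of the quotient at the zeros of ϑ comes for free from divisibility by φ_{-2,1} in
weight -2, and integrality from saturation. The q^0-term is u(3 + u)/u. -/
lemma exists_jacobiExp_phi04 : ∃ F : FormalExp ℤ, JacobiExp 0 4 phi04 (toComplex F) ∧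
    PowerSeries.constantCoeff F = 3 + uPoly ℤ := by
  obtain ⟨ψ, G, hG, hψ⟩ := jacobiExp_thetaTriple.eq_phiNeg_mul
  have hφ : phi04 = ψ := by
    funext τ z
    have hc := (hG.hasExp.differentiable τ).continuous
    refine thetaQuotient_eq hc (fun w => ?_) z
    refine eq_of_mul_theta_eq (g := fun w => theta τ ((3 : ℕ) * w))
      (h := fun w => ψ τ w * theta τ w) ?_ (hc.mul (differentiable_theta τ).continuous) τ
      (fun w => ?_) w
    · exact (differentiable_theta τ).continuous.comp (continuous_const.mul continuous_id)
    · have h := hψ τ w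
      rw [phiNeg] at h
      have h0 := pow_ne_zero 6 (inv_ne_zero (eta_ne_zero' τ))
      refine mul_right_cancel₀ h0 ?_
      push_cast
      linear_combination h
  have h1 : (fun τ z => theta τ (3 * z) * theta τ z * (ModularForm.eta τ)⁻¹ ^ 6) = phiNeg * ψ :=
    funext fun τ => funext fun z => hψ τ z
  have h2 := hasExp_phiNeg.mul hG.hasExp
  rw [← h1] at h2
  have h3 := jacobiExp_thetaTriple.hasExp.unique h2
  obtain ⟨F, rfl⟩ := saturated_phiNegFormal G ⟨_, h3⟩
  refine ⟨F, hφ ▸ hG, ?_⟩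
  rw [← map_mul] at h3
  have h4 := congrArg PowerSeries.constantCoeff (toComplex_injective h3)
  rw [constantCoeff_thetaTripleFormal, map_mul, constantCoeff_phiNegFormal] at h4
  refine (mul_left_cancel₀ ?_ h4).symm
  intro h
  have := congrArg (fun P : ℤ[T;T⁻¹] => P.coeff 1) h
  rw [uPoly, ← map_ofNat (C : ℤ →+* ℤ[T;T⁻¹])] at this
  simp [AddMonoidAlgebra.coeff_sub, AddMonoidAlgebra.coeff_add] at this

/-! ### Relations between the generators -/

lemma constantCoeff_qExpansion_E {k : ℕ} (hk : 3 ≤ k) (hk2 : Even k) :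
    PowerSeries.constantCoeff (qExpansion 1 (ModularForm.E hk)) = 1 := by
  rw [← PowerSeries.coeff_zero_eq_constantCoeff_apply]
  exact EisensteinSeries.E_qExpansion_coeff_zero hk hk2

/-- Index 2 is below 6, so it suffices to compare q^0-terms: 24(6 + u) = (12 + u)² - u². The next
two relations are obtained in the same way. -/
lemma phi02_relation (τ : ℍ) (z : ℂ) : 24 * phi02 τ z =
    phi01 τ z ^ 2 - ModularForm.E₄ τ * phiNeg τ z ^ 2 := by
  have h1 := ((jacobiExp_phi01.pow 2).congr (k' := 0) (m' := 2) (by norm_num) (by norm_num)).add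
    ((((JacobiExp.modularForm ModularForm.E₄).mul (jacobiExp_phiNeg.pow 2)).congr
      (k' := 0) (m' := 2) (by norm_num) (by norm_num)).const_mul (-1))
  have h2 := IsWeakJacobiForm.eq_of_constantCoeff_eq (by norm_num) (jacobiExp_phi02.const_mul 24) h1
    (by
      simp only [map_add, map_mul, map_pow, map_neg, map_one, constantCoeff_toComplex,
        constantCoeff_map, constantCoeff_phi02Formal,
        constantCoeff_phi01Formal, constantCoeff_phiNegFormal, mapRingHom_uPoly, map_ofNat,
        ModularForm.E₄, constantCoeff_qExpansion_E _ (by decide : Even 4)]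
      ring)
  have h3 := congrFun (congrFun h2 τ) z
  simp only [Pi.add_apply, Pi.mul_apply, Pi.pow_apply] at h3
  linear_combination h3

lemma phi03_relation (τ : ℍ) (z : ℂ) : 432 * phi03 τ z =
    phi01 τ z ^ 3 - 3 * ModularForm.E₄ τ * phiNeg τ z ^ 2 * phi01 τ z +
      2 * ModularForm.E₆ τ * phiNeg τ z ^ 3 := by
  have h1 := (((jacobiExp_phi01.pow 3).congr (k' := 0) (m' := 3) (by norm_num) (by norm_num)).add
    (((((JacobiExp.modularForm ModularForm.E₄).mul (jacobiExp_phiNeg.pow 2)).mul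
      jacobiExp_phi01).congr (k' := 0) (m' := 3) (by norm_num) (by norm_num)).const_mul (-3))).add
    ((((JacobiExp.modularForm ModularForm.E₆).mul (jacobiExp_phiNeg.pow 3)).congr
      (k' := 0) (m' := 3) (by norm_num) (by norm_num)).const_mul 2)
  have h2 := IsWeakJacobiForm.eq_of_constantCoeff_eq (by norm_num)
    (jacobiExp_phi03.const_mul 432) h1 (by
      simp only [map_add, map_mul, map_pow, map_neg, map_one, constantCoeff_toComplex,
        constantCoeff_map, constantCoeff_phi03Formal,
        constantCoeff_phi01Formal, constantCoeff_phiNegFormal, mapRingHom_uPoly, map_ofNat,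
        ModularForm.E₄, constantCoeff_qExpansion_E _ (by decide : Even 4),
        ModularForm.E₆, constantCoeff_qExpansion_E _ (by decide : Even 6)]
      ring)
  have h3 := congrFun (congrFun h2 τ) z
  simp only [Pi.add_apply, Pi.mul_apply, Pi.pow_apply] at h3
  linear_combination h3

lemma phi04_relation (τ : ℍ) (z : ℂ) :
    4 * phi04 τ z = phi01 τ z * phi03 τ z - phi02 τ z ^ 2 := by
  obtain ⟨F, hF, hF0⟩ := exists_jacobiExp_phi04
  have h1 := (jacobiExp_phi01.mul jacobiExp_phi03).congr (k' := 0) (m' := 4) (by norm_num)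
    (by norm_num)
  have h2 := IsWeakJacobiForm.eq_of_constantCoeff_eq (by norm_num) (hF.const_mul 4)
    (h1.add (((jacobiExp_phi02.pow 2).congr (k' := 0) (m' := 4) (by norm_num)
      (by norm_num)).const_mul (-1))) (by
      simp only [map_add, map_mul, map_pow, map_neg, map_one, constantCoeff_toComplex, hF0, constantCoeff_phi03Formal, constantCoeff_phi02Formal,
        constantCoeff_phi01Formal, mapRingHom_uPoly, map_ofNat]
      ring)
  have h3 := congrFun (congrFun h2 τ) z
  simp only [Pi.add_apply, Pi.mul_apply, Pi.pow_apply] at h3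
  linear_combination h3

/-- In index 6 the q^0-term no longer determines a form; instead the previous relations are
substituted and E₄³ - E₆² = 1728 Δ is used. -/
lemma discriminant_mul_phiNeg_pow (τ : ℍ) (z : ℂ) :
    ModularForm.discriminant τ * phiNeg τ z ^ 6 =
      9 * (phi01 τ z * phi02 τ z * phi03 τ z) - phi01 τ z ^ 2 * phi04 τ z - 8 * phi02 τ z ^ 3 -
        27 * phi03 τ z ^ 2 := by
  have h2 : phi02 τ z = (phi01 τ z ^ 2 - ModularForm.E₄ τ * phiNeg τ z ^ 2) / 24 := by
    linear_combination phi02_relation τ z / 24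
  have h3 : phi03 τ z = (phi01 τ z ^ 3 - 3 * ModularForm.E₄ τ * phiNeg τ z ^ 2 * phi01 τ z +
      2 * ModularForm.E₆ τ * phiNeg τ z ^ 3) / 432 := by
    linear_combination phi03_relation τ z / 432
  have h4 : phi04 τ z = (phi01 τ z * phi03 τ z - phi02 τ z ^ 2) / 4 := by
    linear_combination phi04_relation τ z / 4
  rw [ModularForm.discriminant_eq_E₄_cube_sub_E₆_sq, h4, h3, h2]
  ring

/-! ### Integral polynomials in `y - 2 + y⁻¹` -/

lemma coeff_uPoly_mul {R : Type*} [CommRing R] (P : R[T;T⁻¹]) (l : ℤ) :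
    (uPoly R * P).coeff l = P.coeff (l - 1) - 2 * P.coeff l + P.coeff (l + 1) := by
  have h : uPoly R * P = C 1 * T 1 * P - C 2 * T 0 * P + C 1 * T (-1) * P := by
    rw [uPoly, map_one, T_zero, map_ofNat]
    ring
  rw [h, AddMonoidAlgebra.coeff_add, AddMonoidAlgebra.coeff_sub, Finsupp.add_apply,
    Finsupp.sub_apply, coeff_T_mul, coeff_T_mul, coeff_T_mul, sub_zero, sub_neg_eq_add, one_mul,
    one_mul]

lemma coeff_uPoly_pow_of_lt {R : Type*} [CommRing R] (n : ℕ) {l : ℤ} (h : (n : ℤ) < |l|) :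
    (uPoly R ^ n).coeff l = 0 := by
  induction n generalizing l with
  | zero =>
    rw [pow_zero, ← T_zero, T_coeff, if_neg]
    rintro rfl
    simp at h
  | succ n ih =>
    push_cast at h
    rw [pow_succ', coeff_uPoly_mul, ih, ih, ih]
    · ring
    all_goals rcases abs_cases l with h1 | h1 <;> rw [lt_abs] <;> omega

lemma coeff_uPoly_pow_self {R : Type*} [CommRing R] (n : ℕ) :
    (uPoly R ^ n).coeff n = 1 := by
  induction n with
  | zero => rw [pow_zero, ← T_zero, T_coeff, if_pos (by simp)]
  | succ n ih =>
    rw [pow_succ', coeff_uPoly_mul, coeff_uPoly_pow_of_lt (l := ((n + 1 : ℕ) : ℤ)),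
      coeff_uPoly_pow_of_lt (l := ((n + 1 : ℕ) : ℤ) + 1)]
    · push_cast
      rw [add_sub_cancel_right, ih]
      ring
    all_goals push_cast; rw [lt_abs]; omega

lemma coeff_uPoly_pow_neg {R : Type*} [CommRing R] (n : ℕ) :
    (uPoly R ^ n).coeff (-n) = 1 := by
  induction n with
  | zero => rw [pow_zero, ← T_zero, T_coeff, if_pos (by simp)]
  | succ n ih =>
    rw [pow_succ', coeff_uPoly_mul, coeff_uPoly_pow_of_lt, coeff_uPoly_pow_of_lt]
    · push_cast
      rw [neg_add, neg_add_cancel_right, ih]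
      ring
    all_goals push_cast; rw [lt_abs]; omega

lemma laurentToComplex_aeval (p : Polynomial ℤ) : laurentToComplex (Polynomial.aeval (uPoly ℤ) p) =
    Polynomial.aeval (uPoly ℂ) (p.map (Int.castRingHom ℂ)) := by
  rw [Polynomial.aeval_def, Polynomial.hom_eval₂, mapRingHom_uPoly, Polynomial.aeval_def,
    Polynomial.eval₂_map]
  congr 1
  exact RingHom.ext_int _ _

lemma aeval_uPoly_int_injective : Function.Injective (Polynomial.aeval (R := ℤ) (uPoly ℤ)) := by
  intro p q h
  have h1 := congrArg laurentToComplex h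
  rw [laurentToComplex_aeval, laurentToComplex_aeval] at h1
  exact Polynomial.map_injective _ (Int.cast_injective) (aeval_uPoly_injective h1)

lemma coeff_aeval_uPoly {p : Polynomial ℂ} {d : ℕ} (hp : p.natDegree ≤ d) :
    (Polynomial.aeval (uPoly ℂ) p).coeff d = p.coeff d := by
  rw [Polynomial.aeval_eq_sum_range' (Nat.lt_succ_of_le hp), Finset.sum_range_succ,
    AddMonoidAlgebra.coeff_add, Finsupp.add_apply, AddMonoidAlgebra.coeff_smul, Finsupp.smul_apply,
    coeff_uPoly_pow_self, AddMonoidAlgebra.coeff_sum, Finsupp.finsetSum_apply,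
    Finset.sum_eq_zero, zero_add, smul_eq_mul, mul_one]
  intro i hi
  rw [AddMonoidAlgebra.coeff_smul, Finsupp.smul_apply, coeff_uPoly_pow_of_lt, smul_zero]
  have := Finset.mem_range.mp hi
  rw [lt_abs]
  omega

/-- The coefficient of X^d is the coefficient of y^d in p(u), hence an integer; the leading term is
removed and the degree drops. -/
lemma exists_int_polynomial {d : ℕ} {p : Polynomial ℂ} (hp : p.natDegree ≤ d)
    (h : Polynomial.aeval (uPoly ℂ) p ∈ laurentToComplex.range) :
    ∃ q : Polynomial ℤ, q.map (Int.castRingHom ℂ) = p := by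
  induction d generalizing p with
  | zero =>
    obtain ⟨n, hn⟩ := mem_range_laurentToComplex.mp h ((0 : ℕ) : ℤ)
    rw [coeff_aeval_uPoly hp] at hn
    rw [Polynomial.eq_C_of_natDegree_le_zero hp, hn]
    exact ⟨Polynomial.C n, by simp⟩
  | succ d ih =>
    obtain ⟨n, hn⟩ := mem_range_laurentToComplex.mp h ((d + 1 : ℕ) : ℤ)
    rw [coeff_aeval_uPoly hp] at hn
    obtain ⟨q, hq⟩ := ih (p := p - (Polynomial.C n * Polynomial.X ^ (d + 1)).map
        (Int.castRingHom ℂ)) (by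
        rw [Polynomial.natDegree_le_iff_coeff_eq_zero] at hp ⊢
        intro N hN
        rcases (Nat.succ_le_of_lt hN).eq_or_lt with h1 | h1
        · subst h1
          simp [hn]
        · rw [Polynomial.coeff_sub, hp N h1]
          simp [Polynomial.coeff_X_pow, (show N ≠ d + 1 by omega)]) (by
        rw [map_sub, ← laurentToComplex_aeval]
        exact sub_mem h ⟨_, rfl⟩)
    exact ⟨q + Polynomial.C n * Polynomial.X ^ (d + 1), by
      rw [Polynomial.map_add, hq, sub_add_cancel]⟩

lemma natDegree_twistedPoly_le (m : ℕ) (a : ℕ → ℂ) : (twistedPoly m a).natDegree ≤ m := by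
  refine Polynomial.natDegree_sum_le_of_forall_le _ _ fun j hj => ?_
  have hj' := Finset.mem_range_succ_iff.mp hj
  refine (Polynomial.natDegree_C_mul_le _ _).trans (Polynomial.natDegree_mul_le_of_le
    (n := m - j) (m := j) (Polynomial.natDegree_X_pow_le _) ?_ |>.trans (by omega))
  have h1 : (12 + Polynomial.X : Polynomial ℂ).natDegree ≤ 1 := by compute_degree
  exact (Polynomial.natDegree_pow_le_of_le (m - j) h1).trans (by omega)

/-- Only j = 0 contributes to the two lowest coefficients once `a 1 = 0`, and (12 + X)^m has
logarithmic derivative m/12 at 0. -/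
lemma coeff_twistedPoly (m : ℕ) {a : ℕ → ℂ} (ha : a 1 = 0) :
    m * (twistedPoly m a).coeff 0 = 12 * (twistedPoly m a).coeff 1 := by
  rw [twistedPoly, Polynomial.finsetSum_coeff, Polynomial.finsetSum_coeff, Finset.mul_sum,
    Finset.mul_sum]
  refine Finset.sum_congr rfl fun j _ => ?_
  rw [Polynomial.coeff_C_mul, Polynomial.coeff_C_mul, Polynomial.coeff_X_pow_mul',
    Polynomial.coeff_X_pow_mul']
  rcases j with _ | _ | j
  · have e : (12 + Polynomial.X : Polynomial ℂ) = Polynomial.X + Polynomial.C 12 := by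
      rw [map_ofNat, add_comm]
    simp only [Nat.sub_zero, zero_le, if_true, e, Polynomial.coeff_X_add_C_pow,
      Nat.choose_zero_right, Nat.choose_one_right, Nat.cast_one, mul_one]
    rcases m with _ | m
    · simp
    · rw [Nat.add_sub_cancel, pow_succ]
      ring
  · simp [ha]
  · rw [if_neg (by omega), if_neg (by omega)]
    simp

/-- The `q ^ 0`-term of an integral form of weight `0` and index `m`. -/
lemma JZ.exists_polynomial {m : ℕ} {φ : ℍ → ℂ → ℂ} (h : φ ∈ JZ m) {F : FormalExp ℤ}
    (hF : HasExp φ (toComplex F)) : ∃ p : Polynomial ℤ, p.natDegree ≤ m ∧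
      m * p.coeff 0 = 12 * p.coeff 1 ∧
        PowerSeries.constantCoeff F = Polynomial.aeval (uPoly ℤ) p := by
  obtain ⟨a, ha, h1⟩ := h.1.constantCoeff_eq hF
  rw [constantCoeff_toComplex] at h1
  obtain ⟨p, hp⟩ := exists_int_polynomial (natDegree_twistedPoly_le m a) ⟨_, h1⟩
  have h2 := natDegree_twistedPoly_le m a
  have h3 := coeff_twistedPoly m ha
  rw [← hp] at h1 h2 h3
  rw [← laurentToComplex_aeval] at h1
  refine ⟨p, by rwa [Polynomial.natDegree_map_eq_of_injective Int.cast_injective] at h2, ?_, ?_⟩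
  · simp only [Polynomial.coeff_map, eq_intCast] at h3
    exact_mod_cast h3
  · refine LaurentPolynomial.ext fun l => ?_
    have := congrArg (fun P => P.coeff l) h1
    simpa using this

/-! ### Generation of the possible `q ^ 0`-terms -/

section Generation

open Polynomial

lemma eq_lin_add_sum {m : ℕ} {p : ℤ[X]} (hp : p.natDegree ≤ m) :
    p = (Polynomial.C (p.coeff 0) + Polynomial.C (p.coeff 1) * X) +
      ∑ n ∈ Finset.Icc 2 m, p.coeff n • X ^ n := by
  ext k
  simp only [coeff_add, coeff_C_mul, finsetSum_coeff, coeff_smul, coeff_X_pow, smul_eq_mul,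
    mul_ite, mul_one, mul_zero, Finset.sum_ite_eq, Finset.mem_Icc, coeff_C, coeff_X]
  rcases k with _ | _ | k
  · simp
  · simp
  · by_cases hk : k + 2 ≤ m
    · simp [hk]
    · simp [hk, coeff_eq_zero_of_natDegree_lt (lt_of_le_of_lt hp (not_le.mp hk))]

lemma exists_eq_mul_of_mul_eq {m : ℕ} {a b : ℤ} (h : m * a = 12 * b) :
    ∃ t : ℤ, a = t * (12 / Nat.gcd 12 m : ℕ) ∧ b = t * (m / Nat.gcd 12 m : ℕ) := by
  have hg : 0 < Nat.gcd 12 m := Nat.gcd_pos_of_pos_left _ (by norm_num)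
  have hc := Nat.coprime_div_gcd_div_gcd hg
  obtain ⟨u, hu⟩ := Nat.gcd_dvd_left 12 m
  obtain ⟨v, hv⟩ := Nat.gcd_dvd_right 12 m
  set g := Nat.gcd 12 m
  have hu' : 12 / g = u := by rw [hu, Nat.mul_div_cancel_left _ hg]
  have hv' : m / g = v := by rw [hv, Nat.mul_div_cancel_left _ hg]
  rw [hu', hv'] at hc ⊢
  have h1 : (v : ℤ) * a = u * b := by
    have hu2 : (12 : ℤ) = g * u := by exact_mod_cast hu
    have hv2 : (m : ℤ) = g * v := by exact_mod_cast hv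
    rw [hu2, hv2] at h
    refine mul_left_cancel₀ (Int.natCast_ne_zero.mpr hg.ne') ?_
    linear_combination h
  obtain ⟨t, ht⟩ : (u : ℤ) ∣ a :=
    IsCoprime.dvd_of_dvd_mul_left (Nat.isCoprime_iff_coprime.mpr hc) ⟨b, h1⟩
  have hu0 : (u : ℤ) ≠ 0 := by
    rintro h0
    rw [Int.natCast_eq_zero.mp h0] at hu
    simp at hu
  refine ⟨t, by rw [ht, mul_comm], mul_left_cancel₀ hu0 ?_⟩
  rw [← h1, ht]
  ring

variable {L : ℕ → AddSubgroup ℤ[X]}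

/-- Four explicit combinations settle degrees 2 to 5. From there on (4 + X) - (3 + X) = 1, where the
factors have degrees 3 and 4 and multiply X² from two consecutive lower degrees. -/
lemma sq_mem_of_generators (hmul : ∀ i j p q, p ∈ L i → q ∈ L j → p * q ∈ L (i + j))
    (ha : 12 + X ∈ L 1) (hb : 6 + X ∈ L 2) (hc : 4 + X ∈ L 3) (hd : 3 + X ∈ L 4) (m : ℕ) :
    X ^ 2 ∈ L (m + 2) := by
  induction m using Nat.strong_induction_on with
  | _ m ih =>
  have hab := hmul _ _ _ _ ha hb
  have hac := hmul _ _ _ _ ha hc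
  have hbc := hmul _ _ _ _ hb hc
  have had := hmul _ _ _ _ ha hd
  match m with
  | 0 =>
    have h := sub_mem (hmul _ _ _ _ ha ha) (zsmul_mem hb 24)
    convert h using 1
    rw [zsmul_eq_mul]; push_cast; ring
  | 1 =>
    have h := sub_mem hab (zsmul_mem hc 18)
    convert h using 1
    rw [zsmul_eq_mul]; push_cast; ring
  | 2 =>
    have h := sub_mem hac (zsmul_mem hd 16)
    convert h using 1
    rw [zsmul_eq_mul]; push_cast; ring
  | 3 =>
    have h := sub_mem hbc (zsmul_mem (sub_mem had hbc) 2)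
    convert h using 1
    rw [zsmul_eq_mul]; push_cast; ring
  | k + 4 =>
    have h := sub_mem (hmul (k + 3) 3 _ _ (ih (k + 1) (by omega)) hc)
      (hmul (k + 2) 4 _ _ (ih k (by omega)) hd)
    convert h using 1
    ring

lemma pow_mem_of_generators (hmul : ∀ i j p q, p ∈ L i → q ∈ L j → p * q ∈ L (i + j))
    (ha : 12 + X ∈ L 1) (hsq : ∀ m, X ^ 2 ∈ L (m + 2)) (n : ℕ) :
    ∀ m, X ^ (n + 2) ∈ L (m + (n + 2)) := by
  induction n using Nat.twoStepInduction with
  | zero => exact hsq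
  | one =>
    intro m
    have h := sub_mem (hmul _ _ _ _ (hsq m) ha) (zsmul_mem (hsq (m + 1)) 12)
    convert h using 1
    rw [zsmul_eq_mul]; push_cast; ring
  | more n ih _ =>
    intro m
    have h := hmul _ _ _ _ (ih m) (hsq 0)
    rwa [← pow_add, zero_add, add_assoc] at h

/-- As X² is available in every degree from 2 on, products may be computed modulo X². A table up to
degree 12 is built by hand and continued with period 12. -/
lemma lin_mem_of_generators (hmul : ∀ i j p q, p ∈ L i → q ∈ L j → p * q ∈ L (i + j))
    (ha : 12 + X ∈ L 1) (hb : 6 + X ∈ L 2) (hc : 4 + X ∈ L 3) (hd : 3 + X ∈ L 4)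
    (hsq : ∀ m, X ^ 2 ∈ L (m + 2)) (m : ℕ) (hm : 1 ≤ m) :
    Polynomial.C ((12 / Nat.gcd 12 m : ℕ) : ℤ) + Polynomial.C ((m / Nat.gcd 12 m : ℕ) : ℤ) * X
      ∈ L m := by
  have hprod : ∀ {i j k : ℕ} {a b c d : ℤ} (e f : ℤ), i + j = k → 2 ≤ k →
      Polynomial.C a + Polynomial.C b * X ∈ L i → Polynomial.C c + Polynomial.C d * X ∈ L j →
      a * c = e → a * d + b * c = f → Polynomial.C e + Polynomial.C f * X ∈ L k := by
    rintro i j k a b c d _ _ rfl hk h1 h2 rfl rfl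
    obtain ⟨n, hn⟩ := Nat.exists_eq_add_of_le' hk
    have h3 := hsq n
    rw [← hn] at h3
    have h := sub_mem (hmul _ _ _ _ h1 h2) (zsmul_mem h3 (b * d))
    convert h using 1
    rw [zsmul_eq_mul]
    simp only [map_mul, map_add, eq_intCast, Int.cast_mul]
    ring
  have hcomb : ∀ {i : ℕ} (s : ℤ) {a b c d : ℤ} (e f : ℤ),
      Polynomial.C a + Polynomial.C b * X ∈ L i → Polynomial.C c + Polynomial.C d * X ∈ L i →
      a - s * c = e → b - s * d = f → Polynomial.C e + Polynomial.C f * X ∈ L i := by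
    rintro i s a b c d _ _ h1 h2 rfl rfl
    have h := sub_mem h1 (zsmul_mem h2 s)
    convert h using 1
    rw [zsmul_eq_mul]
    simp only [map_mul, map_sub, eq_intCast]
    ring
  -- In degree m the target is (12 + mX)/(12, m); where a single product is not primitive, two
  -- products are combined to reduce the content.
  have e1 : Polynomial.C 12 + Polynomial.C 1 * X ∈ L 1 := by simpa using ha
  have e2 : Polynomial.C 6 + Polynomial.C 1 * X ∈ L 2 := by simpa using hb
  have e3 : Polynomial.C 4 + Polynomial.C 1 * X ∈ L 3 := by simpa using hc
  have e4 : Polynomial.C 3 + Polynomial.C 1 * X ∈ L 4 := by simpa using hd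
  have e5 : Polynomial.C 12 + Polynomial.C 5 * X ∈ L 5 := 
    hcomb 1 12 5 (hprod 36 15 (k := 5) rfl (by norm_num) e1 e4 rfl rfl)
      (hprod 24 10 (k := 5) rfl (by norm_num) e2 e3 rfl rfl) rfl rfl
  have e6 : Polynomial.C 2 + Polynomial.C 1 * X ∈ L 6 := 
    hcomb 1 2 1 (hprod 18 9 (k := 6) rfl (by norm_num) e2 e4 rfl rfl)
      (hprod 16 8 (k := 6) rfl (by norm_num) e3 e3 rfl rfl) rfl rfl
  have e7 : Polynomial.C 12 + Polynomial.C 7 * X ∈ L 7 := hprod 12 7 (k := 7) rfl (by norm_num) e3 e4 rfl rfl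
  have e8 : Polynomial.C 3 + Polynomial.C 2 * X ∈ L 8 := 
    hcomb 1 3 2 (hprod 12 8 (k := 8) rfl (by norm_num) e6 e2 rfl rfl)
      (hprod 9 6 (k := 8) rfl (by norm_num) e4 e4 rfl rfl) rfl rfl
  have e9 : Polynomial.C 4 + Polynomial.C 3 * X ∈ L 9 := 
    hcomb 4 4 3 (hprod 36 27 (k := 9) rfl (by norm_num) e5 e4 rfl rfl)
      (hprod 8 6 (k := 9) rfl (by norm_num) e6 e3 rfl rfl) rfl rfl
  have e10 : Polynomial.C 6 + Polynomial.C 5 * X ∈ L 10 := hprod 6 5 (k := 10) rfl (by norm_num) e6 e4 rfl rfl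
  have e11 : Polynomial.C 12 + Polynomial.C 11 * X ∈ L 11 := 
    hcomb 1 12 11 (hprod 36 33 (k := 11) rfl (by norm_num) e7 e4 rfl rfl)
      (hprod 24 22 (k := 11) rfl (by norm_num) e6 e5 rfl rfl) rfl rfl
  have e12 : Polynomial.C 1 + Polynomial.C 1 * X ∈ L 12 := 
    hcomb 2 1 1 (hprod 9 9 (k := 12) rfl (by norm_num) e8 e4 rfl rfl)
      (hprod 4 4 (k := 12) rfl (by norm_num) e6 e6 rfl rfl) rfl rfl
  induction m using Nat.strong_induction_on with
  | _ m ih =>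
  -- Multiplication by 1 + X of degree 12 sends a + bX to a + (a + b)X modulo X², which matches m ↦
  -- m + 12 with unchanged greatest common divisor.
  rcases lt_or_ge 12 m with h12 | h12
  · obtain ⟨n, rfl⟩ := Nat.exists_eq_add_of_le' h12.le
    have hg : Nat.gcd 12 (n + 12) = Nat.gcd 12 n := by simp
    have hdiv : (n + 12) / Nat.gcd 12 n = n / Nat.gcd 12 n + 12 / Nat.gcd 12 n :=
      Nat.add_div_of_dvd_left (Nat.gcd_dvd_left 12 n)
    rw [hg, hdiv, Nat.cast_add]
    exact hprod _ _ rfl (by omega) (ih n (by omega) (by omega)) e12 (mul_one _)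
      (by ring)
  · interval_cases m <;> assumption

/-- The polynomials `12 + X`, `6 + X`, `4 + X`, `3 + X` in degrees `1`, `2`, `3`, `4` generate all
possible `q ^ 0`-terms. -/
theorem mem_of_generators (hone : 1 ∈ L 0)
    (hmul : ∀ i j p q, p ∈ L i → q ∈ L j → p * q ∈ L (i + j))
    (ha : 12 + X ∈ L 1) (hb : 6 + X ∈ L 2) (hc : 4 + X ∈ L 3) (hd : 3 + X ∈ L 4) {m : ℕ}
    {p : ℤ[X]} (hp : p.natDegree ≤ m) (h : m * p.coeff 0 = 12 * p.coeff 1) : p ∈ L m := by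
  have hsq := sq_mem_of_generators hmul ha hb hc hd
  rcases Nat.eq_zero_or_pos m with rfl | hm
  · rw [eq_C_of_natDegree_le_zero hp]
    simpa using zsmul_mem hone (p.coeff 0)
  · rw [eq_lin_add_sum hp]
    refine add_mem ?_ (sum_mem fun n hn => zsmul_mem ?_ _)
    · obtain ⟨t, h0, h1⟩ := exists_eq_mul_of_mul_eq h
      rw [h0, h1]
      have := zsmul_mem (lin_mem_of_generators hmul ha hb hc hd hsq m hm) t
      convert this using 1
      rw [zsmul_eq_mul]
      simp only [map_mul, eq_intCast]
      ring
    · obtain ⟨h2, h3⟩ := Finset.mem_Icc.mp hn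
      obtain ⟨k, rfl⟩ := Nat.exists_eq_add_of_le' h2
      obtain ⟨i, rfl⟩ := Nat.exists_eq_add_of_le' h3
      exact pow_mem_of_generators hmul ha hsq k i

end Generation

/-! ### The graded ring of integral forms -/

/-- `φ` has integral coefficients and `q ^ 0`-term `p (y - 2 + y⁻¹)`. -/
def HasQPoly (φ : ℍ → ℂ → ℂ) (p : Polynomial ℤ) : Prop :=
  ∃ F : FormalExp ℤ, HasExp φ (toComplex F) ∧
    PowerSeries.constantCoeff F = Polynomial.aeval (uPoly ℤ) p

lemma HasQPoly.unique {φ : ℍ → ℂ → ℂ} {p q : Polynomial ℤ} (hp : HasQPoly φ p)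
    (hq : HasQPoly φ q) : p = q := by
  obtain ⟨F, hF, hp⟩ := hp
  obtain ⟨G, hG, hq⟩ := hq
  rw [toComplex_injective (hF.unique hG)] at hp
  exact aeval_uPoly_int_injective (hp.symm.trans hq)

lemma HasQPoly.add {φ ψ : ℍ → ℂ → ℂ} {p q : Polynomial ℤ} (hp : HasQPoly φ p)
    (hq : HasQPoly ψ q) : HasQPoly (φ + ψ) (p + q) := by
  obtain ⟨F, hF, hp⟩ := hp
  obtain ⟨G, hG, hq⟩ := hq
  exact ⟨F + G, by rw [map_add]; exact hF.add hG, by rw [map_add, map_add, hp, hq]⟩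

lemma HasQPoly.mul {φ ψ : ℍ → ℂ → ℂ} {p q : Polynomial ℤ} (hp : HasQPoly φ p)
    (hq : HasQPoly ψ q) : HasQPoly (φ * ψ) (p * q) := by
  obtain ⟨F, hF, hp⟩ := hp
  obtain ⟨G, hG, hq⟩ := hq
  exact ⟨F * G, by rw [map_mul]; exact hF.mul hG, by rw [map_mul, map_mul, hp, hq]⟩

lemma HasQPoly.one : HasQPoly 1 1 :=
  ⟨1, by rw [map_one]; exact HasExp.one, by rw [map_one, map_one]⟩

lemma HasQPoly.hasQZeroTerm {φ : ℍ → ℂ → ℂ} {p : Polynomial ℤ} (h : HasQPoly φ p) :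
    HasQZeroTerm φ (Polynomial.aeval (uPoly ℂ) (p.map (Int.castRingHom ℂ))) := by
  obtain ⟨F, hF, hp⟩ := h
  refine ⟨_, hF, fun l => ?_⟩
  rw [← laurentToComplex_aeval, ← hp, ← constantCoeff_coeff, constantCoeff_toComplex]

lemma HasExp.constantCoeff_eq {φ : ℍ → ℂ → ℂ} {F : FormalExp ℂ} (h : HasExp φ F)
    {P : ℂ[T;T⁻¹]} (hP : HasQZeroTerm φ P) : PowerSeries.constantCoeff F = P := by
  obtain ⟨f, hf, hP⟩ := hP
  refine LaurentPolynomial.ext fun l => ?_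
  rw [constantCoeff_coeff, ← hP, HasFourierExpansion.unique hf h]

lemma JZ.exists_hasQPoly {m : ℕ} (x : JZ m) : ∃ p : Polynomial ℤ, HasQPoly x p ∧
    p.natDegree ≤ m ∧ m * p.coeff 0 = 12 * p.coeff 1 := by
  obtain ⟨F, hF⟩ := hasIntegralCoeffs_iff.mp x.2.2
  obtain ⟨p, h1, h2, h3⟩ := JZ.exists_polynomial x.2 hF
  exact ⟨p, ⟨F, hF, h3⟩, h1, h2⟩

/-- The `q ^ 0`-term of an integral form, as a polynomial in `y - 2 + y⁻¹`. -/
noncomputable def qPoly (m : ℕ) : JZ m →+ Polynomial ℤ :=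
  AddMonoidHom.mk' (fun x => (JZ.exists_hasQPoly x).choose) fun x y =>
    (JZ.exists_hasQPoly (x + y)).choose_spec.1.unique
      ((JZ.exists_hasQPoly x).choose_spec.1.add (JZ.exists_hasQPoly y).choose_spec.1)

lemma hasQPoly_qPoly {m : ℕ} (x : JZ m) : HasQPoly x (qPoly m x) :=
  (JZ.exists_hasQPoly x).choose_spec.1

lemma natDegree_qPoly_le {m : ℕ} (x : JZ m) : (qPoly m x).natDegree ≤ m :=
  (JZ.exists_hasQPoly x).choose_spec.2.1

lemma coeff_qPoly {m : ℕ} (x : JZ m) : m * (qPoly m x).coeff 0 = 12 * (qPoly m x).coeff 1 :=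
  (JZ.exists_hasQPoly x).choose_spec.2.2

lemma HasQPoly.qPoly_eq {m : ℕ} {x : JZ m} {p : Polynomial ℤ} (h : HasQPoly x p) :
    qPoly m x = p := (hasQPoly_qPoly x).unique h

lemma qPoly_eq_zero_iff {m : ℕ} {x : JZ m} : qPoly m x = 0 ↔ x ∈ JZq m := by
  constructor
  · intro h
    have h1 := (hasQPoly_qPoly x).hasQZeroTerm
    rwa [h, Polynomial.map_zero, map_zero] at h1
  · intro h
    obtain ⟨F, hF, hp⟩ := hasQPoly_qPoly x
    have h1 := hF.constantCoeff_eq h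
    rw [constantCoeff_toComplex, hp, laurentToComplex_aeval,
      ← map_zero (Polynomial.aeval (R := ℂ) (uPoly ℂ))] at h1
    exact Polynomial.map_injective _ Int.cast_injective
      ((aeval_uPoly_injective h1).trans (Polynomial.map_zero _).symm)

lemma of_mul_of_eq {i j k : ℕ} (h : i + j = k) (x : JZ i) (y : JZ j) {z : JZ k}
    (hz : (z : ℍ → ℂ → ℂ) = x * y) : DirectSum.of (fun m => JZ m) i x *
      DirectSum.of (fun m => JZ m) j y = DirectSum.of (fun m => JZ m) k z := by
  subst h
  rw [DirectSum.of_mul_of]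
  congr 1
  exact Subtype.ext hz.symm

lemma JacobiExp.mem_JZ {m : ℕ} {φ : ℍ → ℂ → ℂ} {F : FormalExp ℤ}
    (h : JacobiExp 0 m φ (toComplex F)) : φ ∈ JZ m :=
  ⟨h.isWeakJacobiForm, hasIntegralCoeffs_iff.mpr ⟨F, h.hasExp⟩⟩

lemma phi01_mem : phi01 ∈ JZ 1 := jacobiExp_phi01.mem_JZ

lemma phi02_mem : phi02 ∈ JZ 2 := jacobiExp_phi02.mem_JZ

lemma phi03_mem : phi03 ∈ JZ 3 := jacobiExp_phi03.mem_JZ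

lemma phi04_mem : phi04 ∈ JZ 4 := exists_jacobiExp_phi04.choose_spec.1.mem_JZ

lemma hasQPoly_phi01 : HasQPoly phi01 (12 + Polynomial.X) :=
  ⟨_, hasExp_phi01, by rw [constantCoeff_phi01Formal, map_add, Polynomial.aeval_X, map_ofNat]⟩

lemma hasQPoly_phi02 : HasQPoly phi02 (6 + Polynomial.X) :=
  ⟨_, hasExp_phi02, by rw [constantCoeff_phi02Formal, map_add, Polynomial.aeval_X, map_ofNat]⟩

lemma hasQPoly_phi03 : HasQPoly phi03 (4 + Polynomial.X) :=
  ⟨_, hasExp_phi03, by rw [constantCoeff_phi03Formal, map_add, Polynomial.aeval_X, map_ofNat]⟩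

lemma hasQPoly_phi04 : HasQPoly phi04 (3 + Polynomial.X) := by
  obtain ⟨F, hF, h⟩ := exists_jacobiExp_phi04
  exact ⟨F, hF.hasExp, by rw [h, map_add, Polynomial.aeval_X, map_ofNat]⟩

/-- The forms of index `m` whose class in the graded ring lies in `S`. -/
def formsIn (S : Subring (⨁ m, JZ m)) (m : ℕ) : AddSubgroup (JZ m) :=
  S.toAddSubgroup.comap (DirectSum.of (fun m => JZ m) m)

lemma mem_formsIn {S : Subring (⨁ m, JZ m)} {m : ℕ} {x : JZ m} :
    x ∈ formsIn S m ↔ DirectSum.of (fun m => JZ m) m x ∈ S := Iff.rfl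

lemma mul_mem_formsIn {S : Subring (⨁ m, JZ m)} {i j k : ℕ} (h : i + j = k) {x : JZ i} {y : JZ j}
    (hx : x ∈ formsIn S i) (hy : y ∈ formsIn S j) {z : JZ k}
    (hz : (z : ℍ → ℂ → ℂ) = x * y) : z ∈ formsIn S k := by
  rw [mem_formsIn, ← of_mul_of_eq h x y hz]
  exact S.mul_mem hx hy

section Generators

variable {S : Subring (⨁ m, JZ m)}

lemma exists_mem_formsIn_qPoly (h1 : ⟨phi01, phi01_mem⟩ ∈ formsIn S 1)
    (h2 : ⟨phi02, phi02_mem⟩ ∈ formsIn S 2) (h3 : ⟨phi03, phi03_mem⟩ ∈ formsIn S 3)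
    (h4 : ⟨phi04, phi04_mem⟩ ∈ formsIn S 4) {m : ℕ} {p : Polynomial ℤ}
    (hp : p.natDegree ≤ m) (h : m * p.coeff 0 = 12 * p.coeff 1) :
    ∃ x ∈ formsIn S m, qPoly m x = p := by
  -- The q^0-polynomials of the forms in S make a family closed under graded multiplication, so the
  -- purely polynomial statement applies.
  refine AddSubgroup.mem_map.mp (mem_of_generators (L := fun m => (formsIn S m).map (qPoly m))
    ?_ ?_ ?_ ?_ ?_ ?_ hp h)
  · exact ⟨⟨1, SetLike.GradedOne.one_mem⟩, S.one_mem, HasQPoly.one.qPoly_eq⟩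
  · rintro i j _ _ ⟨x, hx, rfl⟩ ⟨y, hy, rfl⟩
    refine ⟨⟨x * y, SetLike.GradedMul.mul_mem x.2 y.2⟩, mul_mem_formsIn rfl hx hy rfl,
      ((hasQPoly_qPoly x).mul (hasQPoly_qPoly y)).qPoly_eq⟩
  · exact ⟨_, h1, hasQPoly_phi01.qPoly_eq⟩
  · exact ⟨_, h2, hasQPoly_phi02.qPoly_eq⟩
  · exact ⟨_, h3, hasQPoly_phi03.qPoly_eq⟩
  · exact ⟨_, h4, hasQPoly_phi04.qPoly_eq⟩

/-- `Δ φ_{-2,1} ^ 6` is a polynomial in the generators. -/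
lemma exists_mem_formsIn_discPhi (h1 : ⟨phi01, phi01_mem⟩ ∈ formsIn S 1)
    (h2 : ⟨phi02, phi02_mem⟩ ∈ formsIn S 2) (h3 : ⟨phi03, phi03_mem⟩ ∈ formsIn S 3)
    (h4 : ⟨phi04, phi04_mem⟩ ∈ formsIn S 4) : ∃ x ∈ formsIn S 6, ∀ τ z,
      (x : ℍ → ℂ → ℂ) τ z = ModularForm.discriminant τ * phiNeg τ z ^ 6 := by
  have hmul : ∀ {i j : ℕ} {x : JZ i} {y : JZ j}, x ∈ formsIn S i → y ∈ formsIn S j →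
      (⟨x * y, SetLike.GradedMul.mul_mem x.2 y.2⟩ : JZ (i + j)) ∈ formsIn S (i + j) :=
    fun hx hy => mul_mem_formsIn rfl hx hy rfl
  refine ⟨_, sub_mem (sub_mem (sub_mem (zsmul_mem (hmul (hmul h1 h2) h3) 9)
    (hmul (hmul h1 h1) h4)) (zsmul_mem (hmul (hmul h2 h2) h2) 8)) (zsmul_mem (hmul h3 h3) 27),
    fun τ z => ?_⟩
  rw [discriminant_mul_phiNeg_pow]
  simp only [AddSubgroup.coe_sub, AddSubgroup.coe_zsmul, Pi.sub_apply, Pi.smul_apply, Pi.mul_apply]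
  simp only [zsmul_eq_mul]
  push_cast
  ring

/-- Strong induction on the index: an element of S with the same q^0-term is subtracted, and the
difference is Δ φ_{-2,1}^6 times an integral form of index m - 6, or zero when m < 6. -/
theorem formsIn_eq_top (h1 : ⟨phi01, phi01_mem⟩ ∈ formsIn S 1)
    (h2 : ⟨phi02, phi02_mem⟩ ∈ formsIn S 2) (h3 : ⟨phi03, phi03_mem⟩ ∈ formsIn S 3)
    (h4 : ⟨phi04, phi04_mem⟩ ∈ formsIn S 4) (m : ℕ) (x : JZ m) : x ∈ formsIn S m := by
  induction m using Nat.strong_induction_on with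
  | _ m ih =>
  obtain ⟨x', hx', hq⟩ := exists_mem_formsIn_qPoly h1 h2 h3 h4 (natDegree_qPoly_le x)
    (coeff_qPoly x)
  rw [← sub_add_cancel x x']
  refine add_mem ?_ hx'
  obtain ⟨F, hF, hp⟩ := hasQPoly_qPoly (x - x')
  rw [map_sub, hq, sub_self, map_zero] at hp
  rcases JZ.eq_discriminant_mul (x - x').2 hF (by rw [constantCoeff_toComplex, hp, map_zero])
    with ⟨-, h0⟩ | ⟨hm, ψ, hψ, hψ'⟩
  · rw [show x - x' = 0 from Subtype.ext h0]
    exact zero_mem _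
  · obtain ⟨d, hd, hd'⟩ := exists_mem_formsIn_discPhi h1 h2 h3 h4
    refine mul_mem_formsIn (by omega) hd (ih (m - 6) (by omega) ⟨ψ, hψ⟩) ?_
    funext τ z
    rw [hψ', Pi.mul_apply, Pi.mul_apply, hd']

end Generators

/-- With S the whole ring, the membership part is empty and the realisation of all admissible
q^0-terms remains. -/
lemma exists_qPoly_eq {m : ℕ} {p : Polynomial ℤ} (hp : p.natDegree ≤ m)
    (h : m * p.coeff 0 = 12 * p.coeff 1) : ∃ x, qPoly m x = p := by
  obtain ⟨x, -, hx⟩ := exists_mem_formsIn_qPoly (S := ⊤) trivial trivial trivial trivial hp h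
  exact ⟨x, hx⟩

theorem adjoin_generators_eq_top :
    Algebra.adjoin ℤ ({DirectSum.of (fun m => JZ m) 1 ⟨phi01, phi01_mem⟩,
      DirectSum.of (fun m => JZ m) 2 ⟨phi02, phi02_mem⟩,
      DirectSum.of (fun m => JZ m) 3 ⟨phi03, phi03_mem⟩,
      DirectSum.of (fun m => JZ m) 4 ⟨phi04, phi04_mem⟩} : Set (⨁ m, JZ m)) = ⊤ := by
  rw [eq_top_iff]
  rintro x -
  induction x using DirectSum.induction_on with
  | zero => exact zero_mem _
  | of m x =>
    exact formsIn_eq_top (S := (Algebra.adjoin ℤ _).toSubring)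
      (Algebra.subset_adjoin (by simp)) (Algebra.subset_adjoin (by simp))
      (Algebra.subset_adjoin (by simp)) (Algebra.subset_adjoin (by simp)) m x
  | add x y hx hy => exact add_mem hx hy

lemma four_mul_of_phi04 : 4 * DirectSum.of (fun m => JZ m) 4 ⟨phi04, phi04_mem⟩ =
    DirectSum.of (fun m => JZ m) 1 ⟨phi01, phi01_mem⟩ *
      DirectSum.of (fun m => JZ m) 3 ⟨phi03, phi03_mem⟩ -
        DirectSum.of (fun m => JZ m) 2 ⟨phi02, phi02_mem⟩ ^ 2 := by
  rw [pow_two, of_mul_of_eq (k := 4) rfl (z := ⟨phi01 * phi03,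
      SetLike.GradedMul.mul_mem (i := 1) (j := 3) phi01_mem phi03_mem⟩) _ _ rfl,
    of_mul_of_eq (k := 4) rfl (z := ⟨phi02 * phi02,
      SetLike.GradedMul.mul_mem (i := 2) (j := 2) phi02_mem phi02_mem⟩) _ _ rfl, ← map_sub,
    show (4 : ⨁ m, JZ m) = ((4 : ℕ) : ⨁ m, JZ m) by norm_num, ← nsmul_eq_mul, ← map_nsmul]
  congr 1
  refine Subtype.ext ?_
  funext τ z
  have h := phi04_relation τ z
  simp only [AddSubgroup.coe_sub, AddSubgroup.coe_nsmul, Pi.sub_apply, Pi.smul_apply, Pi.mul_apply,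
    nsmul_eq_mul]
  push_cast
  linear_combination h

/-! ### The basis of the possible `q ^ 0`-terms -/

/-- The polynomial giving the `n`-th possible `q ^ 0`-term in index `m`. -/
noncomputable def basisPoly (m n : ℕ) : Polynomial ℤ :=
  if n = 1 then Polynomial.C ((12 / Nat.gcd 12 m : ℕ) : ℤ) +
    Polynomial.C ((m / Nat.gcd 12 m : ℕ) : ℤ) * Polynomial.X
  else Polynomial.X ^ n

lemma exists_qPoly_eq_basisPoly {m n : ℕ} (hn : 1 ≤ n) (hnm : n ≤ m) :
    ∃ x, qPoly m x = basisPoly m n := by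
  refine exists_qPoly_eq ?_ ?_
  · rw [basisPoly]
    split_ifs with h
    · have : (Polynomial.C ((12 / Nat.gcd 12 m : ℕ) : ℤ) +
        Polynomial.C ((m / Nat.gcd 12 m : ℕ) : ℤ) * Polynomial.X).natDegree ≤ 1 := by
        compute_degree
      omega
    · exact (Polynomial.natDegree_X_pow_le n).trans hnm
  · rw [basisPoly]
    split_ifs with h
    · have e : m * (12 / Nat.gcd 12 m) = 12 * (m / Nat.gcd 12 m) := by
        rw [← Nat.mul_div_assoc _ (Nat.gcd_dvd_left 12 m),
          ← Nat.mul_div_assoc _ (Nat.gcd_dvd_right 12 m), mul_comm]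
      simp only [Polynomial.coeff_add, Polynomial.coeff_C_zero, Polynomial.coeff_C_mul,
        Polynomial.coeff_X_zero, Polynomial.coeff_X_one, Polynomial.coeff_C_succ, mul_zero,
        mul_one, add_zero, zero_add]
      exact_mod_cast e
    · rw [Polynomial.coeff_X_pow, Polynomial.coeff_X_pow, if_neg (by omega), if_neg (by omega)]
      simp

/-- A form with `q ^ 0`-term `basisPoly m n`. -/
noncomputable def basisForm (m n : ℕ) : JZ m :=
  if h : 1 ≤ n ∧ n ≤ m then (exists_qPoly_eq_basisPoly h.1 h.2).choose else 0

lemma qPoly_basisForm {m n : ℕ} (hn : 1 ≤ n) (hnm : n ≤ m) :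
    qPoly m (basisForm m n) = basisPoly m n := by
  rw [basisForm, dif_pos ⟨hn, hnm⟩]
  exact (exists_qPoly_eq_basisPoly hn hnm).choose_spec

/-- The map induced by `qPoly` on the quotient by the forms without `q ^ 0`-term. -/
noncomputable def qPolyQuot (m : ℕ) : (JZ m ⧸ JZq m) →ₗ[ℤ] Polynomial ℤ :=
  (QuotientAddGroup.lift (JZq m) (qPoly m) fun _ hx => qPoly_eq_zero_iff.mpr hx).toIntLinearMap

@[simp] lemma qPolyQuot_mk {m : ℕ} (x : JZ m) :
    qPolyQuot m (QuotientAddGroup.mk x) = qPoly m x := rfl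

lemma qPolyQuot_injective (m : ℕ) : Function.Injective (qPolyQuot m) := by
  rw [injective_iff_map_eq_zero]
  intro x hx
  induction x using QuotientAddGroup.induction_on with
  | H x => exact (QuotientAddGroup.eq_zero_iff x).mpr (qPoly_eq_zero_iff.mp hx)

lemma linearIndependent_basisPoly (m : ℕ) :
    LinearIndependent ℤ fun n : Finset.Icc 1 m => basisPoly m n := by
  rw [Fintype.linearIndependent_iff]
  intro c hc n
  have hn := Finset.mem_Icc.mp n.2
  have h12 : 0 < 12 / Nat.gcd 12 m :=
    Nat.div_pos (Nat.gcd_le_left _ (by norm_num)) (Nat.gcd_pos_of_pos_left _ (by norm_num))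
  -- For n = 1 the constant term is tested instead of the coefficient of X; it equals 12/(12, m),
  -- and the powers X^k with k ≥ 2 do not meet it.
  have h1 := congrArg (fun p => Polynomial.coeff p (if (n : ℕ) = 1 then 0 else n)) hc
  simp only [Polynomial.finsetSum_coeff, Polynomial.coeff_smul, Polynomial.coeff_zero,
    smul_eq_mul] at h1
  rw [Finset.sum_eq_single n] at h1
  · refine (mul_eq_zero.mp h1).resolve_right ?_
    rw [basisPoly]
    split_ifs with h
    · rw [Polynomial.coeff_add, Polynomial.coeff_C_zero, Polynomial.mul_coeff_zero,
        Polynomial.coeff_X_zero, mul_zero, add_zero]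
      exact Int.natCast_ne_zero.mpr h12.ne'
    · simp
  · intro k _ hk
    have hk' : (k : ℕ) ≠ n := fun h => hk (Subtype.ext h)
    have hk1 := Finset.mem_Icc.mp k.2
    rw [basisPoly]
    split_ifs with h h' h'
    · omega
    · rw [Polynomial.coeff_add, Polynomial.coeff_C_mul, Polynomial.coeff_X, if_neg (by omega),
        Polynomial.coeff_C, if_neg (by omega)]
      simp
    · rw [Polynomial.coeff_X_pow, if_neg (by omega), mul_zero]
    · rw [Polynomial.coeff_X_pow, if_neg (Ne.symm hk'), mul_zero]
  · simp

/-- The classes of the forms `basisForm m n` form a basis. -/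
noncomputable def quotBasis {m : ℕ} (hm : 1 ≤ m) :
    Module.Basis (Finset.Icc 1 m) ℤ (JZ m ⧸ JZq m) :=
  Module.Basis.mk (v := fun n => QuotientAddGroup.mk (basisForm m n))
    (LinearIndependent.of_comp (qPolyQuot m) (by
      convert linearIndependent_basisPoly m with n
      have hn := Finset.mem_Icc.mp n.2
      exact qPoly_basisForm hn.1 hn.2)) (by
    rintro x -
    induction x using QuotientAddGroup.induction_on with
    | H x =>
    obtain ⟨t, h0, h1⟩ := exists_eq_mul_of_mul_eq (coeff_qPoly x)
    have hx : (QuotientAddGroup.mk x : JZ m ⧸ JZq m) =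
        t • (QuotientAddGroup.mk (basisForm m 1) : JZ m ⧸ JZq m) +
        ∑ n ∈ Finset.Icc 2 m, (qPoly m x).coeff n •
          (QuotientAddGroup.mk (basisForm m n) : JZ m ⧸ JZq m) := by
      apply qPolyQuot_injective
      rw [map_add, map_sum, map_smul, qPolyQuot_mk, qPolyQuot_mk, qPoly_basisForm le_rfl hm]
      conv_lhs => rw [eq_lin_add_sum (natDegree_qPoly_le x), h0, h1]
      congr 1
      · rw [basisPoly, if_pos rfl, zsmul_eq_mul]
        simp only [map_mul, eq_intCast]
        ring
      · refine Finset.sum_congr rfl fun n hn => ?_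
        obtain ⟨hn2, hnm⟩ := Finset.mem_Icc.mp hn
        rw [map_smul, qPolyQuot_mk, qPoly_basisForm (by omega) hnm, basisPoly, if_neg (by omega)]
    rw [hx]
    refine add_mem (Submodule.smul_mem _ _ (Submodule.subset_span
      ⟨⟨1, Finset.mem_Icc.mpr ⟨le_rfl, hm⟩⟩, rfl⟩)) (sum_mem fun n hn => Submodule.smul_mem _ _
        (Submodule.subset_span ⟨⟨n, ?_⟩, rfl⟩))
    obtain ⟨hn2, hnm⟩ := Finset.mem_Icc.mp hn
    exact Finset.mem_Icc.mpr ⟨by omega, hnm⟩)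

lemma quotBasis_apply {m : ℕ} (hm : 1 ≤ m) (n : Finset.Icc 1 m) :
    quotBasis hm n = QuotientAddGroup.mk (basisForm m n) := by
  rw [quotBasis, Module.Basis.mk_apply]

lemma hasQZeroTerm_basisForm {m n : ℕ} (hn : 2 ≤ n) (hnm : n ≤ m) :
    HasQZeroTerm (basisForm m n) (uPoly ℂ ^ n) := by
  have h := (hasQPoly_qPoly (basisForm m n)).hasQZeroTerm
  rwa [qPoly_basisForm (by omega) hnm, basisPoly, if_neg (by omega), Polynomial.map_pow,
    Polynomial.map_X, map_pow, Polynomial.aeval_X] at h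

lemma uPoly_sq : uPoly ℂ ^ 2 = T 2 - C 4 * T 1 + C 6 - C 4 * T (-1) + T (-2) := by
  rw [show (2 : ℤ) = 1 + 1 by norm_num, show (-(1 + 1) : ℤ) = -1 + -1 by norm_num, T_add, T_add,
    map_ofNat, map_ofNat, uPoly]
  linear_combination 2 * T_one_mul_T_neg_one (R := ℂ)

lemma hasQZeroTerm_basisForm_one {m : ℕ} (hm : 1 ≤ m) :
    HasQZeroTerm (basisForm m 1) (C (1 / (Nat.gcd 12 m : ℂ)) *
      (C (m : ℂ) * T 1 + C (12 - 2 * (m : ℂ)) + C (m : ℂ) * T (-1))) := by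
  have h := (hasQPoly_qPoly (basisForm m 1)).hasQZeroTerm
  rw [qPoly_basisForm le_rfl hm, basisPoly, if_pos rfl] at h
  convert h using 1
  have hg : (Nat.gcd 12 m : ℂ) ≠ 0 :=
    Nat.cast_ne_zero.mpr (Nat.gcd_pos_of_pos_left _ (by norm_num)).ne'
  rw [Polynomial.map_add, Polynomial.map_mul, Polynomial.map_C, Polynomial.map_C, Polynomial.map_X,
    map_add, map_mul, Polynomial.aeval_X, Polynomial.aeval_C, Polynomial.aeval_C, uPoly,
    eq_intCast, eq_intCast, Int.cast_natCast, Int.cast_natCast,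
    Nat.cast_div (Nat.gcd_dvd_left 12 m) hg, Nat.cast_div (Nat.gcd_dvd_right 12 m) hg]
  change _ = C (((12 : ℕ) : ℂ) / (Nat.gcd 12 m : ℂ)) + C ((m : ℂ) / (Nat.gcd 12 m : ℂ)) *
    (T 1 - 2 + T (-1))
  rw [div_eq_mul_one_div ((12 : ℕ) : ℂ), div_eq_mul_one_div (m : ℂ), map_mul, map_mul, map_sub,
    map_mul, map_ofNat, map_ofNat, Nat.cast_ofNat, map_ofNat]
  ring

/-! ### Algebraic independence -/

lemma tendsto_modularForm_atImInfty {k : ℤ} (f : ModularForm 𝒮ℒ k) :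
    Filter.Tendsto f atImInfty (𝓝 (PowerSeries.constantCoeff (qExpansion 1 f))) := by
  have hper := SlashInvariantFormClass.periodic_comp_ofComplex f one_mem_strictPeriods_SL
  have hanal := ModularFormClass.analyticAt_cuspFunction_zero f one_pos one_mem_strictPeriods_SL
  rw [← PowerSeries.coeff_zero_eq_constantCoeff_apply, qExpansion_coeff_zero one_pos hanal hper,
    ← cuspFunction_apply_zero one_pos hanal hper]
  exact (hanal.continuousAt.tendsto.comp (qParam_tendsto_atImInfty one_pos)).congr fun τ =>
    SlashInvariantFormClass.eq_cuspFunction f τ one_mem_strictPeriods_SL one_ne_zero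

lemma tendsto_E₄ : Filter.Tendsto ModularForm.E₄ atImInfty (𝓝 1) := by
  have h := tendsto_modularForm_atImInfty ModularForm.E₄
  rwa [ModularForm.E₄, constantCoeff_qExpansion_E _ (by decide : Even 4)] at h

lemma tendsto_E₆ : Filter.Tendsto ModularForm.E₆ atImInfty (𝓝 1) := by
  have h := tendsto_modularForm_atImInfty ModularForm.E₆
  rwa [ModularForm.E₆, constantCoeff_qExpansion_E _ (by decide : Even 6)] at h

lemma polynomial_eq_zero_of_tendsto {ι : Type*} {l : Filter ι} [l.NeBot] {g : ι → ℂ}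
    (hg : Filter.Tendsto g l Filter.cofinite) {P : Polynomial ℂ}
    (h : ∀ᶠ i in l, P.eval (g i) = 0) : P = 0 := by
  by_contra hP
  have h1 : ∀ᶠ x in Filter.cofinite, P.eval x ≠ 0 := by
    rw [Filter.eventually_cofinite]
    simpa using Polynomial.finite_setOfPred_isRoot hP
  obtain ⟨i, hi, hi'⟩ := (h.and (hg.eventually h1)).exists
  exact hi' hi

lemma polynomial_eq_zero_of_forall_ne_zero {P : Polynomial ℂ} (h : ∀ x ≠ 0, P.eval x = 0) : P = 0 :=
  polynomial_eq_zero_of_tendsto (l := 𝓝[≠] (0 : ℂ)) (g := id) (nhdsNE_le_cofinite _)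
    (Filter.eventually_of_mem self_mem_nhdsWithin h)

/-- The limit 1 is not attained near i∞ since Δ has no zeros; hence the quotient eventually leaves
every finite set, as needed for `polynomial_eq_zero_of_tendsto`. -/
lemma tendsto_E_ratio : Filter.Tendsto
    (fun τ : ℍ => ModularForm.E₄ τ ^ 3 / ModularForm.E₆ τ ^ 2) atImInfty (𝓝[≠] 1) := by
  refine tendsto_nhdsWithin_iff.mpr ⟨?_, ?_⟩
  · have h := (tendsto_E₄.pow 3).div (tendsto_E₆.pow 2) (by norm_num)
    rwa [one_pow, one_pow, div_one] at h
  · filter_upwards [tendsto_E₆.eventually_ne one_ne_zero] with τ h h1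
    have h2 := ModularForm.discriminant_eq_E₄_cube_sub_E₆_sq τ
    rw [Set.mem_singleton_iff, div_eq_one_iff_eq (pow_ne_zero 2 h)] at h1
    rw [h1, sub_self, zero_div] at h2
    exact ModularForm.discriminant_ne_zero τ h2

lemma exists_polynomial_eval_eq (q : MvPolynomial (Fin 3) ℂ) (g : Fin 3 → Polynomial ℂ) :
    ∃ P : Polynomial ℂ, ∀ x, P.eval x = MvPolynomial.eval (fun i => (g i).eval x) q :=
  ⟨MvPolynomial.aeval g q, fun x => by
    rw [← Polynomial.coe_evalRingHom, MvPolynomial.map_aeval, MvPolynomial.coe_eval₂Hom,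
      MvPolynomial.eval₂_eq_eval_map]
    rw [show (Polynomial.evalRingHom x).comp (algebraMap ℂ (Polynomial ℂ)) = RingHom.id ℂ from
      RingHom.ext fun a => by simp, MvPolynomial.map_id]⟩

/-- The value of `φ_{0,1}`, `φ_{0,2}`, `φ_{0,3}` in terms of `φ_{0,1}`, `E₄ φ_{-2,1} ^ 2` and
`E₆ φ_{-2,1} ^ 3`. -/
noncomputable def generatorPoint {R : Type*} [CommRing R] [Algebra ℂ R] (x v w : R) : Fin 3 → R :=
  ![x, (24 : ℂ)⁻¹ • (x ^ 2 - v), (432 : ℂ)⁻¹ • (x ^ 3 - 3 * v * x + 2 * w)]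

lemma eval_generatorPoint (a b c : Polynomial ℂ) (x : ℂ) :
    (fun i => (generatorPoint a b c i).eval x) =
      generatorPoint (a.eval x) (b.eval x) (c.eval x) := by
  funext i
  fin_cases i <;> simp [generatorPoint, mul_add]

lemma exists_polynomial_generatorPoint (q : MvPolynomial (Fin 3) ℂ) (a b c : Polynomial ℂ) :
    ∃ P : Polynomial ℂ, ∀ x,
      P.eval x = MvPolynomial.eval (generatorPoint (a.eval x) (b.eval x) (c.eval x)) q := by
  obtain ⟨P, hP⟩ := exists_polynomial_eval_eq q (generatorPoint a b c)
  exact ⟨P, fun x => by rw [hP, eval_generatorPoint]⟩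

/-- A polynomial that vanishes at all values of the generators vanishes. -/
lemma eq_zero_of_eval_generators (q : MvPolynomial (Fin 3) ℂ)
    (h : ∀ (t : ℂ) (τ : ℍ) (z : ℂ),
      MvPolynomial.eval ![t * phi01 τ z, t ^ 2 * phi02 τ z, t ^ 3 * phi03 τ z] q = 0) : q = 0 := by
  -- In the coordinates x, v, w of `generatorPoint` the known zeros are (t φ_{0,1}, t² E₄ φ_{-2,1}²,
  -- t³ E₆ φ_{-2,1}³). The following steps free one coordinate after another until q vanishes
  -- everywhere.
  have h0 : ∀ (t : ℂ) (τ : ℍ) (z : ℂ), MvPolynomial.eval (generatorPoint (t * phi01 τ z)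
      (t ^ 2 * (ModularForm.E₄ τ * phiNeg τ z ^ 2)) (t ^ 3 * (ModularForm.E₆ τ * phiNeg τ z ^ 3)))
      q = 0 := by
    intro t τ z
    rw [← h t τ z]
    congr 2
    rw [generatorPoint, smul_eq_mul, smul_eq_mul]
    congr 2
    · linear_combination -(24 : ℂ)⁻¹ * t ^ 2 * phi02_relation τ z
    · congr 1
      linear_combination -(432 : ℂ)⁻¹ * t ^ 3 * phi03_relation τ z
  -- With t = s / φ_{-2,1} and z → 0 the last two coordinates stay fixed while φ_{0,1} / φ_{-2,1}
  -- tends to infinity, so x becomes free.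
  have h1 : ∀ (s : ℂ) (τ : ℍ) (x : ℂ), MvPolynomial.eval (generatorPoint (s * x)
      (s ^ 2 * ModularForm.E₄ τ) (s ^ 3 * ModularForm.E₆ τ)) q = 0 := by
    intro s τ x
    obtain ⟨P, hP⟩ := exists_polynomial_generatorPoint q (Polynomial.C s * Polynomial.X)
      (Polynomial.C (s ^ 2 * ModularForm.E₄ τ)) (Polynomial.C (s ^ 3 * ModularForm.E₆ τ))
    simp only [Polynomial.eval_mul, Polynomial.eval_C, Polynomial.eval_X] at hP
    rw [← hP, polynomial_eq_zero_of_tendsto (((Filter.tendsto_inv₀_nhdsNE_zero).comp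
      (tendsto_phi_ratio τ)).mono_right (Bornology.le_cofinite _)) (P := P), Polynomial.eval_zero]
    filter_upwards [phiNeg_ne_zero_near τ 0] with z hz
    rw [hP, ← h0 (s / phiNeg τ z) τ z]
    congr 2
    simp only [Function.comp]
    field_simp
  -- The choice s = r E₄ / E₆ gives (r² c, r³ c) with c = E₄³ / E₆²; letting τ → i∞ supplies
  -- infinitely many values of c.
  have h2 : ∀ r x c : ℂ, r ≠ 0 →
      MvPolynomial.eval (generatorPoint x (r ^ 2 * c) (r ^ 3 * c)) q = 0 := by
    intro r x c hr
    obtain ⟨P, hP⟩ := exists_polynomial_generatorPoint q (Polynomial.C x)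
      (Polynomial.C (r ^ 2) * Polynomial.X) (Polynomial.C (r ^ 3) * Polynomial.X)
    simp only [Polynomial.eval_mul, Polynomial.eval_C, Polynomial.eval_X] at hP
    rw [← hP, polynomial_eq_zero_of_tendsto (tendsto_E_ratio.mono_right (nhdsNE_le_cofinite _))
      (P := P), Polynomial.eval_zero]
    filter_upwards [tendsto_E₄.eventually_ne one_ne_zero,
      tendsto_E₆.eventually_ne one_ne_zero] with τ h4 h6
    rw [hP, ← h1 (r * ModularForm.E₄ τ / ModularForm.E₆ τ) τ
      (x / (r * ModularForm.E₄ τ / ModularForm.E₆ τ))]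
    congr 2
    field_simp
  -- Solving v = r² c and w = r³ c gives r = w/v and c = v³/w²; the cases v = 0 and w = 0 are
  -- recovered afterwards, one variable at a time.
  have h3 : ∀ x v w : ℂ, v ≠ 0 → w ≠ 0 → MvPolynomial.eval (generatorPoint x v w) q = 0 := by
    intro x v w hv hw
    rw [← h2 (w / v) x (v ^ 3 / w ^ 2) (div_ne_zero hw hv)]
    congr 2
    field_simp
  have h4 : ∀ x v w : ℂ, w ≠ 0 → MvPolynomial.eval (generatorPoint x v w) q = 0 := by
    intro x v w hw
    obtain ⟨P, hP⟩ := exists_polynomial_generatorPoint q (Polynomial.C x) Polynomial.X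
      (Polynomial.C w)
    simp only [Polynomial.eval_C, Polynomial.eval_X] at hP
    rw [← hP, polynomial_eq_zero_of_forall_ne_zero (P := P) fun y hy => by
      rw [hP, h3 x y w hy hw], Polynomial.eval_zero]
  have h5 : ∀ x v w : ℂ, MvPolynomial.eval (generatorPoint x v w) q = 0 := by
    intro x v w
    obtain ⟨P, hP⟩ := exists_polynomial_generatorPoint q (Polynomial.C x) (Polynomial.C v)
      Polynomial.X
    simp only [Polynomial.eval_C, Polynomial.eval_X] at hP
    rw [← hP, polynomial_eq_zero_of_forall_ne_zero (P := P) fun y hy => by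
      rw [hP, h4 x v y hy], Polynomial.eval_zero]
  -- The change of coordinates is triangular, and its inverse is written out.
  refine MvPolynomial.funext fun y => ?_
  rw [map_zero, ← h5 (y 0) (y 0 ^ 2 - 24 * y 1)
    ((432 * y 2 - y 0 ^ 3 + 3 * (y 0 ^ 2 - 24 * y 1) * y 0) / 2)]
  congr 2
  funext i
  fin_cases i <;> simp [generatorPoint]
  ring

/-- The value at `(τ, z)` of the elements of the graded ring, a form of index `m` being multiplied
by `t ^ m`. -/
noncomputable def evalForm (t : ℂ) (τ : ℍ) (z : ℂ) : (⨁ m, JZ m) →+* ℂ :=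
  DirectSum.toSemiring
    (fun m => AddMonoidHom.mk' (fun x : JZ m => t ^ m * (x : ℍ → ℂ → ℂ) τ z) fun x y => by
      rw [AddSubgroup.coe_add, Pi.add_apply, Pi.add_apply, mul_add])
    (by
      change t ^ 0 * (1 : ℍ → ℂ → ℂ) τ z = 1
      simp)
    (fun {i j} x y => by
      change t ^ (i + j) * ((x : ℍ → ℂ → ℂ) * (y : ℍ → ℂ → ℂ)) τ z = t ^ i * (x : ℍ → ℂ → ℂ) τ z *
        (t ^ j * (y : ℍ → ℂ → ℂ) τ z)
      rw [Pi.mul_apply, Pi.mul_apply, pow_add]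
      ring)

lemma evalForm_of (t : ℂ) (τ : ℍ) (z : ℂ) {m : ℕ} (x : JZ m) :
    evalForm t τ z (DirectSum.of (fun m => JZ m) m x) = t ^ m * (x : ℍ → ℂ → ℂ) τ z :=
  DirectSum.toSemiring_of _ _ _ _ _

/-- The evaluations with the extra variable t keep track of the index, so an inhomogeneous relation
in the graded ring becomes a polynomial identity for all t, τ, z. -/
theorem algebraicIndependent_generators :
    AlgebraicIndependent ℤ ![DirectSum.of (fun m => JZ m) 1 ⟨phi01, phi01_mem⟩,
      DirectSum.of (fun m => JZ m) 2 ⟨phi02, phi02_mem⟩,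
      DirectSum.of (fun m => JZ m) 3 ⟨phi03, phi03_mem⟩] := by
  rw [algebraicIndependent_iff]
  intro p hp
  refine MvPolynomial.map_injective (Int.castRingHom ℂ) Int.cast_injective ?_
  rw [map_zero]
  refine eq_zero_of_eval_generators _ fun t τ z => ?_
  have h := congrArg (evalForm t τ z) hp
  rw [MvPolynomial.map_aeval, map_zero] at h
  rw [MvPolynomial.eval_map, ← h, MvPolynomial.coe_eval₂Hom]
  congr 1
  · exact RingHom.ext_int _ _
  · funext i
    fin_cases i
    · exact (pow_one t ▸ evalForm_of t τ z (⟨phi01, phi01_mem⟩ : JZ 1)).symm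
    · exact (evalForm_of t τ z (⟨phi02, phi02_mem⟩ : JZ 2)).symm
    · exact (evalForm_of t τ z (⟨phi03, phi03_mem⟩ : JZ 3)).symm

/-! ### Normalisation and uniqueness of φ_{0,1} -/

lemma uPoly_add_twelve : 12 + uPoly ℂ = T 1 + C 10 + T (-1) := by
  rw [uPoly, map_ofNat]
  ring

lemma hasQZeroTerm_phi01 : HasQZeroTerm phi01 (T 1 + C 10 + T (-1)) := by
  have h := hasQPoly_phi01.hasQZeroTerm
  rwa [Polynomial.map_add, Polynomial.map_ofNat, Polynomial.map_X, map_add, Polynomial.aeval_X,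
    map_ofNat, uPoly_add_twelve] at h

lemma eq_phi01 {φ : ℍ → ℂ → ℂ} (h : IsWeakJacobiForm 0 1 φ)
    (h0 : HasQZeroTerm φ (T 1 + C 10 + T (-1))) : φ = phi01 := by
  obtain ⟨f, hf⟩ := h.exists_modularForms Even.zero
  have h1 : φ = phiSum 1 fun j => f j := funext fun τ => funext fun z => hf τ z
  have h2 := jacobiExp_phiSum (k := 0) 1 (fun _ => rfl) f
  rw [← h1] at h2
  exact IsWeakJacobiForm.eq_of_constantCoeff_eq (by norm_num) h2 jacobiExp_phi01
    ((h2.hasExp.constantCoeff_eq h0).trans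
      (jacobiExp_phi01.hasExp.constantCoeff_eq hasQZeroTerm_phi01).symm)

end WeakJacobi

theorem theorem1p9 :
    (∀ m : ℕ, 1 ≤ m →
      Module.Free ℤ (JZ m ⧸ JZq m) ∧ Module.finrank ℤ (JZ m ⧸ JZq m) = m ∧
      ∃ (ψ : ℕ → JZ m) (b : Module.Basis (Finset.Icc 1 m) ℤ (JZ m ⧸ JZq m)),
        (∀ n : Finset.Icc 1 m, b n = QuotientAddGroup.mk (ψ n)) ∧
        (∀ n : ℕ, 3 ≤ n → n ≤ m → ∃ P : LaurentPolynomial ℂ,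
          HasQZeroTerm (ψ n) P ∧ P.coeff (n : ℤ) = 1 ∧ P.coeff (-(n : ℤ)) = 1 ∧
            ∀ l : ℤ, (n : ℤ) < |l| → P.coeff l = 0) ∧
        (2 ≤ m → HasQZeroTerm (ψ 2)
          (T 2 - C 4 * T 1 + C 6 - C 4 * T (-1) + T (-2))) ∧
        HasQZeroTerm (ψ 1) (C (1 / (Nat.gcd 12 m : ℂ)) *
          (C (m : ℂ) * T 1 + C (12 - 2 * (m : ℂ)) + C (m : ℂ) * T (-1)))) ∧
    (∃ (φ₁ : JZ 1) (φ₂ : JZ 2) (φ₃ : JZ 3) (φ₄ : JZ 4),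
      (HasQZeroTerm φ₁ (T 1 + C 10 + T (-1)) ∧
        ∀ φ : ℍ → ℂ → ℂ, IsWeakJacobiForm 0 1 φ →
          HasQZeroTerm φ (T 1 + C 10 + T (-1)) → φ = φ₁) ∧
      (φ₂ : ℍ → ℂ → ℂ) = phi02 ∧ (φ₃ : ℍ → ℂ → ℂ) = phi03 ∧ (φ₄ : ℍ → ℂ → ℂ) = phi04 ∧
      Algebra.adjoin ℤ ({DirectSum.of (fun m => JZ m) 1 φ₁, DirectSum.of (fun m => JZ m) 2 φ₂,
        DirectSum.of (fun m => JZ m) 3 φ₃, DirectSum.of (fun m => JZ m) 4 φ₄} :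
          Set (⨁ m, JZ m)) = ⊤ ∧
      AlgebraicIndependent ℤ ![DirectSum.of (fun m => JZ m) 1 φ₁,
        DirectSum.of (fun m => JZ m) 2 φ₂, DirectSum.of (fun m => JZ m) 3 φ₃] ∧
      4 * DirectSum.of (fun m => JZ m) 4 φ₄ =
        DirectSum.of (fun m => JZ m) 1 φ₁ * DirectSum.of (fun m => JZ m) 3 φ₃ -
          DirectSum.of (fun m => JZ m) 2 φ₂ ^ 2) := by
  -- For every n ≥ 2 the q^0-term of the basis form is u^n; its expansion for n = 2 is the
  -- prescribed Laurent polynomial.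
  refine ⟨fun m hm => ⟨Module.Free.of_basis (quotBasis hm), ?_, basisForm m, quotBasis hm,
    quotBasis_apply hm, fun n hn hnm => ⟨uPoly ℂ ^ n, hasQZeroTerm_basisForm (by omega) hnm,
      coeff_uPoly_pow_self n, coeff_uPoly_pow_neg n, fun l hl => coeff_uPoly_pow_of_lt n hl⟩,
    fun h2 => uPoly_sq ▸ hasQZeroTerm_basisForm le_rfl h2, hasQZeroTerm_basisForm_one hm⟩,
    ⟨phi01, phi01_mem⟩, ⟨phi02, phi02_mem⟩, ⟨phi03, phi03_mem⟩, ⟨phi04, phi04_mem⟩,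
    ⟨hasQZeroTerm_phi01, fun φ h h0 => eq_phi01 h h0⟩, rfl, rfl, rfl, adjoin_generators_eq_top,
    algebraicIndependent_generators, four_mul_of_phi04⟩
  rw [Module.finrank_eq_card_basis (quotBasis hm), Fintype.card_coe, Nat.card_Icc,
    Nat.add_sub_cancel]
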